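/- Let $n\ge 0$ and let $\eta=(\eta^{ij})$ be an invertible complex $n\times n$ matrix with inverse $(\eta_{ij})$ (for instance a real symmetric or hermitian metric; if $\eta$ is not symmetric, all the algebras below are zero). Sums over repeated indices are understood. Let $\mathcal A=W(2n|n)$ be the unital associative $\mathbb C$-algebra with generators $x^i,\partial_i,\gamma^i$ ($1\le i\le n$) and relations $$x^ix^j=x^jx^i,\quad \partial_i\partial_j=\partial_j\partial_i,\quad \partial_ix^j-x^j\partial_i=\delta_i^j,\quad \gamma^ix^j=x^j\gamma^i,\quad \gamma^i\partial_j=\partial_j\gamma^i,\quad \gamma^i\gamma^j+\gamma^j\gamma^i=2\eta^{ij}.$$ Put $x_i=\eta_{ij}x^j$, $\partial^i=\eta^{ij}\partial_j$, $\gamma_i=\eta_{ij}\gamma^j$ and $$X=\tfrac{\sqrt{-1}}{\sqrt2}\gamma^i\partial_i,\quad Y=\tfrac{\sqrt{-1}}{\sqrt2}\gamma^ix_i,\quad H=-\tfrac12(\partial_ix^i+x^i\partial_i),\quad E=X^2,\quad F=-Y^2,$$ $\mathfrak g_+=\mathbb CX+\mathbb CE$, $\mathfrak g_-=\mathbb CY+\mathbb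 CF$. Let $\mathcal A'$ be the localization of $\mathcal A$ at the multiplicative set generated by $\{H+k:k\in\mathbb Z\}$, $I'=\mathcal A'\mathfrak g_+$, $\mathrm{II}=\mathfrak g_-\mathcal A'+\mathcal A'\mathfrak g_+$, and write $\bar a=a+\mathrm{II}\in\mathcal A'/\mathrm{II}$. Let $P=\sum_{k\ge0}\varphi_k(H)Y^kX^k$ with $\varphi_k(H)=\prod_{j=1}^k(-1)^j/\kappa_j(H)$, $\kappa_j(H)=-j/2$ for $j$ even and $\kappa_j(H)=H+\frac{j+1}2$ for $j$ odd; $P$ acts on $\mathcal A'/I'$ (the sum is finite on each vector). The diamond product on $\mathcal A'/\mathrm{II}$ is $\bar a\diamond\bar b=aPb+\mathrm{II}$. The localized Dirac reduction algebra is $Z_n'=N/I'$, where $N=\{a\in\mathcal A': I'a\subset I'\}$. For a rational function $\phi\in\mathbb C(t)$ with poles only at integers, $\phi(H)\in\mathcal A'$, and $\phi(H)\bar a$ denotes $\overline{\phi(H)}\diamond\bar a$. **Theorem.** 1. The map $Z_n'\to\mathcal A'/\mathrm{II}$, $z+I'\mapsto z+\mathrm{II}$, is a bijection taking the product of $Z_n'$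 to $\diamond$, and its inverse is $\bar a\mapsto P(a+I')$. 2. For all $\phi\in\mathbb C(t)$ with poles only at integers, all $a\in\mathcal A'$ and all $i,j$: $$\overline{\phi(H)}\diamond\bar a=\overline{\phi(H)a},\qquad \bar a\diamond\overline{\phi(H)}=\overline{a\phi(H)},$$ $$\overline{\phi(H)}\diamond\overline{x^i}=\overline{x^i}\diamond\overline{\phi(H-1)},\quad \overline{\phi(H)}\diamond\overline{\partial_i}=\overline{\partial_i}\diamond\overline{\phi(H+1)},\quad \overline{\phi(H)}\diamond\overline{\gamma^i}=\overline{\gamma^i}\diamond\overline{\phi(H)},$$ $$\overline{x^i}\diamond\overline{x^j}=\overline{x^j}\diamond\overline{x^i},\qquad \overline{\partial_i}\diamond\overline{\partial_j}=\overline{\partial_j}\diamond\overline{\partial_i},$$ $$\overline{\partial_i}\diamond\overline{\gamma^j}-\overline{\gamma^j}\diamond\overline{\partial_i}=\tfrac1H\,\overline{\gamma_i}\diamond\overline{\partial^j},$$ $$\overline{\gamma^i}\diamond\overline{\gamma^j}+\overline{\gamma^j}\diamond\overline{\gamma^i}=2\eta^{ij}\bar1+\tfrac2{H+1}\bigl(\overline{x^j}\diamond\overline{\partial^i}+\overline{x^i}\diamond\overline{\partial^j}\bigr),$$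 $$\overline{\partial_i}\diamond\overline{x^j}-\overline{x^j}\diamond\overline{\partial_i}=\delta_i^j\bar1+\tfrac1{2H}\,\overline{\gamma_i}\diamond\overline{\gamma^j}+\tfrac1{H+1}\,\overline{x_i}\diamond\overline{\partial^j},$$ $$\overline{\gamma^i}\diamond\overline{x^j}-\overline{x^j}\diamond\overline{\gamma^i}=\tfrac1{H+1}\,\overline{x^i}\diamond\overline{\gamma^j},$$ $$\overline{x^i}\diamond\overline{\partial_i}=\bigl(-\tfrac n2-H\bigr)\bar1,\qquad \overline{\gamma^i}\diamond\overline{\partial_i}=0,\qquad \overline{\gamma_i}\diamond\overline{x^i}=0,$$ the last three being sums over $i$. 3. These relations are a complete presentation: the unital associative $\mathbb C$-algebra with generators $x^i,\partial_i,\gamma^i$ ($1\le i\le n$), $H$ and $\frac1{H+k}$ ($k\in\mathbb Z$), subject to $\frac1{H+k}(H+k)=(H+k)\frac1{H+k}=1$, $Hx^i=x^i(H-1)$, $H\partial_i=\partial_i(H+1)$, $H\gamma^i=\gamma^iH$, $x^ix^j=x^jx^i$, $\partial_i\partial_j=\partial_j\partial_i$ and the seven displayed relations from $\partial_i,\gamma^j$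 on (with $\diamond$ replaced by the product), is isomorphic to $Z_n'$ by an algebra isomorphism which, followed by the bijection of part 1, takes each generator to its class in $\mathcal A'/\mathrm{II}$. -/

import Mathlib

namespace DiracReduction

/-- Generators `x^i`, `∂_i`, `γ^i` of the Weyl-Clifford algebra. -/
inductive Gen (n : ℕ)
  | x (i : Fin n)
  | d (i : Fin n)
  | g (i : Fin n)

/-- Defining relations of the Weyl-Clifford algebra `W(2n|n)` of the metric `η^{ij}`. -/
inductive WCRel {n : ℕ} (η : GL (Fin n) ℂ) :
    FreeAlgebra ℂ (Gen n) → FreeAlgebra ℂ (Gen n) → Prop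
  | x_x (i j : Fin n) : WCRel η
      (FreeAlgebra.ι ℂ (Gen.x i) * FreeAlgebra.ι ℂ (Gen.x j))
      (FreeAlgebra.ι ℂ (Gen.x j) * FreeAlgebra.ι ℂ (Gen.x i))
  | d_d (i j : Fin n) : WCRel η
      (FreeAlgebra.ι ℂ (Gen.d i) * FreeAlgebra.ι ℂ (Gen.d j))
      (FreeAlgebra.ι ℂ (Gen.d j) * FreeAlgebra.ι ℂ (Gen.d i))
  | d_x (i j : Fin n) : WCRel η
      (FreeAlgebra.ι ℂ (Gen.d i) * FreeAlgebra.ι ℂ (Gen.x j))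
      (FreeAlgebra.ι ℂ (Gen.x j) * FreeAlgebra.ι ℂ (Gen.d i)
        + algebraMap ℂ _ (if i = j then 1 else 0))
  | g_x (i j : Fin n) : WCRel η
      (FreeAlgebra.ι ℂ (Gen.g i) * FreeAlgebra.ι ℂ (Gen.x j))
      (FreeAlgebra.ι ℂ (Gen.x j) * FreeAlgebra.ι ℂ (Gen.g i))
  | g_d (i j : Fin n) : WCRel η
      (FreeAlgebra.ι ℂ (Gen.g i) * FreeAlgebra.ι ℂ (Gen.d j))
      (FreeAlgebra.ι ℂ (Gen.d j) * FreeAlgebra.ι ℂ (Gen.g i))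
  | g_g (i j : Fin n) : WCRel η
      (FreeAlgebra.ι ℂ (Gen.g i) * FreeAlgebra.ι ℂ (Gen.g j)
        + FreeAlgebra.ι ℂ (Gen.g j) * FreeAlgebra.ι ℂ (Gen.g i))
      (algebraMap ℂ _ (2 * (η : Matrix (Fin n) (Fin n) ℂ) i j))

/-- The Weyl-Clifford algebra `W(2n|n)`. -/
def WC {n : ℕ} (η : GL (Fin n) ℂ) : Type := RingQuot (WCRel η)

noncomputable instance {n : ℕ} (η : GL (Fin n) ℂ) : Ring (WC η) :=
  inferInstanceAs (Ring (RingQuot (WCRel η)))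

noncomputable instance {n : ℕ} (η : GL (Fin n) ℂ) : Algebra ℂ (WC η) :=
  inferInstanceAs (Algebra ℂ (RingQuot (WCRel η)))

section WC
variable {n : ℕ} (η : GL (Fin n) ℂ)

noncomputable def WC.mk : FreeAlgebra ℂ (Gen n) →ₐ[ℂ] WC η := RingQuot.mkAlgHom ℂ (WCRel η)

/-- `x^i`. -/
noncomputable def xU (i : Fin n) : WC η := WC.mk η (FreeAlgebra.ι ℂ (Gen.x i))
/-- `∂_i`. -/
noncomputable def dL (i : Fin n) : WC η := WC.mk η (FreeAlgebra.ι ℂ (Gen.d i))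
/-- `γ^i`. -/
noncomputable def gU (i : Fin n) : WC η := WC.mk η (FreeAlgebra.ι ℂ (Gen.g i))

theorem WC.mk_rel {a b : FreeAlgebra ℂ (Gen n)} (h : WCRel η a b) : WC.mk η a = WC.mk η b :=
  RingQuot.mkAlgHom_rel ℂ h

theorem x_x (i j : Fin n) : xU η i * xU η j = xU η j * xU η i := by
  simpa [xU, dL, gU] using WC.mk_rel η (WCRel.x_x i j)
theorem d_d (i j : Fin n) : dL η i * dL η j = dL η j * dL η i := by
  simpa [xU, dL, gU] using WC.mk_rel η (WCRel.d_d i j)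
theorem d_x (i j : Fin n) :
    dL η i * xU η j = xU η j * dL η i + algebraMap ℂ _ (if i = j then 1 else 0) := by
  simpa [xU, dL, gU] using WC.mk_rel η (WCRel.d_x i j)
theorem g_x (i j : Fin n) : gU η i * xU η j = xU η j * gU η i := by
  simpa [xU, dL, gU] using WC.mk_rel η (WCRel.g_x i j)
theorem g_d (i j : Fin n) : gU η i * dL η j = dL η j * gU η i := by
  simpa [xU, dL, gU] using WC.mk_rel η (WCRel.g_d i j)
theorem g_g (i j : Fin n) : gU η i * gU η j + gU η j * gU η i =
    algebraMap ℂ _ (2 * (η : Matrix (Fin n) (Fin n) ℂ) i j) := by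
  simpa [xU, dL, gU] using WC.mk_rel η (WCRel.g_g i j)

theorem WC.induction {p : WC η → Prop} (hs : ∀ c : ℂ, p (algebraMap ℂ _ c))
    (hx : ∀ i, p (xU η i)) (hd : ∀ i, p (dL η i)) (hg : ∀ i, p (gU η i))
    (hadd : ∀ a b, p a → p b → p (a + b)) (hmul : ∀ a b, p a → p b → p (a * b)) (a : WC η) :
    p a := by
  obtain ⟨a, rfl⟩ := RingQuot.mkAlgHom_surjective ℂ (WCRel η) a
  change p (WC.mk η a)
  induction a using FreeAlgebra.induction with
  | grade0 c => simpa using hs c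
  | grade1 v => cases v with
    | x i => exact hx i
    | d i => exact hd i
    | g i => exact hg i
  | mul a b ha hb => simpa using hmul _ _ ha hb
  | add a b ha hb => simpa using hadd _ _ ha hb

/-- `x_i = η_{ij} x^j`, where `(η_{ij})` is the inverse matrix of `(η^{ij})`. -/
noncomputable def xL (i : Fin n) : WC η :=
  ∑ j, ((η⁻¹ : GL (Fin n) ℂ) : Matrix (Fin n) (Fin n) ℂ) i j • xU η j
/-- `∂^i = η^{ij} ∂_j`. -/
noncomputable def dU (i : Fin n) : WC η := ∑ j, (η : Matrix (Fin n) (Fin n) ℂ) i j • dL η j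
/-- `γ_i = η_{ij} γ^j`. -/
noncomputable def gL (i : Fin n) : WC η :=
  ∑ j, ((η⁻¹ : GL (Fin n) ℂ) : Matrix (Fin n) (Fin n) ℂ) i j • gU η j

/-- `X = (i/√2) γ^i ∂_i`, a multiple of the Dirac operator. -/
noncomputable def Xop : WC η := (Complex.I / (Real.sqrt 2 : ℂ)) • ∑ i, gU η i * dL η i
/-- `Y = (i/√2) γ^i x_i`. -/
noncomputable def Yop : WC η := (Complex.I / (Real.sqrt 2 : ℂ)) • ∑ i, gU η i * xL η i
/-- `H = -(1/2)(∂_i x^i + x^i ∂_i)`. -/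
noncomputable def Hop : WC η := -((1 / 2 : ℂ) • ∑ i, (dL η i * xU η i + xU η i * dL η i))

theorem H_x (j : Fin n) : Hop η * xU η j = xU η j * Hop η - xU η j := by
  have key : ∀ i, (dL η i * xU η i + xU η i * dL η i) * xU η j
      = xU η j * (dL η i * xU η i + xU η i * dL η i) + (if i = j then (2:ℂ) else 0) • xU η i := by
    intro i
    have h1 := d_x η i j
    rw [add_mul, mul_assoc, x_x η i j, ← mul_assoc, h1, mul_assoc (xU η i), h1]
    split_ifs with h
    · simp only [map_one, two_smul, mul_add, add_mul, mul_one, one_mul, ← mul_assoc, x_x η i j]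
      abel
    · simp only [map_zero, zero_smul, mul_add, add_zero, ← mul_assoc, x_x η i j]
  have hS : (∑ i, (dL η i * xU η i + xU η i * dL η i)) * xU η j
      = xU η j * (∑ i, (dL η i * xU η i + xU η i * dL η i)) + (2 : ℂ) • xU η j := by
    rw [Finset.sum_mul, Finset.sum_congr rfl (fun i _ => key i), Finset.sum_add_distrib,
      ← Finset.mul_sum]
    simp only [ite_smul, zero_smul, Finset.sum_ite_eq', Finset.mem_univ, if_true]
  rw [Hop, neg_mul, mul_neg, smul_mul_assoc, mul_smul_comm, hS, smul_add, smul_smul]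
  norm_num
  abel

theorem H_d (j : Fin n) : Hop η * dL η j = dL η j * Hop η + dL η j := by
  have key : ∀ i, (dL η i * xU η i + xU η i * dL η i) * dL η j
      = dL η j * (dL η i * xU η i + xU η i * dL η i) - (if i = j then (2:ℂ) else 0) • dL η i := by
    intro i
    have h1 := d_x η j i
    have h2 : xU η i * dL η j = dL η j * xU η i - algebraMap ℂ _ (if j = i then 1 else 0) := by
      rw [h1]; abel
    rw [add_mul, mul_assoc, h2, mul_assoc (xU η i), d_d η i j, ← mul_assoc, h2]
    by_cases h : j = i
    · simp only [h, if_true, map_one, two_smul, mul_sub, sub_mul, mul_add, mul_one, one_mul,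
        ← mul_assoc]
      abel
    · simp only [h, Ne.symm h, if_false, map_zero, zero_smul, mul_add, sub_zero, ← mul_assoc,
        d_d η i j]
  have hS : (∑ i, (dL η i * xU η i + xU η i * dL η i)) * dL η j
      = dL η j * (∑ i, (dL η i * xU η i + xU η i * dL η i)) - (2 : ℂ) • dL η j := by
    rw [Finset.sum_mul, Finset.sum_congr rfl (fun i _ => key i), Finset.sum_sub_distrib,
      ← Finset.mul_sum]
    simp only [ite_smul, zero_smul, Finset.sum_ite_eq', Finset.mem_univ, if_true]
  rw [Hop, neg_mul, mul_neg, smul_mul_assoc, mul_smul_comm, hS, smul_sub, smul_smul]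
  norm_num
  abel

theorem H_g (j : Fin n) : Hop η * gU η j = gU η j * Hop η := by
  have key : ∀ i, (dL η i * xU η i + xU η i * dL η i) * gU η j
      = gU η j * (dL η i * xU η i + xU η i * dL η i) := by
    intro i
    rw [add_mul, mul_add, mul_assoc, ← g_x, ← mul_assoc, ← g_d, mul_assoc, mul_assoc (xU η i),
      ← g_d, ← mul_assoc (xU η i), ← g_x, mul_assoc]
  simp only [Hop, neg_mul, mul_neg, smul_mul_assoc, mul_smul_comm, Finset.sum_mul, Finset.mul_sum,
    key]

theorem eta_symm (i j : Fin n) : algebraMap ℂ (WC η) ((η : Matrix (Fin n) (Fin n) ℂ) i j)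
    = algebraMap ℂ (WC η) ((η : Matrix (Fin n) (Fin n) ℂ) j i) := by
  have h := g_g η i j
  rw [add_comm, g_g η j i, map_mul, map_mul] at h
  have h2 := congrArg (fun a => algebraMap ℂ (WC η) (1 / 2) * a) h
  simp only [← mul_assoc, ← map_mul] at h2
  norm_num at h2
  exact h2.symm

theorem eta_isSymm_or : (η : Matrix (Fin n) (Fin n) ℂ).IsSymm ∨ Subsingleton (WC η) := by
  rcases subsingleton_or_nontrivial (WC η) with h | h
  · exact Or.inr h
  · left
    ext i j
    exact (algebraMap ℂ (WC η)).injective (eta_symm η j i)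

theorem etaInv_symm (i j : Fin n) : algebraMap ℂ (WC η)
      (((η⁻¹ : GL (Fin n) ℂ) : Matrix (Fin n) (Fin n) ℂ) i j)
    = algebraMap ℂ (WC η)
      (((η⁻¹ : GL (Fin n) ℂ) : Matrix (Fin n) (Fin n) ℂ) j i) := by
  rcases eta_isSymm_or η with h | h
  · congr 1
    have : ((η⁻¹ : GL (Fin n) ℂ) : Matrix (Fin n) (Fin n) ℂ).IsSymm := by
      rw [Matrix.coe_units_inv, Matrix.IsSymm, Matrix.transpose_nonsing_inv, h.eq]
    exact (this.apply i j).symm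
  · exact Subsingleton.elim _ _

theorem c_sq : (Complex.I / (Real.sqrt 2 : ℂ)) * (Complex.I / (Real.sqrt 2 : ℂ)) = -(1 / 2) := by
  rw [div_mul_div_comm, Complex.I_mul_I, ← Complex.ofReal_mul, Real.mul_self_sqrt (by norm_num)]
  norm_num

theorem X_d (j : Fin n) : Xop η * dL η j = dL η j * Xop η := by
  simp only [Xop, smul_mul_assoc, mul_smul_comm, Finset.sum_mul, Finset.mul_sum]
  congr 1
  refine Finset.sum_congr rfl fun i _ => ?_
  rw [mul_assoc, d_d, ← mul_assoc, g_d, mul_assoc]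

theorem X_x (j : Fin n) :
    Xop η * xU η j = xU η j * Xop η + (Complex.I / (Real.sqrt 2 : ℂ)) • gU η j := by
  have key : ∀ i, gU η i * dL η i * xU η j
      = xU η j * (gU η i * dL η i) + (if i = j then (1 : ℂ) else 0) • gU η i := by
    intro i
    rw [mul_assoc, d_x, mul_add, ← mul_assoc, g_x, mul_assoc, Algebra.smul_def]
    rw [Algebra.commutes]
  have hS : (∑ i, gU η i * dL η i) * xU η j = xU η j * (∑ i, gU η i * dL η i) + gU η j := by
    rw [Finset.sum_mul, Finset.sum_congr rfl (fun i _ => key i), Finset.sum_add_distrib,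
      ← Finset.mul_sum]
    simp only [ite_smul, one_smul, zero_smul, Finset.sum_ite_eq', Finset.mem_univ, if_true]
  rw [Xop, smul_mul_assoc, hS, mul_smul_comm, smul_add]

theorem X_g (j : Fin n) :
    Xop η * gU η j = -(gU η j * Xop η) + (2 * (Complex.I / (Real.sqrt 2 : ℂ))) • dU η j := by
  have key : ∀ i, gU η i * dL η i * gU η j
      = -(gU η j * (gU η i * dL η i))
        + (2 : ℂ) • ((η : Matrix (Fin n) (Fin n) ℂ) j i • dL η i) := by
    intro i
    have h := g_g η i j
    rw [mul_assoc, ← g_d, ← mul_assoc, eq_sub_of_add_eq h, sub_mul, map_mul, eta_symm η i j,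
      ← map_mul, ← Algebra.smul_def, smul_smul, mul_assoc]
    abel
  have hS : (∑ i, gU η i * dL η i) * gU η j
      = -(gU η j * (∑ i, gU η i * dL η i)) + (2 : ℂ) • dU η j := by
    rw [Finset.sum_mul, Finset.sum_congr rfl (fun i _ => key i), Finset.sum_add_distrib,
      Finset.mul_sum, dU, Finset.smul_sum, Finset.sum_neg_distrib]
  rw [Xop, smul_mul_assoc, hS, mul_smul_comm, smul_add, smul_neg, smul_smul, mul_comm]

theorem X_du (j : Fin n) : Xop η * dU η j = dU η j * Xop η := by
  simp only [dU, Finset.mul_sum, Finset.sum_mul, mul_smul_comm, smul_mul_assoc, X_d]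

theorem E_d (j : Fin n) : Xop η * Xop η * dL η j = dL η j * (Xop η * Xop η) := by
  rw [mul_assoc, X_d, ← mul_assoc, X_d, mul_assoc]

theorem E_g (j : Fin n) : Xop η * Xop η * gU η j = gU η j * (Xop η * Xop η) := by
  rw [mul_assoc, X_g, mul_add, mul_neg, ← mul_assoc, X_g, mul_smul_comm, X_du, add_mul, neg_mul,
    smul_mul_assoc, mul_assoc]
  abel

theorem E_x (j : Fin n) : Xop η * Xop η * xU η j = xU η j * (Xop η * Xop η) - dU η j := by
  rw [mul_assoc, X_x, mul_add, ← mul_assoc, X_x, mul_smul_comm, X_g, add_mul, smul_add, smul_smul,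
    smul_mul_assoc, mul_assoc, smul_neg, mul_left_comm, c_sq]
  norm_num
  abel

theorem H_X : Hop η * Xop η = Xop η * Hop η + Xop η := by
  have key : ∀ i, Hop η * (gU η i * dL η i) = (gU η i * dL η i) * Hop η + gU η i * dL η i := by
    intro i
    rw [← mul_assoc, H_g, mul_assoc, H_d, mul_add, mul_assoc]
  rw [Xop, mul_smul_comm, smul_mul_assoc, Finset.mul_sum, Finset.sum_congr rfl (fun i _ => key i),
    Finset.sum_add_distrib, smul_add, Finset.sum_mul]

theorem H_xl (j : Fin n) : Hop η * xL η j = xL η j * Hop η - xL η j := by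
  simp only [xL, Finset.mul_sum, Finset.sum_mul, mul_smul_comm, smul_mul_assoc, H_x, smul_sub,
    Finset.sum_sub_distrib]

theorem H_Y : Hop η * Yop η = Yop η * Hop η - Yop η := by
  have key : ∀ i, Hop η * (gU η i * xL η i) = (gU η i * xL η i) * Hop η - gU η i * xL η i := by
    intro i
    rw [← mul_assoc, H_g, mul_assoc, H_xl, mul_sub, mul_assoc]
  rw [Yop, mul_smul_comm, smul_mul_assoc, Finset.mul_sum, Finset.sum_congr rfl (fun i _ => key i),
    Finset.sum_sub_distrib, smul_sub, Finset.sum_mul]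

theorem X_xl (j : Fin n) :
    Xop η * xL η j = xL η j * Xop η + (Complex.I / (Real.sqrt 2 : ℂ)) • gL η j := by
  simp only [xL, gL, Finset.mul_sum, Finset.sum_mul, mul_smul_comm, smul_mul_assoc, X_x, smul_add,
    Finset.sum_add_distrib, Finset.smul_sum]
  congr 1
  exact Finset.sum_congr rfl fun i _ => smul_comm _ _ _

theorem sum_du_xl : ∑ i, dU η i * xL η i = ∑ i, dL η i * xU η i := by
  have h : ∀ j k, ∑ i, (((η⁻¹ : GL (Fin n) ℂ) :
      Matrix (Fin n) (Fin n) ℂ) i k * (η : Matrix (Fin n) (Fin n) ℂ) i j) • (dL η j * xU η k)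
      = if j = k then dL η j * xU η k else 0 := by
    intro j k
    rw [← Finset.sum_smul, Algebra.smul_def, map_sum]
    simp_rw [map_mul, etaInv_symm η _ k, ← map_mul]
    rw [← map_sum, ← Matrix.mul_apply, ← Matrix.GeneralLinearGroup.coe_mul, inv_mul_cancel,
      Matrix.GeneralLinearGroup.coe_one, Matrix.one_apply]
    by_cases hjk : j = k
    · simp [hjk]
    · simp [hjk, Ne.symm hjk]
  calc ∑ i, dU η i * xL η i = ∑ i, ∑ j, ∑ k, (((η⁻¹ : GL (Fin n) ℂ) :
      Matrix (Fin n) (Fin n) ℂ) i k * (η : Matrix (Fin n) (Fin n) ℂ) i j) • (dL η j * xU η k) := by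
        refine Finset.sum_congr rfl fun i _ => ?_
        rw [dU, xL, Finset.sum_mul_sum]
        refine Finset.sum_congr rfl fun j _ => Finset.sum_congr rfl fun k _ => ?_
        rw [smul_mul_smul_comm, mul_comm]
    _ = ∑ j, ∑ k, if j = k then dL η j * xU η k else 0 := by
        rw [Finset.sum_comm]
        refine Finset.sum_congr rfl fun j _ => ?_
        rw [Finset.sum_comm]
        exact Finset.sum_congr rfl fun k _ => h j k
    _ = _ := by simp

theorem sum_gl_g : ∑ i, gU η i * gL η i = algebraMap ℂ _ (n : ℂ) := by
  set B := ((η⁻¹ : GL (Fin n) ℂ) : Matrix (Fin n) (Fin n) ℂ) with hB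
  have h0 : ∑ i, gU η i * gL η i = ∑ i, ∑ j, B i j • (gU η i * gU η j) := by
    simp only [gL, Finset.mul_sum, mul_smul_comm, hB]
  have h1 : ∑ i, gU η i * gL η i = ∑ i, ∑ j, B i j • (gU η j * gU η i) := by
    rw [h0, Finset.sum_comm]
    refine Finset.sum_congr rfl fun i _ => Finset.sum_congr rfl fun j _ => ?_
    rw [Algebra.smul_def, hB, etaInv_symm η j i, ← Algebra.smul_def]
  have h2 : (2 : ℂ) • ∑ i, gU η i * gL η i = (2 : ℂ) • algebraMap ℂ (WC η) (n : ℂ) := by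
    rw [two_smul]
    nth_rewrite 1 [h0]
    rw [h1]
    simp only [← Finset.sum_add_distrib, ← smul_add, g_g]
    have : ∀ i, ∑ j, B i j • algebraMap ℂ (WC η) (2 * (η : Matrix (Fin n) (Fin n) ℂ) i j)
        = algebraMap ℂ (WC η) 2 := by
      intro i
      simp_rw [Algebra.smul_def, map_mul, eta_symm η i, ← map_mul]
      rw [← map_sum]
      congr 1
      have h3 : ∑ j, B i j * (η : Matrix (Fin n) (Fin n) ℂ) j i = 1 := by
        rw [← Matrix.mul_apply, hB, ← Matrix.GeneralLinearGroup.coe_mul, inv_mul_cancel,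
          Matrix.GeneralLinearGroup.coe_one, Matrix.one_apply_eq]
      calc _ = 2 * ∑ j, B i j * (η : Matrix (Fin n) (Fin n) ℂ) j i := by
            rw [Finset.mul_sum]; exact Finset.sum_congr rfl fun j _ => by ring
        _ = 2 := by rw [h3, mul_one]
    rw [Finset.sum_congr rfl fun i _ => this i, Finset.sum_const, Finset.card_univ,
      Fintype.card_fin, nsmul_eq_mul, map_natCast, Algebra.smul_def, (Nat.cast_commute n _).eq]
  have h3 := congrArg (fun a => (1 / 2 : ℂ) • a) h2
  simpa [smul_smul] using h3

theorem sum_d_x : ∑ i, dL η i * xU η i = ∑ i, xU η i * dL η i + algebraMap ℂ _ (n : ℂ) := by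
  simp only [d_x, if_true, map_one, Finset.sum_add_distrib, Finset.sum_const, Finset.card_univ,
    Fintype.card_fin]
  simp

theorem X_Y : Xop η * Yop η + Yop η * Xop η = Hop η := by
  have key : ∀ i, Xop η * (gU η i * xL η i) = -(gU η i * xL η i * Xop η)
      - (Complex.I / (Real.sqrt 2 : ℂ)) • (gU η i * gL η i)
      + (2 * (Complex.I / (Real.sqrt 2 : ℂ))) • (dU η i * xL η i) := by
    intro i
    rw [← mul_assoc, X_g, add_mul, neg_mul, mul_assoc, X_xl, mul_add, smul_mul_assoc,
      mul_smul_comm, mul_assoc]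
    abel
  have hS : Xop η * ∑ i, gU η i * xL η i = -((∑ i, gU η i * xL η i) * Xop η)
      - (Complex.I / (Real.sqrt 2 : ℂ)) • algebraMap ℂ _ (n : ℂ)
      + (2 * (Complex.I / (Real.sqrt 2 : ℂ))) • (∑ i, dL η i * xU η i) := by
    rw [Finset.mul_sum, Finset.sum_congr rfl fun i _ => key i, ← sum_du_xl, ← sum_gl_g,
      Finset.sum_add_distrib, Finset.sum_sub_distrib, Finset.sum_mul, Finset.smul_sum,
      Finset.smul_sum, Finset.sum_neg_distrib]
  rw [Yop, mul_smul_comm, hS, smul_mul_assoc, smul_add, smul_sub, smul_neg, smul_smul, smul_smul,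
    mul_left_comm, c_sq, Hop, Finset.sum_add_distrib, sum_d_x]
  have : (1 / 2 : ℂ) • (∑ i, xU η i * dL η i + algebraMap ℂ (WC η) n + ∑ i, xU η i * dL η i)
      = ∑ i, xU η i * dL η i + (1 / 2 : ℂ) • algebraMap ℂ (WC η) n := by
    module
  rw [this]
  module

/-- The multiplicative set `D` generated by the `H + k`, `k ∈ ℤ`. -/
noncomputable def denoms : Submonoid (WC η) :=
  Submonoid.closure (Set.range fun k : ℤ => Hop η + algebraMap ℂ (WC η) k)

theorem denoms_commute {a t : WC η} (ha : Commute (Hop η) a) (ht : t ∈ denoms η) : Commute t a := by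
  induction ht using Submonoid.closure_induction with
  | mem y hy =>
    obtain ⟨k, rfl⟩ := hy
    exact ha.add_left (Algebra.commutes _ _)
  | one => exact Commute.one_left a
  | mul y z _ _ hy hz => exact hy.mul_left hz

theorem denoms_comm {s t : WC η} (hs : s ∈ denoms η) (ht : t ∈ denoms η) : s * t = t * s :=
  (denoms_commute η (denoms_commute η (Commute.refl _) hs).symm ht).symm

theorem add_shift (a : WC η) (w : ℤ) (h : Hop η * a = a * Hop η + algebraMap ℂ _ (w : ℂ) * a) {s : WC η}
    (hs : s ∈ denoms η) : (∃ t ∈ denoms η, t * a = a * s) ∧ (∃ t ∈ denoms η, a * t = s * a) := by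
  induction hs using Submonoid.closure_induction with
  | mem y hy =>
    obtain ⟨k, rfl⟩ := hy
    refine ⟨⟨_, Submonoid.subset_closure ⟨k - w, rfl⟩, ?_⟩,
      ⟨_, Submonoid.subset_closure ⟨k + w, rfl⟩, ?_⟩⟩
    · simp only [add_mul, mul_add, h, Int.cast_sub, map_sub, sub_mul, ← Algebra.commutes _ a]
      abel
    · simp only [add_mul, mul_add, h, Int.cast_add, map_add, ← Algebra.commutes _ a]
      abel
  | one => exact ⟨⟨1, one_mem _, by simp⟩, ⟨1, one_mem _, by simp⟩⟩
  | mul y z _ _ hy hz =>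
    obtain ⟨⟨t₁, h₁, e₁⟩, ⟨t₂, h₂, e₂⟩⟩ := hy
    obtain ⟨⟨t₃, h₃, e₃⟩, ⟨t₄, h₄, e₄⟩⟩ := hz
    refine ⟨⟨t₁ * t₃, mul_mem h₁ h₃, ?_⟩, ⟨t₂ * t₄, mul_mem h₂ h₄, ?_⟩⟩
    · rw [mul_assoc, e₃, ← mul_assoc, e₁, mul_assoc]
    · rw [← mul_assoc, e₂, mul_assoc, e₄, mul_assoc]

theorem adH_scalar (c : ℂ) : Hop η * algebraMap ℂ (WC η) c
    = algebraMap ℂ (WC η) c * Hop η + algebraMap ℂ _ ((0 : ℤ) : ℂ) * algebraMap ℂ (WC η) c := by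
  rw [← Algebra.commutes]; simp
theorem adH_x (i : Fin n) : Hop η * xU η i
    = xU η i * Hop η + algebraMap ℂ _ ((-1 : ℤ) : ℂ) * xU η i := by
  rw [H_x]; simp; abel
theorem adH_d (i : Fin n) : Hop η * dL η i
    = dL η i * Hop η + algebraMap ℂ _ ((1 : ℤ) : ℂ) * dL η i := by
  rw [H_d]; simp
theorem adH_g (i : Fin n) : Hop η * gU η i
    = gU η i * Hop η + algebraMap ℂ _ ((0 : ℤ) : ℂ) * gU η i := by
  rw [H_g]; simp

theorem ore_left (a : WC η) : ∀ s ∈ denoms η, ∃ b, ∃ t ∈ denoms η, t * a = b * s := by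
  induction a using WC.induction with
  | hs c =>
    intro s hs
    obtain ⟨⟨t, ht, e⟩, -⟩ := add_shift η _ 0 (adH_scalar η c) hs
    exact ⟨_, t, ht, e⟩
  | hx i =>
    intro s hs
    obtain ⟨⟨t, ht, e⟩, -⟩ := add_shift η _ (-1) (adH_x η i) hs
    exact ⟨_, t, ht, e⟩
  | hd i =>
    intro s hs
    obtain ⟨⟨t, ht, e⟩, -⟩ := add_shift η _ 1 (adH_d η i) hs
    exact ⟨_, t, ht, e⟩
  | hg i =>
    intro s hs
    obtain ⟨⟨t, ht, e⟩, -⟩ := add_shift η _ 0 (adH_g η i) hs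
    exact ⟨_, t, ht, e⟩
  | hadd a b ha hb =>
    intro s hs
    obtain ⟨a', t₁, ht₁, e₁⟩ := ha s hs
    obtain ⟨b', t₂, ht₂, e₂⟩ := hb s hs
    refine ⟨t₂ * a' + t₁ * b', t₁ * t₂, mul_mem ht₁ ht₂, ?_⟩
    rw [mul_add, mul_assoc t₁ t₂ b, e₂, denoms_comm η ht₁ ht₂, mul_assoc, e₁, add_mul]
    simp only [mul_assoc]
  | hmul a b ha hb =>
    intro s hs
    obtain ⟨b', t, ht, e⟩ := hb s hs
    obtain ⟨a', u, hu, e'⟩ := ha t ht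
    exact ⟨a' * b', u, hu, by rw [← mul_assoc, e', mul_assoc, e, mul_assoc]⟩

/-- the operator `[Hop, ·]` -/
noncomputable def adH : Module.End ℂ (WC η) :=
  LinearMap.mulLeft ℂ (Hop η) - LinearMap.mulRight ℂ (Hop η)

theorem mem_adH {a : WC η} {w : ℤ} : a ∈ (adH η).eigenspace (w : ℂ) ↔
    Hop η * a = a * Hop η + algebraMap ℂ _ (w : ℂ) * a := by
  rw [Module.End.mem_eigenspace_iff, adH, LinearMap.sub_apply, LinearMap.mulLeft_apply,
    LinearMap.mulRight_apply, sub_eq_iff_eq_add', Algebra.smul_def]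

theorem mem_iSup_weights (a : WC η) : a ∈ ⨆ w : ℤ, (adH η).eigenspace (w : ℂ) := by
  induction a using WC.induction with
  | hs c => exact Submodule.mem_iSup_of_mem 0 ((mem_adH η).2 (adH_scalar η c))
  | hx i => exact Submodule.mem_iSup_of_mem (-1) ((mem_adH η).2 (adH_x η i))
  | hd i => exact Submodule.mem_iSup_of_mem 1 ((mem_adH η).2 (adH_d η i))
  | hg i => exact Submodule.mem_iSup_of_mem 0 ((mem_adH η).2 (adH_g η i))
  | hadd a b ha hb => exact add_mem ha hb
  | hmul a b ha hb =>
    have := Submodule.mul_mem_mul ha hb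
    refine (?_ : (⨆ w : ℤ, (adH η).eigenspace (w : ℂ)) * (⨆ w : ℤ, (adH η).eigenspace (w : ℂ))
      ≤ ⨆ w : ℤ, (adH η).eigenspace (w : ℂ)) this
    rw [Submodule.iSup_mul]
    refine iSup_le fun i => ?_
    rw [Submodule.mul_iSup]
    refine iSup_le fun j => le_trans (Submodule.mul_le.2 fun p hp q hq => ?_)
      (le_iSup (fun w : ℤ => (adH η).eigenspace (w : ℂ)) (i + j))
    rw [mem_adH] at hp hq ⊢
    rw [← mul_assoc, hp, add_mul, mul_assoc, hq, mul_add, Int.cast_add, map_add, add_mul,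
      ← mul_assoc p (algebraMap _ _ _), ← Algebra.commutes]
    simp only [mul_assoc]
    abel

theorem ore_cancel (a : WC η) {s : WC η} (hs : s ∈ denoms η) (h : a * s = 0) :
    ∃ t ∈ denoms η, t * a = 0 := by
  classical
  obtain ⟨f, hf, hsum⟩ := (Submodule.mem_iSup_iff_exists_finsupp _ _).1 (mem_iSup_weights η a)
  have hind := (adH η).eigenspaces_iSupIndep.comp (f := fun w : ℤ => (w : ℂ)) Int.cast_injective
  have hH : Hop η * s = s * Hop η := by
    exact (denoms_commute η (Commute.refl _) hs).symm
  have hz : ∀ w ∈ f.support, f w * s = 0 := by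
    refine (iSupIndep_iff_finsetSum_eq_zero_imp_eq_zero _).1 hind f.support
      (fun w => f w * s) (fun w _ => ?_) ?_
    · refine (mem_adH η).2 ?_
      rw [← mul_assoc, (mem_adH η).1 (hf w), add_mul, mul_assoc, hH]
      simp only [mul_assoc]
    · rw [← Finset.sum_mul]
      exact (congrArg (· * s) hsum).trans h
  have hall : ∀ S : Finset ℤ, (∀ w ∈ S, f w * s = 0) → ∃ t ∈ denoms η, ∀ w ∈ S, t * f w = 0 := by
    intro S
    induction S using Finset.induction_on with
    | empty => exact fun _ => ⟨1, one_mem _, by simp⟩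
    | insert w S hw ih =>
      intro hS
      obtain ⟨t, ht, h1⟩ := ih fun v hv => hS v (Finset.mem_insert_of_mem hv)
      obtain ⟨⟨u, hu, e⟩, -⟩ := add_shift η (f w) w ((mem_adH η).1 (hf w)) hs
      refine ⟨t * u, mul_mem ht hu, fun v hv => ?_⟩
      rcases Finset.mem_insert.1 hv with rfl | hv
      · rw [mul_assoc, e, hS _ (Finset.mem_insert_self _ _), mul_zero]
      · rw [denoms_comm η ht hu, mul_assoc, h1 v hv, mul_zero]
  obtain ⟨t, ht, h1⟩ := hall _ hz
  refine ⟨t, ht, ?_⟩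
  rw [← hsum, Finsupp.sum, Finset.mul_sum]
  exact Finset.sum_eq_zero h1

/-- `D` satisfies the left Ore condition, so that the localization at `D` exists. -/
noncomputable instance : OreLocalization.OreSet (denoms η) :=
  Classical.choice (OreLocalization.nonempty_oreSet_iff.2 ⟨fun a b s h => by
    obtain ⟨t, ht, e⟩ := ore_cancel η (a - b) s.2 (by rw [sub_mul, h, sub_self])
    exact ⟨⟨t, ht⟩, by rwa [mul_sub, sub_eq_zero] at e⟩, fun a s => by
    obtain ⟨b, t, ht, e⟩ := ore_left η a s s.2
    exact ⟨b, ⟨t, ht⟩, e⟩⟩)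

/-- The localization `A'` of `A = W(2n|n)` at `D`. -/
abbrev Loc : Type := OreLocalization (denoms η) (WC η)

/-- The canonical map `A → A'`. -/
noncomputable def toLoc : WC η →ₐ[ℂ] Loc η :=
  { OreLocalization.numeratorRingHom with
    commutes' := fun _ => rfl }
end WC
section Projector
variable {R : Type*} [Ring R] [Algebra ℂ R]

/-- `κ_k(h)`: equal to `-k/2` for even `k` and to `h + (k+1)/2` for odd `k`. -/
noncomputable def kappa (h : R) (k : ℕ) : R :=
  if Even k then algebraMap ℂ R (-(k : ℂ) / 2) else h + algebraMap ℂ R (((k : ℂ) + 1) / 2)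

/-- `φ_k(h) = ∏_{j=1}^k (-1)^j / κ_j(h)`. -/
noncomputable def phi (h : R) : ℕ → R
  | 0 => 1
  | k + 1 => phi h k * ((-1) ^ (k + 1) * Ring.inverse (kappa h (k + 1)))

theorem kappa_isUnit {h : R} (hu : ∀ k : ℤ, IsUnit (h + algebraMap ℂ R k)) (k : ℕ) :
    IsUnit (kappa h (k + 1)) := by
  unfold kappa
  split_ifs with he
  · refine IsUnit.map (algebraMap ℂ R) (IsUnit.mk0 _ ?_)
    have : ((k + 1 : ℕ) : ℂ) ≠ 0 := by exact_mod_cast Nat.succ_ne_zero k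
    exact div_ne_zero (neg_ne_zero.2 this) two_ne_zero
  · obtain ⟨m, hm⟩ := Nat.not_even_iff_odd.1 he
    have := hu (m + 1)
    convert this using 3
    rw [hm]; push_cast; ring

theorem phi_mul_kappa {h : R} (hu : ∀ k : ℤ, IsUnit (h + algebraMap ℂ R k)) (k : ℕ) :
    phi h (k + 1) * kappa h (k + 1) = (-1) ^ (k + 1) * phi h k := by
  rw [phi, mul_assoc, mul_assoc, Ring.inverse_mul_cancel _ (kappa_isUnit hu k), mul_one]
  exact (((Commute.neg_one_left (phi h k)).pow_left (k + 1)).eq).symm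

theorem shift_isUnit {h : R} (hu : ∀ k : ℤ, IsUnit (h + algebraMap ℂ R k)) (k : ℤ) :
    IsUnit (h - 1 + algebraMap ℂ R k) := by
  convert hu (k - 1) using 1
  rw [Int.cast_sub, Int.cast_one, map_sub, map_one]; abel

variable {h X Y : R}

theorem X_kappa (hX : h * X = X * h + X) (k : ℕ) : X * kappa h k = kappa (h - 1) k * X := by
  unfold kappa
  split_ifs
  · exact (Algebra.commutes _ _).symm
  · rw [mul_add, ← Algebra.commutes, add_mul, sub_mul, hX]; simp

theorem Xpow_kappa (N k : ℕ) (hX : h * X = X * h + X) :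
    ∃ r, X ^ N * kappa h k = r * X ^ N := by
  induction N generalizing h with
  | zero => exact ⟨kappa h k, by simp⟩
  | succ N ih =>
    obtain ⟨r, hr⟩ := ih (h := h - 1) (by rw [sub_mul, hX]; noncomm_ring)
    exact ⟨r, by rw [pow_succ, mul_assoc, X_kappa hX, ← mul_assoc, hr, mul_assoc]⟩

theorem X_phi (hX : h * X = X * h + X) (hu : ∀ k : ℤ, IsUnit (h + algebraMap ℂ R k)) (k : ℕ) :
    X * phi h k = phi (h - 1) k * X := by
  induction k with
  | zero => simp [phi]
  | succ k ih =>
    have h1 := kappa_isUnit hu k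
    have h2 := kappa_isUnit (shift_isUnit hu) k
    have h3 : X * Ring.inverse (kappa h (k + 1)) = Ring.inverse (kappa (h - 1) (k + 1)) * X := by
      rw [← Ring.inverse_mul_cancel_left _ (X * _) h2, ← mul_assoc (kappa _ _), ← X_kappa hX,
        mul_assoc X, Ring.mul_inverse_cancel _ h1, mul_one]
    rw [phi, phi, ← mul_assoc, ih, mul_assoc, ← mul_assoc X,
      ← ((Commute.neg_one_left X).pow_left (k + 1)).eq, mul_assoc, h3]
    simp only [mul_assoc]

theorem kappa_succ (k : ℕ) : kappa (h - 1) (k + 2) =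
    (-1) ^ (k + 1) * (h + algebraMap ℂ R ((k : ℂ) + 1)) + kappa (h - 1) (k + 1) := by
  unfold kappa
  rcases Nat.even_or_odd k with hk | hk
  · rw [if_pos (by simpa [Nat.even_add_one] using hk), if_neg (by simpa [Nat.even_add_one] using hk),
      Odd.neg_one_pow hk.add_one]
    have : (-((k + 2 : ℕ) : ℂ) / 2) = -((k : ℂ) + 1) - 1 + (((k + 1 : ℕ) : ℂ) + 1) / 2 := by
      push_cast; ring
    rw [this, map_add, map_sub, map_neg, map_one]
    noncomm_ring
  · rw [if_neg (by simpa [Nat.even_add_one] using hk), if_pos (by simpa [Nat.even_add_one] using hk),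
      Even.neg_one_pow hk.add_one, one_mul]
    have : ((((k + 2 : ℕ) : ℂ) + 1) / 2) = 1 + ((k : ℂ) + 1) + -((k + 1 : ℕ) : ℂ) / 2 := by
      push_cast; ring
    rw [this, map_add, map_add _ 1, map_one]
    abel

theorem Ypow_h (hY : h * Y = Y * h - Y) (k : ℕ) :
    Y ^ k * h = (h + algebraMap ℂ R k) * Y ^ k := by
  induction k with
  | zero => simp
  | succ k ih =>
    have : Y * h = (h + 1) * Y := by rw [add_mul, hY]; simp
    rw [pow_succ, mul_assoc, this, ← mul_assoc, mul_add, ih]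
    simp only [Nat.cast_add, map_add, Nat.cast_one, map_one, add_mul, mul_assoc, one_mul, mul_one]
    abel

theorem h_Xpow (hX : h * X = X * h + X) (k : ℕ) :
    X ^ k * h = (h - algebraMap ℂ R k) * X ^ k := by
  induction k with
  | zero => simp
  | succ k ih =>
    have : X * h = (h - 1) * X := by rw [sub_mul, hX]; simp
    rw [pow_succ, mul_assoc, this, ← mul_assoc, mul_sub, ih]
    simp only [Nat.cast_add, map_add, Nat.cast_one, map_one, sub_mul, add_mul, mul_assoc, one_mul,
      mul_one]
    abel

theorem X_Ypow (hXY : X * Y + Y * X = h) (hY : h * Y = Y * h - Y) (k : ℕ) :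
    X * Y ^ (k + 1) = (-1) ^ (k + 1) * (Y ^ (k + 1) * X) + kappa (h - 1) (k + 1) * Y ^ k := by
  have e : X * Y = h - Y * X := by rw [← hXY]; abel
  induction k with
  | zero => simp [kappa, e]; abel
  | succ k ih =>
    rw [pow_succ Y (k + 1), ← mul_assoc X, ih, add_mul, kappa_succ, mul_assoc, mul_assoc _ X, e,
      mul_sub, Ypow_h hY, mul_assoc (kappa _ _), ← pow_succ, add_mul, pow_succ (-1 : R) (k + 1)]
    push_cast
    noncomm_ring

theorem Xpow_Y (hXY : X * Y + Y * X = h) (hX : h * X = X * h + X) (k : ℕ) :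
    X ^ (k + 1) * Y = (-1) ^ (k + 1) * (Y * X ^ (k + 1)) + X ^ k * kappa (h - 1) (k + 1) := by
  have e : X * Y = h - Y * X := by rw [← hXY]; abel
  induction k with
  | zero => simp [kappa, e]; abel
  | succ k ih =>
    have h1 : X ^ (k + 1) * (h + algebraMap ℂ R ((k : ℂ) + 1)) = h * X ^ (k + 1) := by
      rw [mul_add, h_Xpow hX, ← Algebra.commutes]
      push_cast
      rw [← add_mul]; simp
    have h2 : X ^ (k + 1) * kappa (h - 1) (k + 2) = (-1) ^ (k + 1) * (h * X ^ (k + 1))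
        + X ^ (k + 1) * kappa (h - 1) (k + 1) := by
      rw [kappa_succ, mul_add, ← h1, ← mul_assoc, ← mul_assoc,
        ((Commute.neg_one_left (X ^ (k + 1))).pow_left (k + 1)).eq]
    have h3 : X * (-1) ^ (k + 1) = (-1) ^ (k + 1) * X :=
      ((Commute.neg_one_left X).pow_left (k + 1)).eq.symm
    rw [h2, pow_succ' X (k + 1), mul_assoc, ih, mul_add, ← mul_assoc, h3, mul_assoc, ← mul_assoc X Y,
      e, ← mul_assoc X, ← pow_succ', pow_succ (-1 : R) (k + 1), sub_mul]
    simp only [mul_sub, mul_neg, mul_one, neg_mul, mul_assoc, ← pow_succ' X]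
    abel

section Module
variable {M : Type*} [AddCommGroup M] [Module R M]

/-- `∑_k φ_k(h) Y^k X^k v`. -/
noncomputable def proj (h X Y : R) (v : M) : M := ∑ᶠ k : ℕ, (phi h k * Y ^ k * X ^ k) • v

theorem proj_eq_sum {v : M} {N : ℕ} (hv : X ^ N • v = 0) :
    proj h X Y v = ∑ k ∈ Finset.range N, (phi h k * Y ^ k * X ^ k) • v := by
  refine finsum_eq_sum_of_support_subset _ fun k hk => ?_
  by_contra hkN
  refine hk ?_
  obtain ⟨m, rfl⟩ := Nat.exists_eq_add_of_le (not_lt.1 (by simpa using hkN))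
  change _ • _ = _
  rw [mul_smul, add_comm, pow_add X, mul_smul _ _ v, hv, smul_zero, smul_zero]

theorem proj_of_smul_eq_zero {v : M} (hv : X • v = 0) : proj h X Y v = v := by
  rw [proj_eq_sum (N := 1) (by simpa using hv)]
  simp [phi]

theorem X_proj (hXY : X * Y + Y * X = h) (hX : h * X = X * h + X) (hY : h * Y = Y * h - Y)
    (hu : ∀ k : ℤ, IsUnit (h + algebraMap ℂ R k)) {v : M} {N : ℕ} (hv : X ^ N • v = 0) :
    X • proj h X Y v = 0 := by
  have key : ∀ N, X * ∑ k ∈ Finset.range (N + 1), (phi h k * Y ^ k * X ^ k)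
      = (-1) ^ N * (phi (h - 1) N * Y ^ N * X ^ (N + 1)) := by
    intro N
    induction N with
    | zero => simp [phi]
    | succ N ih =>
      have h1 := phi_mul_kappa (shift_isUnit hu) N
      have h2 : X * (phi h (N + 1) * Y ^ (N + 1) * X ^ (N + 1))
          = (-1) ^ (N + 1) * (phi (h - 1) (N + 1) * Y ^ (N + 1) * X ^ (N + 2))
            + (-1) ^ (N + 1) * (phi (h - 1) N * Y ^ N * X ^ (N + 1)) := by
        have h3 : phi (h - 1) (N + 1) * (-1) ^ (N + 1) = (-1) ^ (N + 1) * phi (h - 1) (N + 1) :=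
          ((Commute.neg_one_left _).pow_left (N + 1)).eq.symm
        calc X * (phi h (N + 1) * Y ^ (N + 1) * X ^ (N + 1))
            = (X * phi h (N + 1)) * Y ^ (N + 1) * X ^ (N + 1) := by simp only [mul_assoc]
          _ = phi (h - 1) (N + 1) * (X * Y ^ (N + 1)) * X ^ (N + 1) := by
              rw [X_phi hX hu]; simp only [mul_assoc]
          _ = (phi (h - 1) (N + 1) * (-1) ^ (N + 1)) * Y ^ (N + 1) * (X * X ^ (N + 1))
              + (phi (h - 1) (N + 1) * kappa (h - 1) (N + 1)) * Y ^ N * X ^ (N + 1) := by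
              rw [X_Ypow hXY hY]; simp only [mul_add, add_mul, mul_assoc]
          _ = _ := by rw [h1, h3, ← pow_succ']; simp only [mul_assoc]
      rw [Finset.sum_range_succ, mul_add, ih, h2, pow_succ (-1 : R) N]
      noncomm_ring
  rw [proj_eq_sum (N := N + 1) (by rw [pow_succ', mul_smul, hv, smul_zero]), ← Finset.sum_smul,
    ← mul_smul, key, pow_succ', mul_smul, mul_smul, mul_smul X, hv]
  simp only [smul_zero]

theorem proj_Y (hXY : X * Y + Y * X = h) (hX : h * X = X * h + X) (hY : h * Y = Y * h - Y)
    (hu : ∀ k : ℤ, IsUnit (h + algebraMap ℂ R k)) {v : M} {N : ℕ} (hv : X ^ N • v = 0) :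
    proj h X Y (Y • v) = 0 := by
  have hk : ∀ N j, Y ^ (N + 1) * (X ^ N * kappa (h - 1) j) = kappa h j * (Y ^ (N + 1) * X ^ N) := by
    intro N j
    unfold kappa
    split_ifs
    · rw [← mul_assoc, Algebra.commutes]
    · have h1 : X ^ N * (h - 1 + algebraMap ℂ R (((j : ℂ) + 1) / 2))
          = (h - 1 - algebraMap ℂ R N + algebraMap ℂ R (((j : ℂ) + 1) / 2)) * X ^ N := by
        rw [mul_add, mul_sub, h_Xpow hX, ← Algebra.commutes, add_mul, sub_mul, sub_mul, sub_mul,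
          mul_one, one_mul]
        abel
      have h2 : Y ^ (N + 1) * (h - 1 - algebraMap ℂ R N + algebraMap ℂ R (((j : ℂ) + 1) / 2))
          = (h + algebraMap ℂ R (((j : ℂ) + 1) / 2)) * Y ^ (N + 1) := by
        rw [mul_add, mul_sub, mul_sub, Ypow_h hY, ← Algebra.commutes, ← Algebra.commutes, mul_one,
          Nat.cast_add, Nat.cast_one, map_add, map_one]
        simp only [add_mul, one_mul]
        abel
      rw [h1, ← mul_assoc, h2, mul_assoc]
  have key : ∀ N, (∑ k ∈ Finset.range (N + 1), (phi h k * Y ^ k * X ^ k)) * Y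
      = (-1) ^ N * (phi h N * Y ^ (N + 1) * X ^ N) := by
    intro N
    induction N with
    | zero => simp [phi]
    | succ N ih =>
      have h1 := phi_mul_kappa hu N
      have h2 : phi h (N + 1) * Y ^ (N + 1) * X ^ (N + 1) * Y
          = (-1) ^ (N + 1) * (phi h (N + 1) * Y ^ (N + 2) * X ^ (N + 1))
            + (-1) ^ (N + 1) * (phi h N * Y ^ (N + 1) * X ^ N) := by
        have h3 : phi h (N + 1) * Y ^ (N + 1) * (-1) ^ (N + 1)
            = (-1) ^ (N + 1) * (phi h (N + 1) * Y ^ (N + 1)) :=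
          ((Commute.neg_one_left _).pow_left (N + 1)).eq.symm
        calc phi h (N + 1) * Y ^ (N + 1) * X ^ (N + 1) * Y
            = phi h (N + 1) * Y ^ (N + 1) * (X ^ (N + 1) * Y) := by simp only [mul_assoc]
          _ = (phi h (N + 1) * Y ^ (N + 1) * (-1) ^ (N + 1)) * Y * X ^ (N + 1)
              + phi h (N + 1) * (Y ^ (N + 1) * (X ^ N * kappa (h - 1) (N + 1))) := by
              rw [Xpow_Y hXY hX]; simp only [mul_add, mul_assoc]
          _ = _ := by
              rw [hk, h3, ← mul_assoc _ (kappa _ _), h1, pow_succ Y (N + 1)]; simp only [mul_assoc]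
      rw [Finset.sum_range_succ, add_mul, ih, h2, pow_succ (-1 : R) N]
      noncomm_ring
  have hN : X ^ (N + 1) • Y • v = 0 := by
    obtain ⟨r, hr⟩ := Xpow_kappa N (N + 1) (h := h - 1) (X := X) (by rw [sub_mul, hX]; noncomm_ring)
    rw [← mul_smul, Xpow_Y hXY hX, hr, add_smul, pow_succ' X, mul_smul r, hv]
    simp only [mul_smul, hv, smul_zero, add_zero]
  rw [proj_eq_sum hN, ← Finset.sum_smul, ← mul_smul, key, mul_smul, mul_smul, hv, smul_zero,
    smul_zero]
end Module
end Projector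

section Reduction
variable {n : ℕ} (η : GL (Fin n) ℂ)

/-- `E = X²`. -/
noncomputable def Eop : WC η := Xop η * Xop η
/-- `F = -Y²`. -/
noncomputable def Fop : WC η := -(Yop η * Yop η)

/-- `g₊ = ℂX ⊕ ℂE`. -/
noncomputable def gPlus : Submodule ℂ (WC η) := Submodule.span ℂ {Xop η, Eop η}
/-- `g₋ = ℂY ⊕ ℂF`. -/
noncomputable def gMinus : Submodule ℂ (WC η) := Submodule.span ℂ {Yop η, Fop η}

/-- The left ideal `I' = A' g₊`. -/
noncomputable def leftIdeal : Ideal (Loc η) := Ideal.span (toLoc η '' (gPlus η : Set (WC η)))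

/-- The subspace `II = g₋ A' + A' g₊`. -/
noncomputable def doubleIdeal : Submodule ℂ (Loc η) :=
  Submodule.span ℂ {b | ∃ y ∈ gMinus η, ∃ a : Loc η, b = toLoc η y * a}
    ⊔ (leftIdeal η).restrictScalars ℂ

/-- `M' = A'/I'`. -/
abbrev LeftQuot : Type := Loc η ⧸ leftIdeal η

/-- The double coset space `A'/II`. -/
abbrev DoubleCoset : Type := Loc η ⧸ doubleIdeal η

theorem Hop_isUnit (k : ℤ) : IsUnit (toLoc η (Hop η) + algebraMap ℂ (Loc η) k) := by
  have h := OreLocalization.numerator_isUnit (S := denoms η)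
    ⟨Hop η + algebraMap ℂ (WC η) k, Submonoid.subset_closure ⟨k, rfl⟩⟩
  have e : toLoc η (Hop η) + algebraMap ℂ (Loc η) k = toLoc η (Hop η + algebraMap ℂ (WC η) k) := by
    rw [map_add, AlgHom.commutes]
  rw [e]
  exact h

theorem loc_X_Y : toLoc η (Xop η) * toLoc η (Yop η) + toLoc η (Yop η) * toLoc η (Xop η)
    = toLoc η (Hop η) := by
  rw [← map_mul, ← map_mul, ← map_add, X_Y]
theorem loc_H_X : toLoc η (Hop η) * toLoc η (Xop η)
    = toLoc η (Xop η) * toLoc η (Hop η) + toLoc η (Xop η) := by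
  rw [← map_mul, ← map_mul, ← map_add, H_X]
theorem loc_H_Y : toLoc η (Hop η) * toLoc η (Yop η)
    = toLoc η (Yop η) * toLoc η (Hop η) - toLoc η (Yop η) := by
  rw [← map_mul, ← map_mul, ← map_sub, H_Y]

theorem X_mem : toLoc η (Xop η) ∈ leftIdeal η :=
  Ideal.subset_span ⟨_, Submodule.subset_span (by simp), rfl⟩

theorem gPlus_eq {a : WC η} (ha : a ∈ gPlus η) : ∃ b, a = b * Xop η := by
  obtain ⟨s, t, rfl⟩ := Submodule.mem_span_pair.1 ha
  exact ⟨s • 1 + t • Xop η, by simp [Eop, add_mul]⟩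

theorem gMinus_eq {a : WC η} (ha : a ∈ gMinus η) : ∃ b, a = Yop η * b := by
  obtain ⟨s, t, rfl⟩ := Submodule.mem_span_pair.1 ha
  exact ⟨s • 1 - t • Yop η, by
    simp only [Fop, mul_sub, mul_smul_comm, mul_one, smul_neg]; rw [sub_eq_add_neg]⟩

theorem leftIdeal_smul {M : Type*} [AddCommGroup M] [Module (Loc η) M] {i : Loc η}
    (hi : i ∈ leftIdeal η) {v : M} (hv : toLoc η (Xop η) • v = 0) : i • v = 0 := by
  induction hi using Submodule.span_induction with
  | mem a ha =>
    obtain ⟨a, ha, rfl⟩ := ha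
    obtain ⟨b, rfl⟩ := gPlus_eq η ha
    rw [map_mul, mul_smul, hv, smul_zero]
  | zero => exact zero_smul _ _
  | add a b _ _ ha hb => rw [add_smul, ha, hb, add_zero]
  | smul r a _ ha => rw [smul_assoc, ha, smul_zero]

theorem adH_pow {a : WC η} {w : ℤ} (h : Hop η * a = a * Hop η + algebraMap ℂ _ (w : ℂ) * a) (N : ℕ) :
    Hop η * a ^ N = a ^ N * Hop η + algebraMap ℂ _ ((N * w : ℤ) : ℂ) * a ^ N := by
  induction N with
  | zero => simp
  | succ N ih =>
    rw [pow_succ, ← mul_assoc, ih, add_mul, mul_assoc, h, mul_add, ← mul_assoc _ (algebraMap _ _ _),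
      ← Algebra.commutes]
    push_cast
    simp only [add_mul, one_mul, mul_assoc]
    abel

theorem Epow_x (i : Fin n) (N : ℕ) : Eop η ^ (N + 1) * xU η i =
    xU η i * Eop η ^ (N + 1) - (N + 1 : ℂ) • (dU η i * Eop η ^ N) := by
  have hd : Eop η * dU η i = dU η i * Eop η := by
    rw [Eop, mul_assoc, X_du, ← mul_assoc, X_du, mul_assoc]
  induction N with
  | zero => simp [Eop, E_x]
  | succ N ih =>
    rw [pow_succ' _ (N + 1), mul_assoc, ih, mul_sub, ← mul_assoc, Eop, E_x, ← Eop, sub_mul,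
      mul_smul_comm, ← mul_assoc, hd, mul_assoc, ← pow_succ', mul_assoc, ← pow_succ']
    push_cast
    module

theorem exists_pow_smul (v : LeftQuot η) : ∃ N : ℕ, toLoc η (Eop η) ^ N • v = 0 := by
  have mono : ∀ (v : LeftQuot η) (N m : ℕ), toLoc η (Eop η) ^ N • v = 0 →
      toLoc η (Eop η) ^ (N + m) • v = 0 := fun v N m h => by
    rw [add_comm, pow_add, mul_smul, h, smul_zero]
  have add : ∀ v w : LeftQuot η, (∃ N : ℕ, toLoc η (Eop η) ^ N • v = 0) →
      (∃ N : ℕ, toLoc η (Eop η) ^ N • w = 0) → ∃ N : ℕ, toLoc η (Eop η) ^ N • (v + w) = 0 := by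
    rintro v w ⟨N, hN⟩ ⟨m, hm⟩
    exact ⟨N + m, by rw [smul_add, mono v N m hN, add_comm N m, mono w m N hm, add_zero]⟩
  have step : ∀ (a : WC η) (v : LeftQuot η), (∃ N : ℕ, toLoc η (Eop η) ^ N • v = 0) →
      ∃ N : ℕ, toLoc η (Eop η) ^ N • (toLoc η a • v) = 0 := by
    intro a
    induction a using WC.induction with
    | hs c =>
      rintro v ⟨N, hN⟩
      exact ⟨N, by rw [← mul_smul, AlgHom.commutes, ← Algebra.commutes, mul_smul, hN, smul_zero]⟩
    | hx i =>
      rintro v ⟨N, hN⟩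
      refine ⟨N + 1, ?_⟩
      rw [← mul_smul, ← map_pow, ← map_mul, Epow_x, map_sub, map_smul, map_mul, map_mul, map_pow,
        map_pow, sub_smul, mul_smul, mono v N 1 hN, smul_zero, smul_assoc, mul_smul, hN, smul_zero,
        smul_zero, sub_zero]
    | hd i =>
      rintro v ⟨N, hN⟩
      have : Commute (Eop η ^ N) (dL η i) := Commute.pow_left (E_d η i) N
      exact ⟨N, by rw [← mul_smul, ← map_pow, ← map_mul, this.eq, map_mul, mul_smul, map_pow, hN,
        smul_zero]⟩
    | hg i =>
      rintro v ⟨N, hN⟩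
      have : Commute (Eop η ^ N) (gU η i) := Commute.pow_left (E_g η i) N
      exact ⟨N, by rw [← mul_smul, ← map_pow, ← map_mul, this.eq, map_mul, mul_smul, map_pow, hN,
        smul_zero]⟩
    | hadd a b ha hb =>
      intro v hv
      rw [map_add, add_smul]
      exact add _ _ (ha v hv) (hb v hv)
    | hmul a b ha hb =>
      intro v hv
      rw [map_mul, mul_smul]
      exact ha _ (hb v hv)
  obtain ⟨r, rfl⟩ := Submodule.Quotient.mk_surjective _ v
  induction r using OreLocalization.ind with | _ a s
  obtain ⟨N, hN⟩ := step a (Submodule.Quotient.mk 1) ⟨1, by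
    rw [pow_one, Eop, map_mul, mul_smul, ← Submodule.Quotient.mk_smul _ _ (1 : Loc η),
      smul_eq_mul, mul_one, (Submodule.Quotient.mk_eq_zero _).2 (X_mem η), smul_zero]⟩
  have hE : Hop η * Eop η = Eop η * Hop η + algebraMap ℂ _ ((2 : ℤ) : ℂ) * Eop η := by
    rw [Eop, ← mul_assoc, H_X, add_mul, mul_assoc, H_X, mul_add, Int.cast_ofNat, map_ofNat, two_mul,
      mul_assoc, add_assoc]
  obtain ⟨⟨t, ht, e⟩, -⟩ := add_shift η _ _ (adH_pow η hE N) s.2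
  refine ⟨N, ?_⟩
  have e1 : toLoc η (s : WC η) * ((a /ₒ s : Loc η)) = toLoc η a := OreLocalization.mul_cancel
  have e2 : ((1 : WC η) /ₒ (⟨t, ht⟩ : denoms η)) * toLoc η t = (1 : Loc η) :=
    OreLocalization.mul_inv (1 : denoms η) ⟨t, ht⟩
  have e3 : toLoc η (Eop η) ^ N * (a /ₒ s : Loc η)
      = ((1 : WC η) /ₒ (⟨t, ht⟩ : denoms η)) * (toLoc η (Eop η) ^ N * toLoc η a) := by
    rw [← e1, ← mul_assoc (toLoc η (Eop η) ^ N), ← map_pow, ← map_mul, ← e, map_mul, mul_assoc,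
      ← mul_assoc _ (toLoc η t), e2, one_mul]
  rw [← mul_one (a /ₒ s : Loc η), ← smul_eq_mul, Submodule.Quotient.mk_smul, ← mul_smul, e3, mul_smul,
    mul_smul, hN, smul_zero]

/-- `X` acts locally nilpotently on `M'`, so the extremal projector is a finite sum on each vector. -/
theorem exists_Xpow_smul (v : LeftQuot η) : ∃ N : ℕ, toLoc η (Xop η) ^ N • v = 0 := by
  obtain ⟨N, hN⟩ := exists_pow_smul η v
  exact ⟨2 * N, by rwa [pow_mul, pow_two, ← map_mul]⟩

/-- The action `∑_k φ_k(H) Y^k X^k` of the extremal projector `P` on `M'`. -/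
noncomputable def extremalProjector : LeftQuot η →ₗ[ℂ] LeftQuot η where
  toFun v := ∑ᶠ k : ℕ, (phi (toLoc η (Hop η)) k * toLoc η (Yop η) ^ k * toLoc η (Xop η) ^ k) • v
  map_add' v w := by
    obtain ⟨N, hN⟩ := exists_Xpow_smul η v
    obtain ⟨m, hm⟩ := exists_Xpow_smul η w
    have h1 : toLoc η (Xop η) ^ (N + m) • v = 0 := by
      rw [add_comm, pow_add, mul_smul, hN, smul_zero]
    have h2 : toLoc η (Xop η) ^ (N + m) • w = 0 := by rw [pow_add, mul_smul, hm, smul_zero]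
    have h3 : toLoc η (Xop η) ^ (N + m) • (v + w) = 0 := by rw [smul_add, h1, h2, add_zero]
    have e1 := proj_eq_sum (h := toLoc η (Hop η)) (Y := toLoc η (Yop η)) h1
    have e2 := proj_eq_sum (h := toLoc η (Hop η)) (Y := toLoc η (Yop η)) h2
    have e3 := proj_eq_sum (h := toLoc η (Hop η)) (Y := toLoc η (Yop η)) h3
    simp only [proj] at e1 e2 e3
    rw [e1, e2, e3, ← Finset.sum_add_distrib]
    simp only [smul_add]
  map_smul' c v := by
    obtain ⟨N, hN⟩ := exists_Xpow_smul η v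
    have h3 : toLoc η (Xop η) ^ N • (c • v) = 0 := by rw [smul_comm, hN, smul_zero]
    have e1 := proj_eq_sum (h := toLoc η (Hop η)) (Y := toLoc η (Yop η)) hN
    have e3 := proj_eq_sum (h := toLoc η (Hop η)) (Y := toLoc η (Yop η)) h3
    simp only [proj] at e1 e3
    rw [e1, e3, RingHom.id_apply, Finset.smul_sum]
    exact Finset.sum_congr rfl fun k _ => smul_comm _ _ _

theorem X_extremalProjector (v : LeftQuot η) : toLoc η (Xop η) • extremalProjector η v = 0 := by
  obtain ⟨N, hN⟩ := exists_Xpow_smul η v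
  exact X_proj (loc_X_Y η) (loc_H_X η) (loc_H_Y η) (Hop_isUnit η) hN

theorem extremalProjector_Y (v : LeftQuot η) : extremalProjector η (toLoc η (Yop η) • v) = 0 := by
  obtain ⟨N, hN⟩ := exists_Xpow_smul η v
  exact proj_Y (loc_X_Y η) (loc_H_X η) (loc_H_Y η) (Hop_isUnit η) hN

/-- The class of `a` in the double coset space. -/
noncomputable def bar : Loc η →ₗ[ℂ] DoubleCoset η := (doubleIdeal η).mkQ

/-- The projection `M' → A'/II`. -/
noncomputable def leftToDouble : LeftQuot η →ₗ[ℂ] DoubleCoset η :=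
  Submodule.factor (le_sup_right : (leftIdeal η).restrictScalars ℂ ≤ doubleIdeal η)
    ∘ₗ (Submodule.Quotient.restrictScalarsEquiv ℂ (leftIdeal η)).symm.toLinearMap

/-- The map `A'/II → M'`, `ā ↦ P(a + I')`, induced by `P`. -/
noncomputable def cosetProjector : DoubleCoset η →ₗ[ℂ] LeftQuot η :=
  (doubleIdeal η).liftQ
    (extremalProjector η ∘ₗ ((leftIdeal η).mkQ.restrictScalars ℂ)) <| by
    refine sup_le (Submodule.span_le.2 ?_) fun a ha => ?_
    · rintro _ ⟨y, hy, a, rfl⟩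
      obtain ⟨b, rfl⟩ := gMinus_eq η hy
      change extremalProjector η (Submodule.Quotient.mk (toLoc η (Yop η * b) * a)) = 0
      rw [map_mul, mul_assoc, ← smul_eq_mul, Submodule.Quotient.mk_smul, extremalProjector_Y]
    · change extremalProjector η (Submodule.Quotient.mk a) = 0
      have h : (Submodule.Quotient.mk a : LeftQuot η) = 0 :=
        (Submodule.Quotient.mk_eq_zero (leftIdeal η)).2 ha
      exact (congrArg _ h).trans (map_zero _)

/-- The map `(a, b̄) ↦ a P b + II`. -/
noncomputable def diamondLeft : Loc η →ₗ[ℂ] DoubleCoset η →ₗ[ℂ] DoubleCoset η :=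
  LinearMap.mk₂ ℂ (fun a q => leftToDouble η (a • cosetProjector η q))
    (fun a b q => by rw [add_smul, map_add]) (fun c a q => by rw [smul_assoc, map_smul])
    (fun a p q => by rw [map_add, smul_add, map_add])
    (fun c a q => by
      rw [(cosetProjector η).map_smul, smul_comm, (leftToDouble η).map_smul])

/-- The diamond product `ā ◇ b̄ = a P b + II`. -/
noncomputable def diamond : DoubleCoset η →ₗ[ℂ] DoubleCoset η →ₗ[ℂ] DoubleCoset η :=
  (doubleIdeal η).liftQ (diamondLeft η) <| by
    refine sup_le (Submodule.span_le.2 ?_) fun a ha => ?_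
    · rintro _ ⟨y, hy, a, rfl⟩
      refine LinearMap.ext fun q => ?_
      change leftToDouble η ((toLoc η y * a) • cosetProjector η q) = 0
      obtain ⟨b, hb⟩ := Submodule.Quotient.mk_surjective _ (cosetProjector η q)
      rw [← hb, ← Submodule.Quotient.mk_smul, smul_eq_mul, mul_assoc]
      exact (Submodule.Quotient.mk_eq_zero _).2
        (Submodule.mem_sup_left (Submodule.subset_span ⟨y, hy, _, rfl⟩))
    · refine LinearMap.ext fun q => ?_
      change leftToDouble η (a • cosetProjector η q) = 0
      obtain ⟨b, rfl⟩ := Submodule.Quotient.mk_surjective _ q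
      have h : a • extremalProjector η (Submodule.Quotient.mk b) = 0 :=
        leftIdeal_smul η ha (X_extremalProjector η _)
      exact (congrArg _ h).trans (map_zero _)

theorem diamond_bar (a b : Loc η) : diamond η (bar η a) (bar η b) =
    leftToDouble η (a • extremalProjector η (Submodule.Quotient.mk b)) := rfl

theorem leftToDouble_mk (a : Loc η) : leftToDouble η (Submodule.Quotient.mk a) = bar η a := rfl

/-- The normalizer `{a | I' a ⊆ I'}`. -/
noncomputable def normalizer : Subalgebra ℂ (Loc η) where
  carrier := {a | ∀ i ∈ leftIdeal η, i * a ∈ leftIdeal η}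
  mul_mem' {a b} ha hb i hi := by rw [← mul_assoc]; exact hb _ (ha i hi)
  add_mem' {a b} ha hb i hi := by rw [mul_add]; exact add_mem (ha i hi) (hb i hi)
  algebraMap_mem' c i hi := by rw [← Algebra.commutes]; exact Ideal.mul_mem_left _ _ hi

/-- The left ideal `I'`, as a two-sided ideal of its normalizer. -/
noncomputable def normalizerIdeal : Ideal (normalizer η) := (leftIdeal η).comap (normalizer η).val

instance : (normalizerIdeal η).IsTwoSided := ⟨fun b ha => b.2 _ ha⟩

/-- The localized reduction algebra `Z_n' = N(I')/I'`. -/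
abbrev ReductionAlgebra : Type := normalizer η ⧸ normalizerIdeal η

/-- The canonical map `Z_n' → A'/II`, `z + I' ↦ z + II`. -/
noncomputable def reductionToDouble : ReductionAlgebra η →ₗ[ℂ] DoubleCoset η :=
  ((normalizerIdeal η).restrictScalars ℂ).liftQ (bar η ∘ₗ (normalizer η).val.toLinearMap)
      (fun _ ha => (Submodule.Quotient.mk_eq_zero _).2 (Submodule.mem_sup_right ha))
    ∘ₗ (Submodule.Quotient.restrictScalarsEquiv ℂ (normalizerIdeal η)).symm.toLinearMap

theorem reductionToDouble_mk (a : normalizer η) :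
    reductionToDouble η (Ideal.Quotient.mk _ a) = bar η a := rfl
end Reduction

section Presentation

/-- Generators of the presented algebra: `x^i`, `∂_i`, `γ^i`, `H` and `1/(H+k)`. -/
inductive PGen (n : ℕ)
  | x (i : Fin n)
  | d (i : Fin n)
  | g (i : Fin n)
  | h
  | inv (k : ℤ)

section Free
variable {n : ℕ} (η : GL (Fin n) ℂ)

abbrev PFree (n : ℕ) : Type := FreeAlgebra ℂ (PGen n)

def px (i : Fin n) : PFree n := FreeAlgebra.ι ℂ (PGen.x i)
def pd (i : Fin n) : PFree n := FreeAlgebra.ι ℂ (PGen.d i)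
def pg (i : Fin n) : PFree n := FreeAlgebra.ι ℂ (PGen.g i)
def ph : PFree n := FreeAlgebra.ι ℂ PGen.h
def pinv (k : ℤ) : PFree n := FreeAlgebra.ι ℂ (PGen.inv k)
noncomputable def pxL (i : Fin n) : PFree n :=
  ∑ j, ((η⁻¹ : GL (Fin n) ℂ) : Matrix (Fin n) (Fin n) ℂ) i j • px j
noncomputable def pdU (i : Fin n) : PFree n := ∑ j, (η : Matrix (Fin n) (Fin n) ℂ) i j • pd j
noncomputable def pgL (i : Fin n) : PFree n :=
  ∑ j, ((η⁻¹ : GL (Fin n) ℂ) : Matrix (Fin n) (Fin n) ℂ) i j • pg j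
end Free

/-- The relations of the presentation. -/
inductive PresRel {n : ℕ} (η : GL (Fin n) ℂ) : PFree n → PFree n → Prop
  | inv_mul (k : ℤ) : PresRel η (pinv k * (ph + algebraMap ℂ _ (k : ℂ))) 1
  | mul_inv (k : ℤ) : PresRel η ((ph + algebraMap ℂ _ (k : ℂ)) * pinv k) 1
  | h_x (i : Fin n) : PresRel η (ph * px i) (px i * (ph - 1))
  | h_d (i : Fin n) : PresRel η (ph * pd i) (pd i * (ph + 1))
  | h_g (i : Fin n) : PresRel η (ph * pg i) (pg i * ph)
  | x_x (i j : Fin n) : PresRel η (px i * px j) (px j * px i)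
  | d_d (i j : Fin n) : PresRel η (pd i * pd j) (pd j * pd i)
  | d_g (i j : Fin n) : PresRel η (pd i * pg j - pg j * pd i) (pinv 0 * (pgL η i * pdU η j))
  | g_g (i j : Fin n) : PresRel η (pg i * pg j + pg j * pg i)
      (algebraMap ℂ _ (2 * (η : Matrix (Fin n) (Fin n) ℂ) i j)
        + (2 : ℂ) • (pinv 1 * (px j * pdU η i + px i * pdU η j)))
  | d_x (i j : Fin n) : PresRel η (pd i * px j - px j * pd i)
      (algebraMap ℂ _ (if i = j then 1 else 0)
        + (1 / 2 : ℂ) • (pinv 0 * (pgL η i * pg j)) + pinv 1 * (pxL η i * pdU η j))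
  | g_x (i j : Fin n) : PresRel η (pg i * px j - px j * pg i) (pinv 1 * (px i * pg j))
  | sum_x_d : PresRel η (∑ i, px i * pd i) (algebraMap ℂ _ (-(n : ℂ) / 2) - ph)
  | sum_g_d : PresRel η (∑ i, pg i * pd i) 0
  | sum_g_x : PresRel η (∑ i, pgL η i * px i) 0

/-- The algebra presented by these generators and relations. -/
abbrev Presented {n : ℕ} (η : GL (Fin n) ℂ) : Type := RingQuot (PresRel η)

noncomputable def Presented.of {n : ℕ} (η : GL (Fin n) ℂ) : PFree n →ₐ[ℂ] Presented η :=
  RingQuot.mkAlgHom ℂ (PresRel η)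

end Presentation

section Shorthand
variable {n : ℕ} (η : GL (Fin n) ℂ)

/-- The class of `x^i` in `A'/II`; similarly for the other generators. -/
noncomputable def xBar (i : Fin n) : DoubleCoset η := bar η (toLoc η (xU η i))
noncomputable def dBar (i : Fin n) : DoubleCoset η := bar η (toLoc η (dL η i))
noncomputable def gBar (i : Fin n) : DoubleCoset η := bar η (toLoc η (gU η i))
noncomputable def xLBar (i : Fin n) : DoubleCoset η := bar η (toLoc η (xL η i))
noncomputable def dUBar (i : Fin n) : DoubleCoset η := bar η (toLoc η (dU η i))
noncomputable def gLBar (i : Fin n) : DoubleCoset η := bar η (toLoc η (gL η i))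

/-- `1/(H+k)`, the inverse of the unit `H + k` of `A'`. -/
noncomputable def hInv (k : ℤ) : Loc η := Ring.inverse (toLoc η (Hop η) + algebraMap ℂ (Loc η) k)

/-- `φ(H)` for the rational function `φ(t) = p(t) / ∏_{k ∈ l} (t + k)`. -/
noncomputable def ratH (p : Polynomial ℂ) (l : List ℤ) : Loc η :=
  Polynomial.aeval (toLoc η (Hop η)) p * (l.map (hInv η)).prod

end Shorthand

/-- The diamond product as a binary operation. -/
noncomputable def diamondMul {n : ℕ} {η : GL (Fin n) ℂ} (p q : DoubleCoset η) : DoubleCoset η :=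
  diamond η p q

infixl:70 " ◇ " => diamondMul

end DiracReduction
open DiracReduction

/-! Write c = i/√2, M' = A'/I' and T = γ^i ∂_i, so that X = cT.

The double coset space is M'/YM' (`leftToDouble_eq_zero`), while N/I' is the kernel of X on M'.
Since XP = 0, PY = 0 and P = 1 plus terms φ_k(H) Y^k X^k with k ≥ 1, every m in M' can be written Pm
+ Yb with X Pm = 0 (`extremalProjector_sub`). So the kernel of X and M'/YM' are identified, with
inverse induced by P. An element w of N is fixed by P modulo I', which makes the product of N/I' the
diamond product.

The diamond relations need no expansion of P beyond this decomposition. To compare a · Pm with a · m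
one has to find the class of aYb. Commuting a past Y leaves a simpler operator applied to b, and XYb
= Xm determines that vector modulo YM' after division by H or H + 1. This gives the closed formulas
`g_extremalProjector` and `d_extremalProjector`. Besides, x^i commutes with Y and ∂_i commutes with
X, so x^i ◇ a and a ◇ ∂_i are plain products. The relations then follow from the commutators with X
and the identity c² = -1/2.

The presented algebra B therefore maps to Z_n'. For surjectivity, `eq_top_of_stable` reads the two
closed formulas backwards: the class of a · m is obtained from diamond products applied to the
classes of m, Xm and X²m. A subspace stable under the generators thus pulls back to an A'-submodule
of M', once all X^k m are tracked together.

For injectivity, A' is made to act on sequences in B. The model is m ↦ (class of T^k m)_k: T becomes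
the shift, ∂^i, γ^i and x^i act at index 0 by the closed formulas, and the commutators with T
dictate the rest. The Weyl-Clifford relations are reduced to index 0 by `eq_zero_of_shift`, and
there they are identities in B. The contracted relations of B, together with their consequences
`contract_x_g` and `contract_x_x`, force T to act as the shift (`rep_dirac`), H as h - k at index k
(`rep_H`), and Y with zero entry at index 0 (`rep_Y_zero`). Hence H + k acts invertibly, the action
extends to A', I' kills the sequences supported at index 0, and N preserves them. There the image of
f in Z_n' acts as left multiplication by f (`locRep_freeToReduction`), so f is zero as soon as its
image is; apply this to 1. All of this is for symmetric η; otherwise B is zero. -/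

namespace DiracReduction

/-! ### Commutators of the generators with Y. -/

section Commutation
variable {n : ℕ} (η : GL (Fin n) ℂ)

/-- The symmetry of the inverse metric holds inside the algebra, so the lowered index can move from
x to γ. This is the form in which ∂_i contracts directly against x^i. -/
theorem Y_eq : Yop η = (Complex.I / (Real.sqrt 2 : ℂ)) • ∑ i, gL η i * xU η i := by
  simp only [Yop, gL, xL, Finset.mul_sum, Finset.sum_mul, mul_smul_comm, smul_mul_assoc]
  rw [Finset.sum_comm]
  congr 1
  refine Finset.sum_congr rfl fun i _ => Finset.sum_congr rfl fun j _ => ?_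
  rw [Algebra.smul_def, etaInv_symm η j i, ← Algebra.smul_def]

theorem sum_eta_inv_smul {M : Type*} [AddCommGroup M] [Module ℂ M] (v : Fin n → M) (i : Fin n) :
    ∑ k, (η : Matrix (Fin n) (Fin n) ℂ) i k •
      ∑ j, ((η⁻¹ : GL (Fin n) ℂ) : Matrix (Fin n) (Fin n) ℂ) k j • v j = v i := by
  simp only [Finset.smul_sum, smul_smul]
  rw [Finset.sum_comm]
  simp only [← Finset.sum_smul, ← Matrix.mul_apply, ← Matrix.GeneralLinearGroup.coe_mul,
    mul_inv_cancel, Matrix.GeneralLinearGroup.coe_one, Matrix.one_apply, ite_smul, one_smul,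
    zero_smul, Finset.sum_ite_eq, Finset.mem_univ, if_true]

theorem sum_inv_eta_smul {M : Type*} [AddCommGroup M] [Module ℂ M] (v : Fin n → M) (i : Fin n) :
    ∑ k, ((η⁻¹ : GL (Fin n) ℂ) : Matrix (Fin n) (Fin n) ℂ) i k •
      ∑ j, (η : Matrix (Fin n) (Fin n) ℂ) k j • v j = v i := by
  have := sum_eta_inv_smul (η⁻¹) v i
  rwa [inv_inv] at this

theorem x_Y (i : Fin n) : xU η i * Yop η = Yop η * xU η i := by
  simp only [Yop, xL, mul_smul_comm, smul_mul_assoc, Finset.mul_sum, Finset.sum_mul]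
  congr 1
  refine Finset.sum_congr rfl fun j _ => Finset.sum_congr rfl fun k _ => ?_
  rw [← mul_assoc, ← g_x, mul_assoc, x_x, ← mul_assoc]

theorem g_Y (i : Fin n) :
    gU η i * Yop η = -(Yop η * gU η i) + (2 * (Complex.I / (Real.sqrt 2 : ℂ))) • xU η i := by
  have key : ∀ j, gU η i * (gU η j * xL η j) = -((gU η j * xL η j) * gU η i)
      + (2 : ℂ) • ((η : Matrix (Fin n) (Fin n) ℂ) i j • xL η j) := by
    intro j
    have hx : gU η i * xL η j = xL η j * gU η i := by
      simp only [xL, mul_smul_comm, smul_mul_assoc, Finset.mul_sum, Finset.sum_mul, g_x]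
    rw [mul_assoc, ← hx, ← mul_assoc, ← mul_assoc, eq_sub_of_add_eq (g_g η i j), sub_mul,
      ← Algebra.smul_def, smul_smul]
    abel
  rw [Yop, mul_smul_comm, Finset.mul_sum, Finset.sum_congr rfl fun j _ => key j,
    Finset.sum_add_distrib, ← Finset.smul_sum, Finset.sum_neg_distrib, ← Finset.sum_mul]
  simp only [xL]
  rw [sum_eta_inv_smul, smul_add, smul_neg, smul_mul_assoc, smul_smul, mul_comm]

theorem gL_Y (i : Fin n) :
    gL η i * Yop η = -(Yop η * gL η i) + (2 * (Complex.I / (Real.sqrt 2 : ℂ))) • xL η i := by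
  simp only [gL, xL, Finset.sum_mul, Finset.mul_sum, mul_smul_comm, smul_mul_assoc, g_Y, smul_add,
    Finset.sum_add_distrib, Finset.smul_sum, smul_neg, Finset.sum_neg_distrib]
  congr 1
  exact Finset.sum_congr rfl fun j _ => smul_comm _ _ _

theorem d_Y (i : Fin n) :
    dL η i * Yop η = Yop η * dL η i + (Complex.I / (Real.sqrt 2 : ℂ)) • gL η i := by
  have key : ∀ j, dL η i * (gL η j * xU η j) = (gL η j * xU η j) * dL η i
      + (if i = j then gL η j else 0) := by
    intro j
    have hg : dL η i * gL η j = gL η j * dL η i := by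
      simp only [gL, mul_smul_comm, smul_mul_assoc, Finset.mul_sum, Finset.sum_mul, g_d]
    rw [← mul_assoc, hg, mul_assoc, d_x, mul_add, mul_assoc]
    split_ifs <;> simp
  rw [Y_eq, mul_smul_comm, Finset.mul_sum, Finset.sum_congr rfl fun j _ => key j,
    Finset.sum_add_distrib, smul_add, smul_mul_assoc, Finset.sum_mul, Finset.sum_ite_eq,
    if_pos (Finset.mem_univ _)]

theorem xL_Y (i : Fin n) : xL η i * Yop η = Yop η * xL η i := by
  simp only [xL, Finset.sum_mul, Finset.mul_sum, mul_smul_comm, smul_mul_assoc, x_Y]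

theorem H_gL (j : Fin n) : Hop η * gL η j = gL η j * Hop η := by
  simp only [gL, Finset.sum_mul, Finset.mul_sum, mul_smul_comm, smul_mul_assoc, H_g]

end Commutation

/-! ### The double coset space as a model of the reduction algebra. -/

section DoubleCoset
variable {n : ℕ} (η : GL (Fin n) ℂ)

theorem hInv_mul_cancel (k : ℤ) : hInv η k * (toLoc η (Hop η) + algebraMap ℂ (Loc η) k) = 1 :=
  Ring.inverse_mul_cancel _ (Hop_isUnit η k)

theorem mul_hInv_cancel (k : ℤ) : (toLoc η (Hop η) + algebraMap ℂ (Loc η) k) * hInv η k = 1 :=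
  Ring.mul_inverse_cancel _ (Hop_isUnit η k)

/-- An element of weight w for the adjoint action of H turns H + k into H + k + w when moved across;
cancelling the units gives the same for inverses. -/
theorem hInv_mul_of_weight {a : Loc η} {w : ℤ}
    (h : toLoc η (Hop η) * a = a * (toLoc η (Hop η) + algebraMap ℂ (Loc η) w)) (k : ℤ) :
    hInv η k * a = a * hInv η (k + w) := by
  have e : (toLoc η (Hop η) + algebraMap ℂ (Loc η) k) * a
      = a * (toLoc η (Hop η) + algebraMap ℂ (Loc η) (k + w : ℤ)) := by
    rw [add_mul, h, Int.cast_add, map_add, Algebra.commutes]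
    simp only [mul_add]
    abel
  calc hInv η k * a
      = hInv η k * (a * (toLoc η (Hop η) + algebraMap ℂ (Loc η) (k + w : ℤ))) * hInv η (k + w) := by
        rw [mul_assoc, mul_assoc, mul_hInv_cancel, mul_one]
    _ = a * hInv η (k + w) := by rw [← e, ← mul_assoc, hInv_mul_cancel, one_mul]

theorem aeval_mul_of_weight {a : Loc η} {w : ℤ}
    (h : toLoc η (Hop η) * a = a * (toLoc η (Hop η) + algebraMap ℂ (Loc η) w)) (p : Polynomial ℂ) :
    Polynomial.aeval (toLoc η (Hop η)) p * a
      = a * Polynomial.aeval (toLoc η (Hop η)) (p.comp (Polynomial.X + Polynomial.C (w : ℂ))) := by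
  induction p using Polynomial.induction_on' with
  | add p q hp hq => simp only [map_add, add_mul, mul_add, Polynomial.add_comp, hp, hq]
  | monomial m c =>
    have e : ∀ m : ℕ, toLoc η (Hop η) ^ m * a
        = a * (toLoc η (Hop η) + algebraMap ℂ (Loc η) w) ^ m := by
      intro m
      induction m with
      | zero => simp
      | succ m ih => rw [pow_succ', mul_assoc, ih, ← mul_assoc, h, mul_assoc, ← pow_succ']
    rw [Polynomial.aeval_monomial, mul_assoc, e, Polynomial.monomial_comp, map_mul, map_pow,
      map_add, Polynomial.aeval_X, Polynomial.aeval_C, Polynomial.aeval_C, ← mul_assoc,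
      Algebra.commutes, mul_assoc]

theorem ratH_mul_of_weight {a : Loc η} {w : ℤ}
    (h : toLoc η (Hop η) * a = a * (toLoc η (Hop η) + algebraMap ℂ (Loc η) w)) (p : Polynomial ℂ)
    (l : List ℤ) : ratH η p l * a
      = a * ratH η (p.comp (Polynomial.X + Polynomial.C (w : ℂ))) (l.map (· + w)) := by
  have e : ∀ l : List ℤ, (l.map (hInv η)).prod * a
      = a * ((l.map (· + w)).map (hInv η)).prod := by
    intro l
    induction l with
    | nil => simp
    | cons k l ih =>
      simp only [List.map_cons, List.prod_cons]
      rw [mul_assoc, ih, ← mul_assoc, hInv_mul_of_weight η h, mul_assoc]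
  rw [ratH, mul_assoc, e, ← mul_assoc, aeval_mul_of_weight η h, mul_assoc]
  rfl

theorem loc_weight_x (i : Fin n) : toLoc η (Hop η) * toLoc η (xU η i)
    = toLoc η (xU η i) * (toLoc η (Hop η) + algebraMap ℂ (Loc η) (-1 : ℤ)) := by
  rw [← map_mul, H_x, map_sub, map_mul]
  simp [mul_add, sub_eq_add_neg]

theorem loc_weight_d (i : Fin n) : toLoc η (Hop η) * toLoc η (dL η i)
    = toLoc η (dL η i) * (toLoc η (Hop η) + algebraMap ℂ (Loc η) (1 : ℤ)) := by
  rw [← map_mul, H_d, map_add, map_mul]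
  simp [mul_add]

theorem loc_weight_g (i : Fin n) : toLoc η (Hop η) * toLoc η (gU η i)
    = toLoc η (gU η i) * (toLoc η (Hop η) + algebraMap ℂ (Loc η) (0 : ℤ)) := by
  rw [← map_mul, H_g, map_mul]
  simp

theorem loc_weight_X : toLoc η (Hop η) * toLoc η (Xop η)
    = toLoc η (Xop η) * (toLoc η (Hop η) + algebraMap ℂ (Loc η) (1 : ℤ)) := by
  rw [loc_H_X]; simp [mul_add]

theorem loc_weight_Y : toLoc η (Hop η) * toLoc η (Yop η)
    = toLoc η (Yop η) * (toLoc η (Hop η) + algebraMap ℂ (Loc η) (-1 : ℤ)) := by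
  rw [loc_H_Y]; simp [mul_add, sub_eq_add_neg]

theorem leftToDouble_Y (m : LeftQuot η) : leftToDouble η (toLoc η (Yop η) • m) = 0 := by
  obtain ⟨a, rfl⟩ := Submodule.Quotient.mk_surjective _ m
  exact (Submodule.Quotient.mk_eq_zero _).2 (Submodule.mem_sup_left
    (Submodule.subset_span ⟨Yop η, Submodule.subset_span (by simp), a, rfl⟩))

/-- Both generators of `gMinus` are left divisible by Y, so the whole span is contained in YA'. -/
theorem exists_of_mem_doubleIdeal {a : Loc η} (ha : a ∈ doubleIdeal η) :
    ∃ b : Loc η, a - toLoc η (Yop η) * b ∈ leftIdeal η := by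
  obtain ⟨y, hy, z, hz, rfl⟩ := Submodule.mem_sup.1 ha
  suffices ∃ b, y = toLoc η (Yop η) * b by
    obtain ⟨b, rfl⟩ := this
    exact ⟨b, by simpa using hz⟩
  induction hy using Submodule.span_induction with
  | mem y hy =>
    obtain ⟨u, hu, a, rfl⟩ := hy
    obtain ⟨b, rfl⟩ := gMinus_eq η hu
    exact ⟨toLoc η b * a, by rw [map_mul, mul_assoc]⟩
  | zero => exact ⟨0, by simp⟩
  | add y y' _ _ h h' =>
    -- The induction hypotheses still ask that the summand plus `z` lie in `doubleIdeal`, so that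
    -- membership is rebuilt here.
    obtain ⟨b, rfl⟩ := h (add_mem (Submodule.mem_sup_left ‹_›) (Submodule.mem_sup_right hz))
    obtain ⟨b', rfl⟩ := h' (add_mem (Submodule.mem_sup_left ‹_›) (Submodule.mem_sup_right hz))
    exact ⟨b + b', by rw [mul_add]⟩
  | smul c y _ h =>
    obtain ⟨b, rfl⟩ := h (add_mem (Submodule.mem_sup_left ‹_›) (Submodule.mem_sup_right hz))
    exact ⟨c • b, by rw [mul_smul_comm]⟩

/-- This identifies A'/II with M'/YM', and is used everywhere to compute modulo YM'. -/
theorem leftToDouble_eq_zero {m : LeftQuot η} :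
    leftToDouble η m = 0 ↔ ∃ b, m = toLoc η (Yop η) • b := by
  refine ⟨fun h => ?_, ?_⟩
  · obtain ⟨a, rfl⟩ := Submodule.Quotient.mk_surjective _ m
    obtain ⟨b, hb⟩ := exists_of_mem_doubleIdeal η ((Submodule.Quotient.mk_eq_zero _).1 h)
    refine ⟨Submodule.Quotient.mk b, ?_⟩
    rw [← Submodule.Quotient.mk_smul, Submodule.Quotient.eq]
    exact hb
  · rintro ⟨b, rfl⟩
    exact leftToDouble_Y η b

/-- The subalgebra of elements whose left multiplication descends to `A'/II`. -/
noncomputable def leftNormalizer : Subalgebra ℂ (Loc η) where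
  carrier := {u | ∀ m, leftToDouble η m = 0 → leftToDouble η (u • m) = 0}
  mul_mem' {a b} ha hb m hm := by rw [mul_smul]; exact ha _ (hb m hm)
  add_mem' {a b} ha hb m hm := by rw [add_smul, map_add, ha m hm, hb m hm, add_zero]
  algebraMap_mem' c m hm := by rw [algebraMap_smul, map_smul, hm, smul_zero]

theorem mem_leftNormalizer {u : Loc η} (u' : Loc η)
    (h : u * toLoc η (Yop η) = toLoc η (Yop η) * u') : u ∈ leftNormalizer η := by
  intro m hm
  obtain ⟨b, rfl⟩ := (leftToDouble_eq_zero η).1 hm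
  rw [← mul_smul, h, mul_smul, leftToDouble_Y]

theorem H_mem_leftNormalizer : toLoc η (Hop η) ∈ leftNormalizer η :=
  mem_leftNormalizer η _ (loc_weight_Y η)

theorem hInv_mem_leftNormalizer (k : ℤ) : hInv η k ∈ leftNormalizer η :=
  mem_leftNormalizer η _ (hInv_mul_of_weight η (loc_weight_Y η) k)

theorem aeval_mem_of {R : Type*} [Ring R] [Algebra ℂ R] {S : Subalgebra ℂ R} {a : R} (h : a ∈ S)
    (p : Polynomial ℂ) : Polynomial.aeval a p ∈ S :=
  Algebra.adjoin_le (Set.singleton_subset_iff.2 h) (Polynomial.aeval_mem_adjoin_singleton ℂ a)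

theorem ratH_mem {S : Subalgebra ℂ (Loc η)} (h : toLoc η (Hop η) ∈ S) (hi : ∀ k, hInv η k ∈ S)
    (p : Polynomial ℂ) (l : List ℤ) : ratH η p l ∈ S := by
  refine mul_mem (aeval_mem_of h p) (list_prod_mem ?_)
  intro u hu
  obtain ⟨k, -, rfl⟩ := List.mem_map.1 hu
  exact hi k

theorem x_mem_leftNormalizer (i : Fin n) : toLoc η (xU η i) ∈ leftNormalizer η :=
  mem_leftNormalizer η (toLoc η (xU η i)) (by rw [← map_mul, x_Y, map_mul])

/-- The coefficients φ_k(H) are built from scalars and inverses of H + integer, all of which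
preserve YM'. Hence the terms of P with k ≥ 1 vanish in the double coset space. -/
theorem phi_mem_leftNormalizer (k : ℕ) : phi (toLoc η (Hop η)) k ∈ leftNormalizer η := by
  induction k with
  | zero => exact one_mem _
  | succ k ih =>
    refine mul_mem ih (mul_mem (pow_mem (neg_mem (one_mem _)) _) ?_)
    unfold kappa
    split_ifs with he
    · have hz : (-((k + 1 : ℕ) : ℂ) / 2) ≠ 0 :=
        div_ne_zero (neg_ne_zero.2 (by exact_mod_cast Nat.succ_ne_zero k)) two_ne_zero
      have e : Ring.inverse (algebraMap ℂ (Loc η) (-((k + 1 : ℕ) : ℂ) / 2))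
          = algebraMap ℂ (Loc η) (-((k + 1 : ℕ) : ℂ) / 2)⁻¹ :=
        Ring.inverse_unit ((Units.mk0 _ hz).map (algebraMap ℂ (Loc η) : ℂ →* Loc η))
      rw [e]
      exact algebraMap_mem _ _
    · obtain ⟨m, hm⟩ := Nat.not_even_iff_odd.1 he
      -- The odd index is k + 1 = 2m + 1, so the shift in κ is the integer m + 1.
      have e : ((((k + 1 : ℕ) : ℂ) + 1) / 2) = ((m + 1 : ℤ) : ℂ) := by rw [hm]; push_cast; ring
      rw [e]
      exact hInv_mem_leftNormalizer η _

/-- The term k = 0 of P is the identity and each later term has Y directly after a function of H, so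
m - Pm lies in YM'. This decomposition replaces the series for P in all computations that follow. -/
theorem extremalProjector_sub (m : LeftQuot η) :
    ∃ b, m = extremalProjector η m + toLoc η (Yop η) • b := by
  obtain ⟨N, hN⟩ := exists_Xpow_smul η m
  have h0 : leftToDouble η (m - extremalProjector η m) = 0 := by
    -- The cutoff is N + 1 rather than N, so that the term k = 0 is present and can be split off.
    have e := proj_eq_sum (h := toLoc η (Hop η)) (Y := toLoc η (Yop η)) (N := N + 1) (v := m)
      (by rw [pow_succ', mul_smul, hN, smul_zero])
    change leftToDouble η (m - proj _ _ _ m) = 0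
    rw [e, Finset.sum_range_succ', map_sub, map_add, map_sum, Finset.sum_eq_zero]
    · simp [phi]
    · intro k _
      rw [mul_assoc, mul_smul, pow_succ' (toLoc η (Yop η)), mul_assoc, mul_smul]
      exact phi_mem_leftNormalizer η (k + 1) _ (leftToDouble_Y η _)
  obtain ⟨b, hb⟩ := (leftToDouble_eq_zero η).1 h0
  exact ⟨b, by rw [← hb]; abel⟩

theorem leftToDouble_extremalProjector (m : LeftQuot η) :
    leftToDouble η (extremalProjector η m) = leftToDouble η m := by
  obtain ⟨b, hb⟩ := extremalProjector_sub η m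
  nth_rewrite 2 [hb]
  rw [map_add, leftToDouble_Y, add_zero]

theorem smul_extremalProjector {u : Loc η} (hu : u ∈ leftNormalizer η) (m : LeftQuot η) :
    leftToDouble η (u • extremalProjector η m) = leftToDouble η (u • m) := by
  obtain ⟨b, hb⟩ := extremalProjector_sub η m
  nth_rewrite 2 [hb]
  rw [smul_add, map_add, hu _ (leftToDouble_Y η b), add_zero]

/-- The left ideal is generated by X alone, because E = X²; so a normalizes it exactly when X
annihilates the class of a in M'. -/
theorem mem_normalizer {a : Loc η} :
    a ∈ normalizer η ↔ toLoc η (Xop η) * a ∈ leftIdeal η := by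
  refine ⟨fun h => h _ (X_mem η), fun h i hi => ?_⟩
  have := leftIdeal_smul η hi (v := (Submodule.Quotient.mk a : LeftQuot η))
    ((Submodule.Quotient.mk_eq_zero _).2 h)
  exact (Submodule.Quotient.mk_eq_zero _).1 this

theorem mul_X_mem (a : Loc η) : a * toLoc η (Xop η) ∈ leftIdeal η :=
  Ideal.mul_mem_left _ _ (X_mem η)

theorem mem_normalizer_of_comm {a : Loc η} (a' : Loc η)
    (h : toLoc η (Xop η) * a = a' * toLoc η (Xop η)) : a ∈ normalizer η :=
  (mem_normalizer η).2 (h ▸ mul_X_mem η a')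

theorem H_mem_normalizer : toLoc η (Hop η) ∈ normalizer η :=
  mem_normalizer_of_comm η (toLoc η (Hop η) - 1) (by rw [sub_mul, loc_H_X]; simp)

theorem hInv_mem_normalizer (k : ℤ) : hInv η k ∈ normalizer η :=
  mem_normalizer_of_comm η (hInv η (k - 1)) (by
    rw [hInv_mul_of_weight η (loc_weight_X η), sub_add_cancel])

theorem d_mem_normalizer (i : Fin n) : toLoc η (dL η i) ∈ normalizer η :=
  mem_normalizer_of_comm η (toLoc η (dL η i)) (by rw [← map_mul, X_d, map_mul])

theorem dU_mem_normalizer (i : Fin n) : toLoc η (dU η i) ∈ normalizer η :=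
  mem_normalizer_of_comm η (toLoc η (dU η i)) (by rw [← map_mul, X_du, map_mul])

theorem extremalProjector_mk {a : Loc η} (ha : a ∈ normalizer η) :
    extremalProjector η (Submodule.Quotient.mk a) = Submodule.Quotient.mk a :=
  proj_of_smul_eq_zero ((Submodule.Quotient.mk_eq_zero _).2 ((mem_normalizer η).1 ha))

theorem diamond_of_left {u : Loc η} (hu : u ∈ leftNormalizer η) (a : Loc η) :
    bar η u ◇ bar η a = bar η (u * a) :=
  smul_extremalProjector η hu _

theorem diamond_of_right (a : Loc η) {u : Loc η} (hu : u ∈ normalizer η) :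
    bar η a ◇ bar η u = bar η (a * u) := by
  rw [diamondMul, diamond_bar, extremalProjector_mk η hu]
  rfl

theorem cosetProjector_bar (z : normalizer η) :
    cosetProjector η (bar η z) = Submodule.Quotient.mk (z : Loc η) :=
  extremalProjector_mk η z.2

theorem exists_normalizer_of_smul_eq_zero {m : LeftQuot η} (h : toLoc η (Xop η) • m = 0) :
    ∃ z : normalizer η, m = Submodule.Quotient.mk (z : Loc η) := by
  obtain ⟨a, rfl⟩ := Submodule.Quotient.mk_surjective _ m
  exact ⟨⟨a, (mem_normalizer η).2 ((Submodule.Quotient.mk_eq_zero _).1 h)⟩, rfl⟩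

/-- Injectivity: P fixes the classes of normalizer elements and factors through A'/II, so it
recovers z. Surjectivity: Pm is killed by X, hence represented by a normalizer element, and has the
same double coset as m. -/
theorem reductionToDouble_bijective : Function.Bijective (reductionToDouble η) := by
  constructor
  · rw [injective_iff_map_eq_zero]
    intro z hz
    obtain ⟨z, rfl⟩ := Ideal.Quotient.mk_surjective z
    rw [reductionToDouble_mk] at hz
    have h := cosetProjector_bar η z
    rw [hz, map_zero] at h
    exact Ideal.Quotient.eq_zero_iff_mem.2 
      ((Submodule.Quotient.mk_eq_zero (leftIdeal η)).1 h.symm)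
  · intro q
    obtain ⟨a, rfl⟩ := Submodule.Quotient.mk_surjective _ q
    obtain ⟨z, hz⟩ := exists_normalizer_of_smul_eq_zero η
      (X_extremalProjector η (Submodule.Quotient.mk a))
    refine ⟨Ideal.Quotient.mk _ z, ?_⟩
    have := leftToDouble_extremalProjector η (Submodule.Quotient.mk a)
    rw [hz] at this
    exact this

theorem reductionToDouble_mul (z w : ReductionAlgebra η) :
    reductionToDouble η (z * w) = reductionToDouble η z ◇ reductionToDouble η w := by
  obtain ⟨z, rfl⟩ := Ideal.Quotient.mk_surjective z
  obtain ⟨w, rfl⟩ := Ideal.Quotient.mk_surjective w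
  rw [← map_mul, reductionToDouble_mk, reductionToDouble_mk, reductionToDouble_mk,
    diamond_of_right η _ w.2]
  rfl

end DoubleCoset

/-! ### The diamond relations between the generators. -/

section Relations
variable {n : ℕ} (η : GL (Fin n) ℂ)

theorem toLoc_smul_smul (a b : WC η) (m : LeftQuot η) :
    toLoc η a • toLoc η b • m = toLoc η (a * b) • m := by
  rw [map_mul, mul_smul]

/-- Write m = Pm + Yb. Modulo YM' the difference of the two sides without correction is γ^i Y b = 2c
x^i b, and x^i X m = x^i X Y b is (H + 1) x^i b modulo YM'. Dividing by H + 1 expresses the unknown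
b through m. -/
theorem g_extremalProjector (i : Fin n) (m : LeftQuot η) :
    leftToDouble η (toLoc η (gU η i) • extremalProjector η m)
      = leftToDouble η (toLoc η (gU η i) • m) - (2 * (Complex.I / (Real.sqrt 2 : ℂ))) •
          leftToDouble η (hInv η 1 • toLoc η (xU η i) • toLoc η (Xop η) • m) := by
  obtain ⟨b, hb⟩ := extremalProjector_sub η m
  have hz := X_extremalProjector η m
  set z := extremalProjector η m
  set c := Complex.I / (Real.sqrt 2 : ℂ)
  have h1 : toLoc η (gU η i) • toLoc η (Yop η) • b
      = -(toLoc η (Yop η) • toLoc η (gU η i) • b) + (2 * c) • toLoc η (xU η i) • b := by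
    rw [toLoc_smul_smul, g_Y, map_add, add_smul, map_neg, neg_smul, map_smul, smul_assoc,
      toLoc_smul_smul]
  have h2 : toLoc η (xU η i) • toLoc η (Xop η) • toLoc η (Yop η) • b
      = (toLoc η (Hop η) + algebraMap ℂ (Loc η) (1 : ℤ)) • toLoc η (xU η i) • b
        - toLoc η (Yop η) • toLoc η (xU η i) • toLoc η (Xop η) • b := by
    have e : xU η i * (Xop η * Yop η) = (Hop η + 1) * xU η i - Yop η * (xU η i * Xop η) := by
      rw [eq_sub_of_add_eq (X_Y η), mul_sub, ← mul_assoc, x_Y, add_mul, H_x, mul_assoc]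
      simp
    rw [toLoc_smul_smul η (Xop η) (Yop η), toLoc_smul_smul η, e, map_sub, sub_smul,
      ← toLoc_smul_smul, ← toLoc_smul_smul, ← toLoc_smul_smul, map_add, map_one, Int.cast_one,
      map_one]
  have h3 : leftToDouble η (hInv η 1 • toLoc η (Yop η) •
      toLoc η (xU η i) • toLoc η (Xop η) • b) = 0 :=
    hInv_mem_leftNormalizer η 1 _ (leftToDouble_Y η _)
  rw [hb, smul_add, smul_add, hz, zero_add, h1, h2, smul_sub, ← mul_smul (hInv η 1),
    hInv_mul_cancel, one_smul]
  simp only [map_add, map_sub, map_neg, map_smul, leftToDouble_Y, h3]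
  module

/-- The same method as for γ: the discrepancy is ∂_i Y b, which is c γ_i b modulo YM'. Solving for
γ_i b with γ_i X m leaves a multiple of x_i X b, and x_i X² m is what removes it. -/
theorem d_extremalProjector (i : Fin n) (m : LeftQuot η) :
    leftToDouble η (toLoc η (dL η i) • extremalProjector η m)
      = leftToDouble η (toLoc η (dL η i) • m) - (Complex.I / (Real.sqrt 2 : ℂ)) •
          leftToDouble η (hInv η 0 • toLoc η (gL η i) • toLoc η (Xop η) • m)
        - leftToDouble η (hInv η 0 • toLoc η (xL η i) • toLoc η (Xop η) • toLoc η (Xop η) • m) := by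
  obtain ⟨b, hb⟩ := extremalProjector_sub η m
  have hz := X_extremalProjector η m
  set z := extremalProjector η m
  have hc := c_sq
  set c := Complex.I / (Real.sqrt 2 : ℂ)
  have h1 : toLoc η (dL η i) • toLoc η (Yop η) • b
      = toLoc η (Yop η) • toLoc η (dL η i) • b + c • toLoc η (gL η i) • b := by
    rw [toLoc_smul_smul, d_Y, map_add, add_smul, map_smul, smul_assoc, toLoc_smul_smul]
  have hXY : toLoc η (Xop η) • toLoc η (Yop η) • b
      = toLoc η (Hop η) • b - toLoc η (Yop η) • toLoc η (Xop η) • b := by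
    rw [toLoc_smul_smul, eq_sub_of_add_eq (X_Y η), map_sub, sub_smul, toLoc_smul_smul]
  have h2 : toLoc η (gL η i) • toLoc η (Xop η) • toLoc η (Yop η) • b
      = (toLoc η (Hop η) + algebraMap ℂ (Loc η) (0 : ℤ)) • toLoc η (gL η i) • b
        + toLoc η (Yop η) • toLoc η (gL η i) • toLoc η (Xop η) • b
        - (2 * c) • toLoc η (xL η i) • toLoc η (Xop η) • b := by
    have e : toLoc η (gL η i) • toLoc η (Yop η) • toLoc η (Xop η) • b
        = -(toLoc η (Yop η) • toLoc η (gL η i) • toLoc η (Xop η) • b)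
          + (2 * c) • toLoc η (xL η i) • toLoc η (Xop η) • b := by
      rw [toLoc_smul_smul, gL_Y, map_add, add_smul, map_neg, neg_smul, map_smul, smul_assoc,
        toLoc_smul_smul η (Yop η)]
    rw [hXY, smul_sub, e, toLoc_smul_smul, ← H_gL, ← toLoc_smul_smul, Int.cast_zero, map_zero,
      add_zero]
    abel
  have h4 : toLoc η (xL η i) • toLoc η (Xop η) • toLoc η (Xop η) • toLoc η (Yop η) • b
      = -(toLoc η (xL η i) • toLoc η (Xop η) • b)
        + toLoc η (Yop η) • toLoc η (xL η i) • toLoc η (Xop η) • toLoc η (Xop η) • b := by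
    -- X² commutes with Y up to -X: apply XY = H - YX twice and then [H, X] = X.
    have e : Xop η * (Xop η * Yop η) = -Xop η + Yop η * (Xop η * Xop η) := by
      have e1 := eq_sub_of_add_eq (X_Y η)
      rw [e1, mul_sub, ← mul_assoc, e1, eq_sub_of_add_eq (H_X η).symm, sub_mul, mul_assoc]
      abel
    rw [toLoc_smul_smul η (Xop η) (Yop η), toLoc_smul_smul η (Xop η) (Xop η * Yop η), e, map_add, map_neg, add_smul, smul_add,
      neg_smul, smul_neg, toLoc_smul_smul η _ (Yop η * _), ← mul_assoc, xL_Y, mul_assoc]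
    simp only [toLoc_smul_smul]
  have h3 : ∀ m, leftToDouble η (hInv η 0 • toLoc η (Yop η) • m) = 0 := fun m =>
    hInv_mem_leftNormalizer η 0 _ (leftToDouble_Y η _)
  rw [hb]
  simp only [smul_add, hz, zero_add]
  rw [h1, h2, h4, smul_sub, smul_add, smul_add, ← mul_smul (hInv η 0),
    hInv_mul_cancel, one_smul]
  simp only [map_add, map_sub, map_neg, map_smul, leftToDouble_Y, h3, smul_neg,
    smul_comm (hInv η 0) (2 * c), smul_add, smul_sub]
  -- The identity c · 2c = -1 makes the two multiples of x_i X b cancel.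
  rw [smul_smul c (2 * c), mul_left_comm, hc]
  module

theorem gBar_diamond (i : Fin n) (a : Loc η) : gBar η i ◇ bar η a
    = bar η (toLoc η (gU η i) * a) - (2 * (Complex.I / (Real.sqrt 2 : ℂ))) •
        (bar η (hInv η 1) ◇ bar η (toLoc η (xU η i) * (toLoc η (Xop η) * a))) := by
  rw [diamond_of_left η (hInv_mem_leftNormalizer η 1)]
  exact g_extremalProjector η i (Submodule.Quotient.mk a)

theorem dBar_diamond (i : Fin n) (a : Loc η) : dBar η i ◇ bar η a
    = bar η (toLoc η (dL η i) * a) - (Complex.I / (Real.sqrt 2 : ℂ)) •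
        (bar η (hInv η 0) ◇ bar η (toLoc η (gL η i) * (toLoc η (Xop η) * a)))
      - bar η (hInv η 0) ◇ bar η (toLoc η (xL η i) * (toLoc η (Xop η) * (toLoc η (Xop η) * a))) := by
  rw [diamond_of_left η (hInv_mem_leftNormalizer η 0),
    diamond_of_left η (hInv_mem_leftNormalizer η 0)]
  exact d_extremalProjector η i (Submodule.Quotient.mk a)

theorem xBar_diamond (i : Fin n) (a : Loc η) : xBar η i ◇ bar η a = bar η (toLoc η (xU η i) * a) :=
  diamond_of_left η (x_mem_leftNormalizer η i) a

theorem bar_X (a : Loc η) : bar η (a * toLoc η (Xop η)) = 0 :=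
  (Submodule.Quotient.mk_eq_zero _).2 (Submodule.mem_sup_right (mul_X_mem η a))

theorem bar_toLoc_X (a : WC η) : bar η (toLoc η (a * Xop η)) = 0 := by
  rw [map_mul, bar_X]

theorem bar_toLoc_Y : bar η (toLoc η (Yop η)) = 0 := by
  have := leftToDouble_Y η (Submodule.Quotient.mk 1)
  rw [← Submodule.Quotient.mk_smul, smul_eq_mul, mul_one] at this
  exact this

theorem diamond_add (p q r : DoubleCoset η) : p ◇ (q + r) = p ◇ q + p ◇ r := map_add _ _ _
theorem diamond_sub (p q r : DoubleCoset η) : p ◇ (q - r) = p ◇ q - p ◇ r := map_sub _ _ _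
theorem diamond_neg (p q : DoubleCoset η) : p ◇ (-q) = -(p ◇ q) := map_neg _ _
theorem diamond_smul (c : ℂ) (p q : DoubleCoset η) : p ◇ (c • q) = c • (p ◇ q) := map_smul _ _ _
theorem diamond_zero (p : DoubleCoset η) : p ◇ 0 = 0 := map_zero _
theorem diamond_sum {ι : Type*} (s : Finset ι) (p : DoubleCoset η) (q : ι → DoubleCoset η) :
    p ◇ (∑ i ∈ s, q i) = ∑ i ∈ s, p ◇ q i := map_sum _ _ _
theorem smul_diamond (c : ℂ) (p q : DoubleCoset η) : (c • p) ◇ q = c • (p ◇ q) := by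
  simp [diamondMul]
theorem sum_diamond {ι : Type*} (s : Finset ι) (p : ι → DoubleCoset η) (q : DoubleCoset η) :
    (∑ i ∈ s, p i) ◇ q = ∑ i ∈ s, p i ◇ q := by
  simp [diamondMul]
theorem diamond_dBar (a : WC η) (i : Fin n) :
    bar η (toLoc η a) ◇ dBar η i = bar η (toLoc η (a * dL η i)) := by
  rw [dBar, diamond_of_right η _ (d_mem_normalizer η i), ← map_mul (toLoc η)]

theorem diamond_dUBar (a : WC η) (i : Fin n) :
    bar η (toLoc η a) ◇ dUBar η i = bar η (toLoc η (a * dU η i)) := by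
  rw [dUBar, diamond_of_right η _ (dU_mem_normalizer η i), ← map_mul (toLoc η)]

theorem gBar_diamond_toLoc (i : Fin n) (a : WC η) : gBar η i ◇ bar η (toLoc η a)
    = bar η (toLoc η (gU η i * a)) - (2 * (Complex.I / (Real.sqrt 2 : ℂ))) •
        (bar η (hInv η 1) ◇ bar η (toLoc η (xU η i * (Xop η * a)))) := by
  rw [gBar_diamond]; simp only [map_mul]

theorem dBar_diamond_toLoc (i : Fin n) (a : WC η) : dBar η i ◇ bar η (toLoc η a)
    = bar η (toLoc η (dL η i * a)) - (Complex.I / (Real.sqrt 2 : ℂ)) •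
        (bar η (hInv η 0) ◇ bar η (toLoc η (gL η i * (Xop η * a))))
      - bar η (hInv η 0) ◇ bar η (toLoc η (xL η i * (Xop η * (Xop η * a)))) := by
  rw [dBar_diamond]; simp only [map_mul]

theorem xBar_diamond_toLoc (i : Fin n) (a : WC η) :
    xBar η i ◇ bar η (toLoc η a) = bar η (toLoc η (xU η i * a)) := by
  rw [xBar_diamond, ← map_mul (toLoc η)]

theorem x_x_diamond (i j : Fin n) : xBar η i ◇ xBar η j = xBar η j ◇ xBar η i := by
  rw [xBar.eq_def η j, xBar_diamond_toLoc, ← xBar, xBar.eq_def η i, xBar_diamond_toLoc, x_x]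

theorem d_d_diamond (i j : Fin n) : dBar η i ◇ dBar η j = dBar η j ◇ dBar η i := by
  rw [dBar.eq_def η i, diamond_dBar, ← dBar, dBar.eq_def η j, diamond_dBar, d_d]

/-- In `dBar_diamond` the X² term dies because X² commutes with γ^j and so ends in X; in the other
correction X γ^j leaves only 2c ∂^j, and c · 2c = -1. -/
theorem d_g_diamond (i j : Fin n) : dBar η i ◇ gBar η j - gBar η j ◇ dBar η i
    = bar η (hInv η 0) ◇ (gLBar η i ◇ dUBar η j) := by
  have e : Xop η * (Xop η * gU η j) = gU η j * Xop η * Xop η := by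
    rw [← mul_assoc, E_g, mul_assoc]
  rw [gLBar, diamond_dUBar]
  nth_rewrite 2 [gBar]
  rw [diamond_dBar, gBar, dBar_diamond_toLoc, e, X_g, g_d, ← mul_assoc (xL η i), bar_toLoc_X,
    diamond_zero, mul_add, mul_neg, mul_smul_comm, ← mul_assoc (gL η i), map_add, map_neg, map_add,
    map_neg, bar_toLoc_X, map_smul, map_smul, neg_zero, zero_add, diamond_smul, smul_smul,
    mul_left_comm, c_sq]
  module

theorem bar_toLoc_algebraMap (c : ℂ) :
    bar η (toLoc η (algebraMap ℂ (WC η) c)) = c • bar η 1 := by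
  rw [AlgHom.commutes, Algebra.algebraMap_eq_smul_one, map_smul]

/-- The discrepancy is symmetrized in the Clifford relation and also lets a class of γγ be traded
for a diamond product. -/
theorem gBar_diamond_gBar (i j : Fin n) : gBar η i ◇ gBar η j
    = bar η (toLoc η (gU η i * gU η j))
      + (2 : ℂ) • (bar η (hInv η 1) ◇ (xBar η i ◇ dUBar η j)) := by
  rw [xBar, diamond_dUBar, gBar.eq_def η j, gBar_diamond_toLoc, X_g, mul_add, mul_neg,
    mul_smul_comm, ← mul_assoc (xU η i), map_add, map_neg, map_add,
    map_neg, bar_toLoc_X, map_smul, map_smul, neg_zero, zero_add, diamond_smul, smul_smul,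
    mul_mul_mul_comm, c_sq]
  module

theorem g_g_diamond (i j : Fin n) : gBar η i ◇ gBar η j + gBar η j ◇ gBar η i
    = (2 * (η : Matrix (Fin n) (Fin n) ℂ) i j) • bar η 1
      + (2 : ℂ) • (bar η (hInv η 1) ◇ (xBar η j ◇ dUBar η i + xBar η i ◇ dUBar η j)) := by
  rw [gBar_diamond_gBar, gBar_diamond_gBar, ← bar_toLoc_algebraMap, ← g_g, map_add, map_add,
    diamond_add]
  module

theorem gLBar_diamond (i : Fin n) (q : DoubleCoset η) : gLBar η i ◇ q
    = ∑ j, ((η⁻¹ : GL (Fin n) ℂ) : Matrix (Fin n) (Fin n) ℂ) i j • (gBar η j ◇ q) := by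
  simp only [gLBar, gL, map_sum, map_smul, sum_diamond, smul_diamond, gBar]

theorem xLBar_diamond (i : Fin n) (q : DoubleCoset η) : xLBar η i ◇ q
    = ∑ j, ((η⁻¹ : GL (Fin n) ℂ) : Matrix (Fin n) (Fin n) ℂ) i j • (xBar η j ◇ q) := by
  simp only [xLBar, xL, map_sum, map_smul, sum_diamond, smul_diamond, xBar]

/-- Partial fractions: 1/(H+k) - 1/(H+k+1) is the product of the two. -/
theorem hInv_eq (k : ℤ) : hInv η k = hInv η (k + 1) + hInv η k * hInv η (k + 1) := by
  have h : toLoc η (Hop η) + algebraMap ℂ (Loc η) (k + 1 : ℤ)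
      = 1 + (toLoc η (Hop η) + algebraMap ℂ (Loc η) k) := by
    rw [Int.cast_add, map_add, Int.cast_one, map_one]; abel
  calc hInv η k = hInv η k * ((toLoc η (Hop η) + algebraMap ℂ (Loc η) (k + 1 : ℤ))
        * hInv η (k + 1)) := by rw [mul_hInv_cancel, mul_one]
    _ = _ := by
      rw [h, add_mul, mul_add, one_mul, ← mul_assoc, hInv_mul_cancel, one_mul, add_comm]

theorem hInv_diamond (k : ℤ) (q : DoubleCoset η) : bar η (hInv η k) ◇ q
    = bar η (hInv η (k + 1)) ◇ q + bar η (hInv η k) ◇ (bar η (hInv η (k + 1)) ◇ q) := by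
  obtain ⟨a, rfl⟩ := Submodule.Quotient.mk_surjective _ q
  change bar η (hInv η k) ◇ bar η a = bar η (hInv η (k + 1)) ◇ bar η a
    + bar η (hInv η k) ◇ (bar η (hInv η (k + 1)) ◇ bar η a)
  simp only [diamond_of_left η (hInv_mem_leftNormalizer η _)]
  rw [← map_add, ← mul_assoc, ← add_mul, ← hInv_eq]

/-- The closed formula for ∂_i gives 1/(2H) times the class of γ_i γ^j plus 1/H times x_i ◇ ∂^j.
Replacing that class by γ_i ◇ γ^j costs 1/(H(H+1)) x_i ◇ ∂^j, and 1/H - 1/(H(H+1)) = 1/(H+1). -/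
theorem d_x_diamond (i j : Fin n) : dBar η i ◇ xBar η j - xBar η j ◇ dBar η i
    = (if i = j then (1 : ℂ) else 0) • bar η 1
      + (1 / 2 : ℂ) • (bar η (hInv η 0) ◇ (gLBar η i ◇ gBar η j))
      + bar η (hInv η 1) ◇ (xLBar η i ◇ dUBar η j) := by
  have hg : gLBar η i ◇ gBar η j = bar η (toLoc η (gL η i * gU η j))
      + (2 : ℂ) • (bar η (hInv η 1) ◇ (xLBar η i ◇ dUBar η j)) := by
    simp only [gLBar_diamond, xLBar_diamond, gBar_diamond_gBar, smul_add, Finset.sum_add_distrib,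
      diamond_sum, diamond_smul, Finset.smul_sum, gL, Finset.sum_mul, smul_mul_assoc, map_sum,
      map_smul, smul_comm (2 : ℂ)]
  have e1 : Xop η * (Xop η * xU η j) = xU η j * Xop η * Xop η - dU η j := by
    rw [← mul_assoc, E_x, mul_assoc]
  have h0 := hInv_diamond η 0 (xLBar η i ◇ dUBar η j)
  have hd : dBar η i ◇ xBar η j = bar η (toLoc η (dL η i * xU η j))
      + (1 / 2 : ℂ) • (bar η (hInv η 0) ◇ bar η (toLoc η (gL η i * gU η j)))
      + bar η (hInv η 0) ◇ (xLBar η i ◇ dUBar η j) := by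
    rw [xLBar, diamond_dUBar, xBar, dBar_diamond_toLoc, e1, X_x, mul_add, mul_sub,
      ← mul_assoc (gL η i), ← mul_assoc (xL η i), mul_smul_comm, map_add, map_add, map_sub, map_sub,
      bar_toLoc_X, bar_toLoc_X, zero_add, zero_sub, map_smul, map_smul, diamond_smul, smul_smul,
      c_sq, diamond_neg]
    module
  rw [hd, hg, h0, xBar, diamond_dBar, d_x, map_add, map_add, bar_toLoc_algebraMap, diamond_add,
    diamond_smul]
  simp only [zero_add]
  module

theorem g_x_diamond (i j : Fin n) : gBar η i ◇ xBar η j - xBar η j ◇ gBar η i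
    = bar η (hInv η 1) ◇ (xBar η i ◇ gBar η j) := by
  rw [gBar, xBar_diamond_toLoc, ← gBar, xBar.eq_def η j, gBar_diamond_toLoc, X_x, mul_add,
    mul_smul_comm, ← mul_assoc (xU η i), map_add, map_add, bar_toLoc_X, zero_add, map_smul,
    map_smul, diamond_smul, smul_smul, mul_assoc, c_sq, gBar, xBar_diamond_toLoc, g_x]
  module

theorem sum_x_d_diamond : ∑ i, xBar η i ◇ dBar η i
    = bar η (algebraMap ℂ _ (-(n : ℂ) / 2) - toLoc η (Hop η)) := by
  simp only [xBar, diamond_dBar]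
  rw [← map_sum, ← map_sum, ← AlgHom.commutes (toLoc η), ← map_sub]
  congr 2
  rw [Hop, Finset.sum_add_distrib, sum_d_x, neg_div, map_neg, div_eq_inv_mul, map_mul,
    ← Algebra.smul_def]
  module

theorem sum_g_d_diamond : ∑ i, gBar η i ◇ dBar η i = 0 := by
  simp only [gBar, diamond_dBar]
  rw [← map_sum, ← map_sum]
  have h : Complex.I / (Real.sqrt 2 : ℂ) ≠ 0 := fun h => by simpa [h] using c_sq
  have e : ∑ i, gU η i * dL η i = (Complex.I / (Real.sqrt 2 : ℂ))⁻¹ • (1 * Xop η) := by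
    rw [one_mul, Xop, inv_smul_smul₀ h]
  rw [e, map_smul, map_smul, bar_toLoc_X, smul_zero]

/-- Each γ^j ◇ x^i is its plain class plus 1/(H+1) times the class with i and j exchanged. The
contraction is symmetric, so both parts become multiples of the class of Y, which is zero. -/
theorem sum_g_x_diamond : ∑ i, gLBar η i ◇ xBar η i = 0 := by
  have h : Complex.I / (Real.sqrt 2 : ℂ) ≠ 0 := fun h => by simpa [h] using c_sq
  have e1 : bar η (toLoc η (∑ i, gL η i * xU η i)) = 0 := by
    have e : ∑ i, gL η i * xU η i = (Complex.I / (Real.sqrt 2 : ℂ))⁻¹ • Yop η := by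
      rw [Y_eq, inv_smul_smul₀ h]
    rw [e, map_smul, map_smul, bar_toLoc_Y, smul_zero]
  have key : ∀ i j, gBar η j ◇ xBar η i = bar η (toLoc η (gU η j * xU η i))
      + bar η (hInv η 1) ◇ bar η (toLoc η (gU η i * xU η j)) := by
    intro i j
    have := g_x_diamond η j i
    rw [gBar.eq_def η j, xBar_diamond_toLoc, gBar.eq_def η i, xBar_diamond_toLoc, ← g_x, ← g_x,
      sub_eq_iff_eq_add'] at this
    exact this
  have e2 : ∑ i, gLBar η i ◇ xBar η i = bar η (toLoc η (∑ i, gL η i * xU η i))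
      + bar η (hInv η 1) ◇ bar η (toLoc η (∑ i, gL η i * xU η i)) := by
    have e3 : ∑ i, gL η i * xU η i = ∑ i, ∑ j,
        ((η⁻¹ : GL (Fin n) ℂ) : Matrix (Fin n) (Fin n) ℂ) i j • (gU η i * xU η j) := by
      rw [Finset.sum_comm]
      simp only [gL, Finset.sum_mul, smul_mul_assoc]
      refine Finset.sum_congr rfl fun i _ => Finset.sum_congr rfl fun j _ => ?_
      rw [Algebra.smul_def, etaInv_symm, ← Algebra.smul_def]
    nth_rewrite 2 [e3]
    simp only [gLBar_diamond, key, gL, Finset.sum_mul, smul_mul_assoc, map_sum, map_smul,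
      diamond_sum, diamond_smul, smul_add, Finset.sum_add_distrib]
  rw [e2, e1, diamond_zero, add_zero]

end Relations

/-! ### Commutation with rational functions of H. -/

section RationalFunctions
variable {n : ℕ} (η : GL (Fin n) ℂ) (p : Polynomial ℂ) (l : List ℤ)

theorem ratH_mem_leftNormalizer : ratH η p l ∈ leftNormalizer η :=
  ratH_mem η (H_mem_leftNormalizer η) (hInv_mem_leftNormalizer η) p l

theorem ratH_mem_normalizer : ratH η p l ∈ normalizer η :=
  ratH_mem η (H_mem_normalizer η) (hInv_mem_normalizer η) p l

theorem ratH_xBar (i : Fin n) : bar η (ratH η p l) ◇ xBar η i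
    = xBar η i ◇ bar η (ratH η (p.comp (Polynomial.X - 1)) (l.map (· - 1))) := by
  rw [xBar, diamond_of_left η (ratH_mem_leftNormalizer η _ _),
    diamond_of_right η _ (ratH_mem_normalizer η _ _), ratH_mul_of_weight η (loc_weight_x η i)]
  simp [sub_eq_add_neg]

theorem ratH_dBar (i : Fin n) : bar η (ratH η p l) ◇ dBar η i
    = dBar η i ◇ bar η (ratH η (p.comp (Polynomial.X + 1)) (l.map (· + 1))) := by
  rw [dBar, diamond_of_left η (ratH_mem_leftNormalizer η _ _),
    diamond_of_right η _ (ratH_mem_normalizer η _ _), ratH_mul_of_weight η (loc_weight_d η i)]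
  simp

theorem ratH_gBar (i : Fin n) : bar η (ratH η p l) ◇ gBar η i
    = gBar η i ◇ bar η (ratH η p l) := by
  rw [gBar, diamond_of_left η (ratH_mem_leftNormalizer η _ _),
    diamond_of_right η _ (ratH_mem_normalizer η _ _), ratH_mul_of_weight η (loc_weight_g η i)]
  simp

end RationalFunctions

/-! ### The double coset space is generated by the classes of the generators. -/

section Generation
variable {n : ℕ} (η : GL (Fin n) ℂ)

theorem diamond_leftToDouble (a : Loc η) (m : LeftQuot η) :
    bar η a ◇ leftToDouble η m = leftToDouble η (a • extremalProjector η m) := by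
  obtain ⟨b, rfl⟩ := Submodule.Quotient.mk_surjective _ m
  rfl

variable {η} {J : Submodule ℂ (DoubleCoset η)}

theorem dU_eq_sum_dBar (m : LeftQuot η) (i : Fin n) : toLoc η (dU η i) • m
    = ∑ j, (η : Matrix (Fin n) (Fin n) ℂ) i j • toLoc η (dL η j) • m := by
  simp only [dU, map_sum, map_smul, Finset.sum_smul, smul_assoc]

theorem gL_smul (m : LeftQuot η) (i : Fin n) : toLoc η (gL η i) • m
    = ∑ j, ((η⁻¹ : GL (Fin n) ℂ) : Matrix (Fin n) (Fin n) ℂ) i j • toLoc η (gU η j) • m := by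
  simp only [gL, map_sum, map_smul, Finset.sum_smul, smul_assoc]

theorem xL_smul (m : LeftQuot η) (i : Fin n) : toLoc η (xL η i) • m
    = ∑ j, ((η⁻¹ : GL (Fin n) ℂ) : Matrix (Fin n) (Fin n) ℂ) i j • toLoc η (xU η j) • m := by
  simp only [xL, map_sum, map_smul, Finset.sum_smul, smul_assoc]

theorem hInv_diamond_leftToDouble (k : ℤ) (m : LeftQuot η) :
    bar η (hInv η k) ◇ leftToDouble η m = leftToDouble η (hInv η k • m) := by
  rw [diamond_leftToDouble, smul_extremalProjector η (hInv_mem_leftNormalizer η k)]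

theorem leftToDouble_x_mem (hx : ∀ i, ∀ q ∈ J, xBar η i ◇ q ∈ J) (i : Fin n) {m : LeftQuot η}
    (hm : leftToDouble η m ∈ J) : leftToDouble η (toLoc η (xU η i) • m) ∈ J := by
  rw [← smul_extremalProjector η (x_mem_leftNormalizer η i), ← diamond_leftToDouble]
  exact hx i _ hm

theorem leftToDouble_hInv_mem (hh : ∀ k, ∀ q ∈ J, bar η (hInv η k) ◇ q ∈ J) (k : ℤ)
    {m : LeftQuot η} (hm : leftToDouble η m ∈ J) : leftToDouble η (hInv η k • m) ∈ J := by
  rw [← hInv_diamond_leftToDouble]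
  exact hh k _ hm

/-- `g_extremalProjector` read backwards: the class of γ^i m is γ^i ◇ m̄ plus a correction in Xm.
This is why Xm must be controlled along with m. -/
theorem leftToDouble_g_mem (hx : ∀ i, ∀ q ∈ J, xBar η i ◇ q ∈ J)
    (hg : ∀ i, ∀ q ∈ J, gBar η i ◇ q ∈ J) (hh : ∀ k, ∀ q ∈ J, bar η (hInv η k) ◇ q ∈ J)
    (i : Fin n) {m : LeftQuot η} (h0 : leftToDouble η m ∈ J)
    (h1 : leftToDouble η (toLoc η (Xop η) • m) ∈ J) :
    leftToDouble η (toLoc η (gU η i) • m) ∈ J := by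
  have e := g_extremalProjector η i m
  rw [← diamond_leftToDouble, eq_sub_iff_add_eq] at e
  rw [← e]
  exact add_mem (hg i _ h0) (J.smul_mem _ (leftToDouble_hInv_mem hh _ (leftToDouble_x_mem hx _ h1)))

/-- The same reading of `d_extremalProjector`; its corrections involve Xm and X²m, so only the
powers 0, 1, 2 enter. -/
theorem leftToDouble_d_mem (hx : ∀ i, ∀ q ∈ J, xBar η i ◇ q ∈ J)
    (hg : ∀ i, ∀ q ∈ J, gBar η i ◇ q ∈ J) (hd : ∀ i, ∀ q ∈ J, dBar η i ◇ q ∈ J)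
    (hh : ∀ k, ∀ q ∈ J, bar η (hInv η k) ◇ q ∈ J)
    (i : Fin n) {m : LeftQuot η} (hm : ∀ k : ℕ, leftToDouble η (toLoc η (Xop η) ^ k • m) ∈ J) :
    leftToDouble η (toLoc η (dL η i) • m) ∈ J := by
  have h0 := hm 0
  have h1 := hm 1
  have h2 := hm 2
  have e := d_extremalProjector η i m
  rw [← diamond_leftToDouble, eq_sub_iff_add_eq, eq_sub_iff_add_eq] at e
  rw [pow_two, mul_smul] at h2
  rw [pow_one] at h1
  rw [pow_zero, one_smul] at h0
  rw [← e]
  refine add_mem (add_mem (hd i _ h0) ?_) (J.smul_mem _ ?_) <;>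
    refine leftToDouble_hInv_mem hh _ ?_
  · rw [xL_smul, map_sum]
    refine sum_mem fun j _ => ?_
    rw [map_smul]
    exact J.smul_mem _ (leftToDouble_x_mem hx _ h2)
  · rw [gL_smul, map_sum]
    refine sum_mem fun j _ => ?_
    rw [map_smul]
    exact J.smul_mem _ (leftToDouble_g_mem hx hg hh _ h1 h2)

theorem Xpow_hInv (k : ℕ) (j : ℤ) : toLoc η (Xop η) ^ k * hInv η j
    = hInv η (j - k) * toLoc η (Xop η) ^ k := by
  induction k generalizing j with
  | zero => simp
  | succ k ih =>
    have h := hInv_mul_of_weight η (loc_weight_X η) (j - 1)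
    rw [sub_add_cancel] at h
    rw [pow_succ, mul_assoc, ← h, ← mul_assoc, ih, mul_assoc]
    push_cast
    ring_nf

/-- A subspace of `A'/II` that contains `1` and is stable under left multiplication by the
generators is everything. -/
theorem eq_top_of_stable (h1 : bar η 1 ∈ J) (hx : ∀ i, ∀ q ∈ J, xBar η i ◇ q ∈ J)
    (hg : ∀ i, ∀ q ∈ J, gBar η i ◇ q ∈ J) (hd : ∀ i, ∀ q ∈ J, dBar η i ◇ q ∈ J)
    (hh : ∀ k, ∀ q ∈ J, bar η (hInv η k) ◇ q ∈ J) : J = ⊤ := by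
  -- V is the largest X-stable subspace of M' whose classes lie in J. It turns out to be stable
  -- under all of A' and to contain the class of 1.
  let V : Submodule ℂ (LeftQuot η) :=
    { carrier := {m | ∀ k : ℕ, leftToDouble η (toLoc η (Xop η) ^ k • m) ∈ J}
      add_mem' := fun ha hb k => by rw [smul_add, map_add]; exact add_mem (ha k) (hb k)
      zero_mem' := fun k => by rw [smul_zero, map_zero]; exact J.zero_mem
      smul_mem' := fun c m hm k => by
        rw [smul_comm, map_smul]; exact J.smul_mem _ (hm k) }
  have hX : ∀ m ∈ V, toLoc η (Xop η) • m ∈ V := fun m hm k => by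
    rw [← mul_smul, ← pow_succ]; exact hm (k + 1)
  have hV : ∀ m ∈ V, leftToDouble η m ∈ J := fun m hm => by simpa using hm 0
  have hXpow : ∀ (k : ℕ), ∀ m ∈ V, toLoc η (Xop η) ^ k • m ∈ V := by
    intro k m hm
    induction k with
    | zero => simpa using hm
    | succ k ih => rw [pow_succ', mul_smul]; exact hX _ ih
  have hVd : ∀ i, ∀ m ∈ V, toLoc η (dL η i) • m ∈ V := by
    intro i m hm k
    have e : Commute (Xop η ^ k) (dL η i) := Commute.pow_left (X_d η i) k
    rw [← map_pow, toLoc_smul_smul, e.eq, ← toLoc_smul_smul, map_pow]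
    exact leftToDouble_d_mem hx hg hd hh i (hXpow k m hm)
  have hVg : ∀ i, ∀ m ∈ V, toLoc η (gU η i) • m ∈ V := by
    intro i m hm k
    -- X γ^i m = -γ^i X m + 2c ∂^i m lowers the power of X by one, at the price of changing the
    -- vector; ∂ has already been dealt with.
    induction k generalizing m with
    | zero =>
      rw [pow_zero, one_smul]
      exact leftToDouble_g_mem hx hg hh i (hV m hm) (hV _ (hX m hm))
    | succ k ih =>
      have e : toLoc η (Xop η) • toLoc η (gU η i) • m
          = -(toLoc η (gU η i) • toLoc η (Xop η) • m)
            + (2 * (Complex.I / (Real.sqrt 2 : ℂ))) • toLoc η (dU η i) • m := by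
        rw [toLoc_smul_smul, X_g, map_add, add_smul, map_neg, neg_smul, map_smul, smul_assoc,
          ← toLoc_smul_smul]
      rw [pow_succ, mul_smul, e, smul_add, smul_neg, map_add, map_neg]
      refine add_mem (neg_mem (ih _ (hX m hm))) ?_
      have h2 : (2 * (Complex.I / (Real.sqrt 2 : ℂ))) • toLoc η (dU η i) • m ∈ V := by
        rw [dU_eq_sum_dBar]
        exact V.smul_mem _ (sum_mem fun j _ => V.smul_mem _ (hVd j m hm))
      exact h2 k
  have hVx : ∀ i, ∀ m ∈ V, toLoc η (xU η i) • m ∈ V := by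
    intro i m hm k
    induction k generalizing m with
    | zero =>
      rw [pow_zero, one_smul]
      exact leftToDouble_x_mem hx i (hV m hm)
    | succ k ih =>
      have e : toLoc η (Xop η) • toLoc η (xU η i) • m
          = toLoc η (xU η i) • toLoc η (Xop η) • m
            + (Complex.I / (Real.sqrt 2 : ℂ)) • toLoc η (gU η i) • m := by
        rw [toLoc_smul_smul, X_x, map_add, add_smul, map_smul, smul_assoc, ← toLoc_smul_smul]
      rw [pow_succ, mul_smul, e, smul_add, map_add]
      exact add_mem (ih _ (hX m hm)) (V.smul_mem _ (hVg i m hm) k)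
  have hVh : ∀ j, ∀ m ∈ V, hInv η j • m ∈ V := by
    intro j m hm k
    rw [← mul_smul, Xpow_hInv, mul_smul]
    exact leftToDouble_hInv_mem hh _ (hm k)
  have hVa : ∀ a : WC η, ∀ m ∈ V, toLoc η a • m ∈ V := by
    intro a
    induction a using WC.induction with
    | hs c =>
      intro m hm
      rw [AlgHom.commutes, algebraMap_smul]
      exact V.smul_mem c hm
    | hx i => exact hVx i
    | hd i => exact hVd i
    | hg i => exact hVg i
    | hadd a b ha hb => intro m hm; rw [map_add, add_smul]; exact add_mem (ha m hm) (hb m hm)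
    | hmul a b ha hb => intro m hm; rw [← toLoc_smul_smul]; exact ha _ (hb m hm)
  -- A fraction is reached by cancelling its denominator: it suffices that s · m in V implies m in
  -- V, which follows from stability under 1/(H+k).
  have hVs : ∀ s ∈ denoms η, ∀ m, toLoc η s • m ∈ V → m ∈ V := by
    intro s hs
    induction hs using Submonoid.closure_induction with
    | mem s hs =>
      obtain ⟨k, rfl⟩ := hs
      intro m hm
      have := hVh k _ hm
      rwa [map_add, AlgHom.commutes, ← mul_smul, hInv_mul_cancel, one_smul] at this
    | one => intro m hm; rwa [map_one, one_smul] at hm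
    | mul s t _ _ ihs iht => intro m hm; rw [← toLoc_smul_smul] at hm; exact iht _ (ihs _ hm)
  have hV1 : (Submodule.Quotient.mk 1 : LeftQuot η) ∈ V := by
    intro k
    rcases k with _ | k
    · rw [pow_zero, one_smul]; exact h1
    · have : toLoc η (Xop η) ^ (k + 1) • (Submodule.Quotient.mk 1 : LeftQuot η) = 0 := by
        rw [← Submodule.Quotient.mk_smul, smul_eq_mul, mul_one, pow_succ]
        exact (Submodule.Quotient.mk_eq_zero _).2 (mul_X_mem η _)
      rw [this, map_zero]
      exact J.zero_mem
  rw [eq_top_iff]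
  rintro q -
  obtain ⟨a, rfl⟩ := Submodule.Quotient.mk_surjective _ q
  refine hV (Submodule.Quotient.mk a) ?_
  induction a using OreLocalization.ind with | _ a s
  refine hVs s s.2 _ ?_
  have e1 : toLoc η (s : WC η) * ((a /ₒ s : Loc η)) = toLoc η a * 1 :=
    (OreLocalization.mul_cancel).trans (mul_one (toLoc η a)).symm
  rw [← Submodule.Quotient.mk_smul, smul_eq_mul, e1, ← smul_eq_mul, Submodule.Quotient.mk_smul]
  exact hVa a _ hV1

end Generation

/-! ### The homomorphism from the presented algebra, and its surjectivity. -/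

section PresentationMap
variable {n : ℕ} (η : GL (Fin n) ℂ)

/-- The class in `A'/II` of a generator of the presented algebra. -/
noncomputable def genBar : PGen n → DoubleCoset η
  | .x i => xBar η i
  | .d i => dBar η i
  | .g i => gBar η i
  | .h => bar η (toLoc η (Hop η))
  | .inv k => bar η (hInv η k)

/-- The bijection `Z_n' → A'/II` as a linear equivalence. -/
noncomputable def reductionEquiv : ReductionAlgebra η ≃ₗ[ℂ] DoubleCoset η :=
  LinearEquiv.ofBijective (reductionToDouble η) (reductionToDouble_bijective η)

noncomputable def freeToReduction : PFree n →ₐ[ℂ] ReductionAlgebra η :=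
  FreeAlgebra.lift ℂ fun g => (reductionEquiv η).symm (genBar η g)

theorem reductionToDouble_freeToReduction_gen (g : PGen n) :
    reductionToDouble η (freeToReduction η (FreeAlgebra.ι ℂ g)) = genBar η g := by
  rw [freeToReduction, FreeAlgebra.lift_ι_apply]
  exact (reductionEquiv η).apply_symm_apply _

theorem reductionToDouble_one : reductionToDouble η 1 = bar η 1 :=
  reductionToDouble_mk η 1

-- Each relation is tested after the injection into A'/II, where products become diamond products
-- and the relations are the ones already established.
set_option maxHeartbeats 1000000 in
theorem freeToReduction_rel {a b : PFree n} (h : PresRel η a b) :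
    freeToReduction η a = freeToReduction η b := by
  have hx : ∀ i, reductionToDouble η (freeToReduction η (px i)) = xBar η i := fun i =>
    reductionToDouble_freeToReduction_gen η (.x i)
  have hd : ∀ i, reductionToDouble η (freeToReduction η (pd i)) = dBar η i := fun i =>
    reductionToDouble_freeToReduction_gen η (.d i)
  have hg : ∀ i, reductionToDouble η (freeToReduction η (pg i)) = gBar η i := fun i =>
    reductionToDouble_freeToReduction_gen η (.g i)
  have hh : reductionToDouble η (freeToReduction η ph) = bar η (toLoc η (Hop η)) :=
    reductionToDouble_freeToReduction_gen η .h
  have hi : ∀ k, reductionToDouble η (freeToReduction η (pinv k)) = bar η (hInv η k) := fun k =>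
    reductionToDouble_freeToReduction_gen η (.inv k)
  have hxL : ∀ i, reductionToDouble η (freeToReduction η (pxL η i)) = xLBar η i := fun i => by
    simp only [pxL, xLBar, xL, map_sum, map_smul, hx, xBar]
  have hdU : ∀ i, reductionToDouble η (freeToReduction η (pdU η i)) = dUBar η i := fun i => by
    simp only [pdU, dUBar, dU, map_sum, map_smul, hd, dBar]
  have hgL : ∀ i, reductionToDouble η (freeToReduction η (pgL η i)) = gLBar η i := fun i => by
    simp only [pgL, gLBar, gL, map_sum, map_smul, hg, gBar]
  have hs : ∀ c : ℂ, reductionToDouble η (freeToReduction η (algebraMap ℂ _ c))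
      = c • bar η 1 := fun c => by
    rw [AlgHom.commutes, Algebra.algebraMap_eq_smul_one, map_smul, reductionToDouble_one]
  have hs' : ∀ c : ℂ, c • bar η 1 = bar η (algebraMap ℂ (Loc η) c) := fun c => by
    rw [Algebra.algebraMap_eq_smul_one, map_smul]
  have hm : ∀ a b, reductionToDouble η (freeToReduction η (a * b))
      = reductionToDouble η (freeToReduction η a) ◇ reductionToDouble η (freeToReduction η b) :=
    fun a b => by rw [map_mul, reductionToDouble_mul]
  have h1 : reductionToDouble η (freeToReduction η 1) = bar η 1 := by
    rw [map_one, reductionToDouble_one]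
  have hHl := fun a => diamond_of_left η (H_mem_leftNormalizer η) a
  have hHr := fun a => diamond_of_right η a (H_mem_normalizer η)
  apply (reductionToDouble_bijective η).1
  cases h with
  | inv_mul k =>
    rw [hm, map_add, map_add, hs, hi, hh, h1, hs', ← map_add,
      diamond_of_left η (hInv_mem_leftNormalizer η k), hInv_mul_cancel]
  | mul_inv k =>
    rw [hm, map_add, map_add, hs, hi, hh, h1, hs', ← map_add,
      diamond_of_right η _ (hInv_mem_normalizer η k), mul_hInv_cancel]
  | h_x i =>
    rw [hm, hm, map_sub, map_sub, hh, hx, h1, xBar, hHl, diamond_sub, hHr, loc_weight_x,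
      diamond_of_right η _ (one_mem _), ← map_sub]
    simp [mul_add, sub_eq_add_neg]
  | h_d i =>
    rw [hm, hm, map_add, map_add, hh, hd, h1, dBar, hHl, diamond_add, hHr, loc_weight_d,
      diamond_of_right η _ (one_mem _), ← map_add]
    simp [mul_add]
  | h_g i =>
    rw [hm, hm, hh, hg, gBar, hHl, hHr, loc_weight_g]
    simp
  | x_x i j => rw [hm, hm, hx, hx, x_x_diamond]
  | d_d i j => rw [hm, hm, hd, hd, d_d_diamond]
  | d_g i j =>
    rw [map_sub, map_sub, hm, hm, hd, hg, d_g_diamond, hm, hi, hm, hgL, hdU]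
  | g_g i j =>
    rw [map_add, map_add, hm, hm, hg, hg, g_g_diamond, map_add, map_add, hs, map_smul, map_smul, hm,
      hi, map_add, map_add, hm, hm, hx, hx, hdU, hdU]
  | d_x i j =>
    rw [map_sub, map_sub, hm, hm, hd, hx, d_x_diamond, map_add, map_add, map_add, map_add, hs,
      map_smul, map_smul, hm, hi, hm, hgL, hg, hm, hi, hm, hxL, hdU]
  | g_x i j =>
    rw [map_sub, map_sub, hm, hm, hg, hx, g_x_diamond, hm, hi, hm, hx, hg]
  | sum_x_d =>
    simp only [map_sub, map_sum, hm, hx, hd, hs, hh, sum_x_d_diamond]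
    rw [hs']
  | sum_g_d => simp only [map_sum, hm, hg, hd, sum_g_d_diamond, map_zero]
  | sum_g_x => simp only [map_sum, hm, hgL, hx, sum_g_x_diamond, map_zero]

/-- The homomorphism from the presented algebra to `Z_n'`. -/
noncomputable def presentedToReduction : Presented η →ₐ[ℂ] ReductionAlgebra η :=
  RingQuot.liftAlgHom ℂ ⟨freeToReduction η, fun _ _ h => freeToReduction_rel η h⟩

theorem presentedToReduction_of (a : PFree n) :
    presentedToReduction η (Presented.of η a) = freeToReduction η a :=
  RingQuot.liftAlgHom_mkAlgHom_apply ℂ _ _ a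

/-- The image in A'/II contains the class of 1 and is stable under left multiplication by the
generators, so `eq_top_of_stable` applies; stability under the class of H itself is not needed
there. -/
theorem presentedToReduction_surjective : Function.Surjective (presentedToReduction η) := by
  let J : Submodule ℂ (DoubleCoset η) :=
    (LinearMap.range (presentedToReduction η).toLinearMap).map (reductionToDouble η)
  have hJ : ∀ g, ∀ q ∈ J, genBar η g ◇ q ∈ J := by
    rintro g _ ⟨_, ⟨z, rfl⟩, rfl⟩
    refine ⟨_, ⟨Presented.of η (FreeAlgebra.ι ℂ g) * z, rfl⟩, ?_⟩
    change reductionToDouble η (presentedToReduction η (_ * z)) = _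
    rw [map_mul, reductionToDouble_mul, presentedToReduction_of,
      reductionToDouble_freeToReduction_gen]
    rfl
  have h : J = ⊤ := eq_top_of_stable
    ⟨1, ⟨1, map_one (presentedToReduction η)⟩, reductionToDouble_one η⟩
    (fun i => hJ (.x i)) (fun i => hJ (.g i)) (fun i => hJ (.d i)) (fun k => hJ (.inv k))
  intro z
  have hz : reductionToDouble η z ∈ J := h ▸ Submodule.mem_top
  obtain ⟨_, ⟨w, rfl⟩, hw⟩ := hz
  exact ⟨w, (reductionToDouble_bijective η).1 hw⟩

end PresentationMap

/-! ### Contractions, and the relations with all indices raised. -/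

/-- The contraction `η_{ij} f^{ij}`. -/
noncomputable def contract {n : ℕ} (η : GL (Fin n) ℂ) {M : Type*} [AddCommGroup M] [Module ℂ M]
    (f : Fin n → Fin n → M) : M :=
  ∑ i, ∑ j, ((η⁻¹ : GL (Fin n) ℂ) : Matrix (Fin n) (Fin n) ℂ) i j • f i j

/-- Elements of an algebra that satisfy the relations of the presented algebra, with all indices
raised: `p i` stands for `∂^i`. -/
structure DiracData {n : ℕ} (η : GL (Fin n) ℂ) (B : Type*) [Ring B] [Algebra ℂ B] where
  x : Fin n → B
  p : Fin n → B
  g : Fin n → B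
  h : B
  inv : ℤ → B
  inv_mul' (k : ℤ) : inv k * (h + algebraMap ℂ B k) = 1
  mul_inv' (k : ℤ) : (h + algebraMap ℂ B k) * inv k = 1
  h_x (i : Fin n) : h * x i = x i * (h - 1)
  h_p (i : Fin n) : h * p i = p i * (h + 1)
  h_g (i : Fin n) : h * g i = g i * h
  x_x (i j : Fin n) : x i * x j = x j * x i
  p_p (i j : Fin n) : p i * p j = p j * p i
  p_g (i j : Fin n) : p i * g j = g j * p i + inv 0 * (g i * p j)
  g_g (i j : Fin n) : g i * g j + g j * g i = (2 * (η : Matrix (Fin n) (Fin n) ℂ) i j) • (1 : B)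
    + (2 : ℂ) • (inv 1 * (x j * p i + x i * p j))
  p_x (i j : Fin n) : p i * x j = x j * p i + (η : Matrix (Fin n) (Fin n) ℂ) i j • (1 : B)
    + (1 / 2 : ℂ) • (inv 0 * (g i * g j)) + inv 1 * (x i * p j)
  g_x (i j : Fin n) : g i * x j = x j * g i + inv 1 * (x i * g j)
  contract_x_p : contract η (fun i j => x i * p j) = (-(n : ℂ) / 2) • (1 : B) - h
  contract_g_p : contract η (fun i j => g i * p j) = 0
  contract_g_x : contract η (fun i j => g i * x j) = 0

section Contract
variable {n : ℕ} (η : GL (Fin n) ℂ) {M N : Type*} [AddCommGroup M] [Module ℂ M]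
  [AddCommGroup N] [Module ℂ N]

theorem contract_add (f g : Fin n → Fin n → M) :
    contract η (fun i j => f i j + g i j) = contract η f + contract η g := by
  simp only [contract, smul_add, Finset.sum_add_distrib]

theorem contract_sub (f g : Fin n → Fin n → M) :
    contract η (fun i j => f i j - g i j) = contract η f - contract η g := by
  simp only [contract, smul_sub, Finset.sum_sub_distrib]

theorem contract_map (L : M →ₗ[ℂ] N) (f : Fin n → Fin n → M) :
    contract η (fun i j => L (f i j)) = L (contract η f) := by
  simp only [contract, map_sum, map_smul]

theorem contract_smul (c : ℂ) (f : Fin n → Fin n → M) :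
    contract η (fun i j => c • f i j) = c • contract η f :=
  contract_map η (LinearMap.lsmul ℂ M c) f

variable {B : Type*} [Ring B] [Algebra ℂ B]

theorem contract_mul_left (a : B) (f : Fin n → Fin n → B) :
    contract η (fun i j => a * f i j) = a * contract η f :=
  contract_map η (LinearMap.mulLeft ℂ a) f

theorem contract_mul_right (a : B) (f : Fin n → Fin n → B) :
    contract η (fun i j => f i j * a) = contract η f * a :=
  contract_map η (LinearMap.mulRight ℂ a) f

theorem contract_comm (f : Fin n → Fin n → Fin n → Fin n → M) :
    contract η (fun i j => contract η fun k l => f i j k l)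
      = contract η (fun k l => contract η fun i j => f i j k l) := by
  simp only [contract, Finset.smul_sum]
  have e : ∀ i, ∑ j, ∑ k, ∑ l, ((η⁻¹ : GL (Fin n) ℂ) : Matrix (Fin n) (Fin n) ℂ) i j •
      ((η⁻¹ : GL (Fin n) ℂ) : Matrix (Fin n) (Fin n) ℂ) k l • f i j k l
      = ∑ k, ∑ l, ∑ j, ((η⁻¹ : GL (Fin n) ℂ) : Matrix (Fin n) (Fin n) ℂ) k l •
      ((η⁻¹ : GL (Fin n) ℂ) : Matrix (Fin n) (Fin n) ℂ) i j • f i j k l := by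
    intro i
    rw [Finset.sum_comm]
    refine Finset.sum_congr rfl fun k _ => ?_
    rw [Finset.sum_comm]
    exact Finset.sum_congr rfl fun l _ => Finset.sum_congr rfl fun j _ => smul_comm _ _ _
  rw [Finset.sum_congr rfl fun i _ => e i, Finset.sum_comm]
  exact Finset.sum_congr rfl fun k _ => Finset.sum_comm

variable {η}

theorem inv_isSymm (hη : (η : Matrix (Fin n) (Fin n) ℂ).IsSymm) :
    ((η⁻¹ : GL (Fin n) ℂ) : Matrix (Fin n) (Fin n) ℂ).IsSymm := by
  rw [Matrix.coe_units_inv, Matrix.IsSymm, Matrix.transpose_nonsing_inv, hη.eq]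

theorem contract_swap (hη : (η : Matrix (Fin n) (Fin n) ℂ).IsSymm) (f : Fin n → Fin n → M) :
    contract η (fun i j => f j i) = contract η f := by
  rw [contract, Finset.sum_comm]
  exact Finset.sum_congr rfl fun i _ => Finset.sum_congr rfl fun j _ => by
    rw [(inv_isSymm hη).apply]

theorem inv_mul_eta (i j : Fin n) :
    ∑ k, ((η⁻¹ : GL (Fin n) ℂ) : Matrix (Fin n) (Fin n) ℂ) i k * (η : Matrix (Fin n) (Fin n) ℂ) k j
      = if i = j then 1 else 0 := by
  rw [← Matrix.mul_apply, ← Matrix.GeneralLinearGroup.coe_mul, inv_mul_cancel,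
    Matrix.GeneralLinearGroup.coe_one, Matrix.one_apply]

theorem contract_eta (hη : (η : Matrix (Fin n) (Fin n) ℂ).IsSymm) (v : M) :
    contract η (fun i j => (η : Matrix (Fin n) (Fin n) ℂ) i j • v) = (n : ℂ) • v := by
  simp only [contract, smul_smul, ← Finset.sum_smul]
  congr 1
  have e : ∀ i, ∑ j, ((η⁻¹ : GL (Fin n) ℂ) : Matrix (Fin n) (Fin n) ℂ) i j *
      (η : Matrix (Fin n) (Fin n) ℂ) i j = 1 := fun i => by
    simpa [hη.apply] using inv_mul_eta (η := η) i i
  rw [Finset.sum_congr rfl fun i _ => e i]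
  simp

theorem contract_contract_eta (hη : (η : Matrix (Fin n) (Fin n) ℂ).IsSymm) (f : Fin n → Fin n → M) :
    contract η (fun i j => contract η fun k l => (η : Matrix (Fin n) (Fin n) ℂ) i k • f l j)
      = contract η f := by
  have e : ∀ i j, contract η (fun k l => (η : Matrix (Fin n) (Fin n) ℂ) i k • f l j) = f i j := by
    intro i j
    rw [contract, Finset.sum_comm]
    simp only [smul_smul, ← Finset.sum_smul]
    have e : ∀ l, ∑ k, ((η⁻¹ : GL (Fin n) ℂ) : Matrix (Fin n) (Fin n) ℂ) k l *
        (η : Matrix (Fin n) (Fin n) ℂ) i k = if l = i then 1 else 0 := fun l => by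
      rw [← inv_mul_eta]
      exact Finset.sum_congr rfl fun k _ => by rw [(inv_isSymm hη).apply, hη.apply]
    rw [Finset.sum_congr rfl fun l _ => by rw [e l]]
    simp
  simp only [e]

end Contract

/-! ### The operators on sequences. -/

namespace DiracData
variable {n : ℕ} {η : GL (Fin n) ℂ} {B : Type*} [Ring B] [Algebra ℂ B] (D : DiracData η B)

theorem h_inv (k : ℤ) : D.h * D.inv k = 1 - (k : ℂ) • D.inv k := by
  rw [eq_sub_iff_add_eq, Algebra.smul_def, ← add_mul, D.mul_inv']

theorem inv_h (k : ℤ) : D.inv k * D.h = 1 - (k : ℂ) • D.inv k := by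
  rw [eq_sub_iff_add_eq, Algebra.smul_def, Algebra.commutes, ← mul_add, D.inv_mul']

theorem inv_mul_of_weight {a : B} {w : ℤ} (h : D.h * a = a * (D.h + algebraMap ℂ B w)) (k : ℤ) :
    a * D.inv (k + w) = D.inv k * a := by
  have e : (D.h + algebraMap ℂ B k) * a = a * (D.h + algebraMap ℂ B (k + w : ℤ)) := by
    rw [add_mul, h, Int.cast_add, map_add, Algebra.commutes]
    simp only [mul_add]
    abel
  calc a * D.inv (k + w)
      = D.inv k * ((D.h + algebraMap ℂ B k) * a) * D.inv (k + w) := by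
        rw [← mul_assoc, D.inv_mul', one_mul]
    _ = D.inv k * a := by rw [e, mul_assoc, mul_assoc, D.mul_inv', mul_one]

theorem x_inv (k : ℤ) (i : Fin n) : D.x i * D.inv k = D.inv (k + 1) * D.x i := by
  have h : D.h * D.x i = D.x i * (D.h + algebraMap ℂ B (-1 : ℤ)) := by
    rw [D.h_x]; simp [sub_eq_add_neg]
  have := D.inv_mul_of_weight h (k + 1)
  rwa [add_neg_cancel_right] at this

theorem p_inv (k : ℤ) (i : Fin n) : D.p i * D.inv k = D.inv (k - 1) * D.p i := by
  have h : D.h * D.p i = D.p i * (D.h + algebraMap ℂ B (1 : ℤ)) := by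
    rw [D.h_p]; simp
  have := D.inv_mul_of_weight h (k - 1)
  rwa [sub_add_cancel] at this

theorem g_inv (k : ℤ) (i : Fin n) : D.g i * D.inv k = D.inv k * D.g i := by
  have h : D.h * D.g i = D.g i * (D.h + algebraMap ℂ B (0 : ℤ)) := by
    rw [D.h_g]; simp
  have := D.inv_mul_of_weight h k
  rwa [add_zero] at this

/-- Partial fractions. They remove products of inverses, so that the computations below become
linear over normally ordered monomials. -/
theorem inv_inv {j k : ℤ} (hjk : k ≠ j) :
    D.inv j * D.inv k = (1 / ((k : ℂ) - j)) • (D.inv j - D.inv k) := by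
  have hz : (k : ℂ) - j ≠ 0 := sub_ne_zero.2 (Int.cast_injective.ne hjk)
  have e : D.inv j - D.inv k = ((k : ℂ) - j) • (D.inv j * D.inv k) := by
    have e1 : D.inv j * (D.h * D.inv k) = D.inv j - (k : ℂ) • (D.inv j * D.inv k) := by
      rw [D.h_inv, mul_sub, mul_one, mul_smul_comm]
    have e2 : D.inv j * D.h * D.inv k = D.inv k - (j : ℂ) • (D.inv j * D.inv k) := by
      rw [D.inv_h, sub_mul, one_mul, smul_mul_assoc]
    rw [mul_assoc, e1] at e2
    linear_combination (norm := module) e2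
  rw [e, smul_smul, one_div, inv_mul_cancel₀ hz, one_smul]

/-- The shift `(b_k) ↦ (b_{k+1})`, which represents the Dirac operator `γ^i ∂_i`. -/
def shift (B : Type*) [Ring B] [Algebra ℂ B] : Module.End ℂ (ℕ → B) where
  toFun b k := b (k + 1)
  map_add' _ _ := rfl
  map_smul' _ _ := rfl

/-- The action of `∂^i` on sequences. -/
noncomputable def actP (i : Fin n) : Module.End ℂ (ℕ → B) where
  -- With X = cT, this is `d_extremalProjector` solved for the class of ∂^i m and applied to T^k m,
  -- which is legitimate as T commutes with ∂^i. Its class of γ^i T m is turned into a product by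
  -- `g_extremalProjector`, which changes the coefficient of x^i T² m from -1/(2H) to -1/(2(H+1)).
  toFun b k := D.p i * b k - (1 / 2 : ℂ) • (D.inv 0 * (D.g i * b (k + 1)))
    - (1 / 2 : ℂ) • (D.inv 1 * (D.x i * b (k + 2)))
  map_add' b b' := by
    ext k
    simp only [Pi.add_apply, mul_add, smul_add]
    abel
  map_smul' c b := by
    ext k
    simp only [Pi.smul_apply, mul_smul_comm, RingHom.id_apply]
    module

/-- The value at 0 is `g_extremalProjector` solved for the class of γ^i m, using 2c² = -1. The
recursion is the rule T γ^i = 2∂^i - γ^i T, with T read as the shift. -/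
noncomputable def actGFun (i : Fin n) : ℕ → (ℕ → B) → B
  | 0, b => D.g i * b 0 - D.inv 1 * (D.x i * b 1)
  | k + 1, b => -actGFun i k (shift B b) + (2 : ℂ) • D.actP i b k

/-- The action of `γ^i` on sequences. -/
noncomputable def actG (i : Fin n) : Module.End ℂ (ℕ → B) where
  toFun b k := D.actGFun i k b
  map_add' b b' := by
    ext k
    induction k generalizing b b' with
    | zero =>
      simp only [Pi.add_apply, actGFun, mul_add]
      abel
    | succ k ih =>
      simp only [Pi.add_apply, actGFun, map_add, smul_add] at ih ⊢
      rw [ih]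
      abel
  map_smul' c b := by
    ext k
    induction k generalizing b with
    | zero =>
      simp only [Pi.smul_apply, actGFun, mul_smul_comm, RingHom.id_apply, smul_sub]
    | succ k ih =>
      simp only [Pi.smul_apply, actGFun, map_smul, RingHom.id_apply] at ih ⊢
      rw [ih]
      module

/-- At index 0 the class of x^i m is a plain product; the recursion is T x^i = x^i T + γ^i. -/
noncomputable def actXFun (i : Fin n) : ℕ → (ℕ → B) → B
  | 0, b => D.x i * b 0
  | k + 1, b => actXFun i k (shift B b) + D.actG i b k

/-- The action of `x^i` on sequences. -/
noncomputable def actX (i : Fin n) : Module.End ℂ (ℕ → B) where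
  toFun b k := D.actXFun i k b
  map_add' b b' := by
    ext k
    induction k generalizing b b' with
    | zero => simp only [Pi.add_apply, actXFun, mul_add]
    | succ k ih =>
      simp only [Pi.add_apply, actXFun, map_add] at ih ⊢
      rw [ih]
      abel
  map_smul' c b := by
    ext k
    induction k generalizing b with
    | zero => simp only [Pi.smul_apply, actXFun, mul_smul_comm, RingHom.id_apply]
    | succ k ih =>
      simp only [Pi.smul_apply, actXFun, map_smul, RingHom.id_apply] at ih ⊢
      rw [ih, smul_add]

theorem shift_apply (b : ℕ → B) (k : ℕ) : shift B b k = b (k + 1) := rfl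

theorem shift_P (i : Fin n) : shift B * D.actP i = D.actP i * shift B := rfl

theorem shift_G (i : Fin n) :
    shift B * D.actG i = (2 : ℂ) • D.actP i - D.actG i * shift B := by
  rw [sub_eq_neg_add]; rfl

theorem shift_X (i : Fin n) : shift B * D.actX i = D.actX i * shift B + D.actG i := rfl

theorem P_apply (i : Fin n) (b : ℕ → B) (k : ℕ) : D.actP i b k
    = D.p i * b k - (1 / 2 : ℂ) • (D.inv 0 * (D.g i * b (k + 1)))
      - (1 / 2 : ℂ) • (D.inv 1 * (D.x i * b (k + 2))) := rfl

theorem G_zero (i : Fin n) (b : ℕ → B) :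
    D.actG i b 0 = D.g i * b 0 - D.inv 1 * (D.x i * b 1) := rfl

theorem G_one (i : Fin n) (b : ℕ → B) : D.actG i b 1
    = -(D.g i * b 1 - D.inv 1 * (D.x i * b 2)) + (2 : ℂ) • D.actP i b 0 := rfl

/-- T² commutes with γ^i, which is seen here as the cancellation of the two contributions of `actP`.
-/
theorem G_two (i : Fin n) (b : ℕ → B) :
    D.actG i b 2 = D.g i * b 2 - D.inv 1 * (D.x i * b 3) := by
  change -(-(D.g i * b 2 - D.inv 1 * (D.x i * b 3)) + (2 : ℂ) • D.actP i (shift B b) 0)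
    + (2 : ℂ) • D.actP i (shift B b) 0 = _
  abel

theorem X_zero (i : Fin n) (b : ℕ → B) : D.actX i b 0 = D.x i * b 0 := rfl

theorem X_one (i : Fin n) (b : ℕ → B) : D.actX i b 1 = D.x i * b 1 + D.actG i b 0 := rfl

theorem X_two (i : Fin n) (b : ℕ → B) :
    D.actX i b 2 = D.x i * b 2 + (2 : ℂ) • D.actP i b 0 := by
  change D.x i * b 2 + (D.g i * b 1 - D.inv 1 * (D.x i * b 2))
    + (-(D.g i * b 1 - D.inv 1 * (D.x i * b 2)) + (2 : ℂ) • D.actP i b 0) = _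
  abel

/-- The entry at k of R b is, up to a power of ε, the entry at 0 of R applied to the k-fold shift of
b. An operator relation compatible with the shift thus needs checking at index 0 only. -/
theorem eq_zero_of_shift {R : Module.End ℂ (ℕ → B)} (ε : ℂ)
    (h : shift B * R = ε • (R * shift B)) (h0 : ∀ b, R b 0 = 0) : R = 0 := by
  have key : ∀ k b, R b k = 0 := by
    intro k
    induction k with
    | zero => exact h0
    | succ k ih =>
      intro b
      have := congrFun (LinearMap.congr_fun h b) k
      exact this.trans (by
        change ε • R (shift B b) k = 0
        rw [ih, smul_zero])
  ext b k
  exact key k b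

theorem inv01 : D.inv 0 * D.inv 1 = D.inv 0 - D.inv 1 := by
  have := D.inv_inv (j := 0) (k := 1) (by norm_num)
  rwa [Int.cast_one, Int.cast_zero, sub_zero, div_one, one_smul] at this

theorem inv12 : D.inv 1 * D.inv 2 = D.inv 1 - D.inv 2 := by
  have := D.inv_inv (j := 1) (k := 2) (by norm_num)
  rw [this]
  push_cast
  module

theorem inv_neg10 : D.inv (-1) * D.inv 0 = D.inv (-1) - D.inv 0 := by
  have := D.inv_inv (j := -1) (k := 0) (by norm_num)
  rw [this]
  push_cast
  module

theorem x_inv0 (i : Fin n) : D.x i * D.inv 0 = D.inv 1 * D.x i := D.x_inv 0 i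
theorem x_inv1 (i : Fin n) : D.x i * D.inv 1 = D.inv 2 * D.x i := D.x_inv 1 i
theorem p_inv0 (i : Fin n) : D.p i * D.inv 0 = D.inv (-1) * D.p i := D.p_inv 0 i
theorem p_inv1 (i : Fin n) : D.p i * D.inv 1 = D.inv 0 * D.p i := D.p_inv 1 i

section Assoc
variable (z : B) (i j : Fin n)

theorem inv01_assoc : D.inv 0 * (D.inv 1 * z) = D.inv 0 * z - D.inv 1 * z := by
  rw [← mul_assoc, inv01, sub_mul]
theorem inv12_assoc : D.inv 1 * (D.inv 2 * z) = D.inv 1 * z - D.inv 2 * z := by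
  rw [← mul_assoc, inv12, sub_mul]
theorem inv_neg10_assoc : D.inv (-1) * (D.inv 0 * z) = D.inv (-1) * z - D.inv 0 * z := by
  rw [← mul_assoc, inv_neg10, sub_mul]
theorem x_inv0_assoc : D.x i * (D.inv 0 * z) = D.inv 1 * (D.x i * z) := by
  rw [← mul_assoc, x_inv0, mul_assoc]
theorem x_inv1_assoc : D.x i * (D.inv 1 * z) = D.inv 2 * (D.x i * z) := by
  rw [← mul_assoc, x_inv1, mul_assoc]
theorem p_inv0_assoc : D.p i * (D.inv 0 * z) = D.inv (-1) * (D.p i * z) := by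
  rw [← mul_assoc, p_inv0, mul_assoc]
theorem p_inv1_assoc : D.p i * (D.inv 1 * z) = D.inv 0 * (D.p i * z) := by
  rw [← mul_assoc, p_inv1, mul_assoc]
theorem g_inv_assoc (k : ℤ) : D.g i * (D.inv k * z) = D.inv k * (D.g i * z) := by
  rw [← mul_assoc, g_inv, mul_assoc]
theorem x_x_assoc : D.x i * (D.x j * z) = D.x j * (D.x i * z) := by
  rw [← mul_assoc, x_x, mul_assoc]
theorem p_p_assoc : D.p i * (D.p j * z) = D.p j * (D.p i * z) := by
  rw [← mul_assoc, p_p, mul_assoc]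
theorem p_g_assoc : D.p i * (D.g j * z) = D.g j * (D.p i * z) + D.inv 0 * (D.g i * (D.p j * z)) := by
  rw [← mul_assoc, p_g]
  simp only [add_mul, mul_assoc]
theorem g_g_assoc : D.g i * (D.g j * z) = -(D.g j * (D.g i * z))
    + (2 * (η : Matrix (Fin n) (Fin n) ℂ) i j) • z
    + (2 : ℂ) • (D.inv 1 * (D.x j * (D.p i * z)) + D.inv 1 * (D.x i * (D.p j * z))) := by
  rw [← mul_assoc, eq_sub_of_add_eq (D.g_g i j)]
  simp only [add_mul, sub_mul, mul_add, mul_assoc, smul_mul_assoc, one_mul]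
  abel
theorem p_x_assoc : D.p i * (D.x j * z) = D.x j * (D.p i * z)
    + (η : Matrix (Fin n) (Fin n) ℂ) i j • z + (1 / 2 : ℂ) • (D.inv 0 * (D.g i * (D.g j * z)))
    + D.inv 1 * (D.x i * (D.p j * z)) := by
  rw [← mul_assoc, p_x]
  simp only [add_mul, mul_assoc, smul_mul_assoc, one_mul]
theorem g_x_assoc : D.g i * (D.x j * z) = D.x j * (D.g i * z) + D.inv 1 * (D.x i * (D.g j * z)) := by
  rw [← mul_assoc, g_x]
  simp only [add_mul, mul_assoc]

end Assoc

/-! ### The Weyl-Clifford relations on sequences. -/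

theorem act_p_p (hη : (η : Matrix (Fin n) (Fin n) ℂ).IsSymm) (i j : Fin n) :
    D.actP i * D.actP j = D.actP j * D.actP i := by
  rw [← sub_eq_zero]
  refine eq_zero_of_shift 1 ?_ fun b => ?_
  · rw [mul_sub, ← mul_assoc, ← mul_assoc, shift_P, shift_P, mul_assoc, mul_assoc, shift_P, shift_P,
      sub_mul, one_smul, mul_assoc, mul_assoc]
  · change D.actP i (D.actP j b) 0 - D.actP j (D.actP i b) 0 = 0
    -- The rewriting brings every monomial to the order inverse of h, x, γ, ∂. Commuting pairs and
    -- γγ are swapped only for indices (j, i), which keeps it terminating. What is left is a linear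
    -- identity.
    simp only [P_apply, mul_sub, mul_smul_comm, x_inv0_assoc, x_inv1_assoc, p_inv0_assoc,
      p_inv1_assoc, g_inv_assoc, p_x_assoc, p_g_assoc, g_x_assoc, D.x_x_assoc _ j i,
      D.p_p_assoc _ j i, D.g_g_assoc _ j i, inv01_assoc, inv12_assoc,
      inv_neg10_assoc, mul_add, mul_neg, hη.apply i j]
    module

/-- Moving the shift across this commutator produces a commutator of two `actP` and a sign, hence ε
= -1. Each of the next relations similarly reduces to earlier ones, which fixes their order. -/
theorem act_g_p (hη : (η : Matrix (Fin n) (Fin n) ℂ).IsSymm) (i j : Fin n) :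
    D.actG i * D.actP j = D.actP j * D.actG i := by
  rw [← sub_eq_zero]
  refine eq_zero_of_shift (-1) ?_ fun b => ?_
  · have h := D.act_p_p hη i j
    rw [mul_sub, ← mul_assoc, ← mul_assoc, shift_P, shift_G, sub_mul, mul_assoc, mul_assoc,
      shift_P, shift_G, mul_sub, smul_mul_assoc, h, sub_mul]
    simp only [mul_smul_comm, mul_assoc]
    module
  · change D.actG i (D.actP j b) 0 - D.actP j (D.actG i b) 0 = 0
    simp only [P_apply, G_zero, G_one, G_two, mul_sub, mul_smul_comm, x_inv0_assoc, x_inv1_assoc,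
      zero_add,
      p_inv1_assoc, g_inv_assoc, p_x_assoc, p_g_assoc, g_x_assoc, D.x_x_assoc _ j i,
      D.g_g_assoc _ j i, inv01_assoc, inv12_assoc, mul_add, mul_neg, hη.apply i j]
    module

theorem act_g_g (hη : (η : Matrix (Fin n) (Fin n) ℂ).IsSymm) (i j : Fin n) :
    D.actG i * D.actG j + D.actG j * D.actG i
      = (2 * (η : Matrix (Fin n) (Fin n) ℂ) i j) • (1 : Module.End ℂ (ℕ → B)) := by
  rw [← sub_eq_zero]
  refine eq_zero_of_shift 1 ?_ fun b => ?_
  · have h := D.act_g_p hη i j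
    have h' := D.act_g_p hη j i
    have e : ∀ i j, shift B * (D.actG i * D.actG j) = D.actG i * D.actG j * shift B
        - (2 : ℂ) • (D.actG i * D.actP j) + (2 : ℂ) • (D.actP i * D.actG j) := fun i j => by
      rw [← mul_assoc, shift_G, sub_mul, mul_assoc, shift_G, mul_sub, smul_mul_assoc,
        mul_smul_comm, ← mul_assoc]
      abel
    rw [mul_sub, mul_add, e, e, h, h', mul_smul_comm, mul_one, sub_mul, add_mul, smul_mul_assoc,
      one_mul]
    module
  · change D.actG i (D.actG j b) 0 + D.actG j (D.actG i b) 0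
      - (2 * (η : Matrix (Fin n) (Fin n) ℂ) i j) • b 0 = 0
    simp only [P_apply, G_zero, G_one, mul_sub, mul_smul_comm, x_inv0_assoc, x_inv1_assoc,
      zero_add,
      g_inv_assoc, g_x_assoc, D.x_x_assoc _ j i,
      D.g_g_assoc _ j i, inv12_assoc, mul_add, mul_neg, hη.apply i j]
    module

theorem act_p_x (hη : (η : Matrix (Fin n) (Fin n) ℂ).IsSymm) (i j : Fin n) :
    D.actP i * D.actX j = D.actX j * D.actP i
      + ((η : Matrix (Fin n) (Fin n) ℂ) i j) • (1 : Module.End ℂ (ℕ → B)) := by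
  rw [← sub_eq_zero]
  refine eq_zero_of_shift 1 ?_ fun b => ?_
  · have h := D.act_g_p hη j i
    rw [mul_sub, mul_add, ← mul_assoc, ← mul_assoc, shift_P, shift_X, mul_assoc, shift_X, add_mul,
      mul_assoc _ _ (D.actP i), shift_P, h, mul_add, mul_smul_comm, mul_one, sub_mul, add_mul,
      smul_mul_assoc, one_mul]
    simp only [mul_assoc]
    module
  · change D.actP i (D.actX j b) 0 - (D.actX j (D.actP i b) 0
      + ((η : Matrix (Fin n) (Fin n) ℂ) i j) • b 0) = 0
    simp only [P_apply, G_zero, X_zero, X_one, X_two, mul_sub, mul_smul_comm, x_inv0_assoc,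
      x_inv1_assoc, zero_add,
      g_inv_assoc, p_x_assoc, g_x_assoc, D.x_x_assoc _ j i,
      inv01_assoc, inv12_assoc, mul_add]
    module

/-- Moving the shift across gives twice the commutator of ∂^i with x^j minus the anticommutator of
γ^i and γ^j; both equal 2η^{ij} and cancel. -/
theorem act_g_x (hη : (η : Matrix (Fin n) (Fin n) ℂ).IsSymm) (i j : Fin n) :
    D.actG i * D.actX j = D.actX j * D.actG i := by
  rw [← sub_eq_zero]
  refine eq_zero_of_shift (-1) ?_ fun b => ?_
  · have h := D.act_g_g hη i j
    have h' := D.act_p_x hη i j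
    rw [mul_sub, ← mul_assoc, ← mul_assoc, shift_G, shift_X, sub_mul, mul_assoc, shift_X,
      add_mul, mul_assoc _ _ (D.actG i), shift_G, mul_sub, mul_add, smul_mul_assoc, h', mul_smul_comm,
      eq_sub_of_add_eq h, sub_mul]
    simp only [mul_assoc]
    module
  · change D.actG i (D.actX j b) 0 - D.actX j (D.actG i b) 0 = 0
    simp only [G_zero, X_zero, X_one, mul_sub, x_inv1_assoc,
      g_x_assoc, D.x_x_assoc _ j i,
      inv12_assoc, mul_add]
    module

theorem act_x_x (hη : (η : Matrix (Fin n) (Fin n) ℂ).IsSymm) (i j : Fin n) :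
    D.actX i * D.actX j = D.actX j * D.actX i := by
  rw [← sub_eq_zero]
  refine eq_zero_of_shift 1 ?_ fun b => ?_
  · have h := D.act_g_x hη i j
    have h' := D.act_g_x hη j i
    rw [mul_sub, ← mul_assoc, ← mul_assoc, shift_X, shift_X, add_mul, add_mul, mul_assoc, shift_X,
      mul_assoc _ _ (D.actX i), shift_X, h, h', sub_mul]
    simp only [mul_add, mul_assoc]
    module
  · change D.x i * (D.x j * b 0) - D.x j * (D.x i * b 0) = 0
    rw [x_x_assoc, sub_self]

/-! ### Contractions that the relations force. -/

/-- Contracting the relation between γ and x gives (1 + 1/(h+1)) c = 0 for the contraction c; that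
is (h + 2) c = 0, and h + 2 is invertible. -/
theorem contract_x_g (hη : (η : Matrix (Fin n) (Fin n) ℂ).IsSymm) :
    contract η (fun i j => D.x i * D.g j) = 0 := by
  have h := D.contract_g_x
  simp only [g_x] at h
  rw [contract_add, contract_mul_left, contract_swap hη (fun i j => D.x i * D.g j)] at h
  set c := contract η (fun i j => D.x i * D.g j)
  have h1 : (D.h + algebraMap ℂ B (2 : ℤ)) * c = 0 := by
    calc (D.h + algebraMap ℂ B (2 : ℤ)) * c
        = (D.h + algebraMap ℂ B (1 : ℤ)) * (c + D.inv 1 * c) := by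
          rw [mul_add, ← mul_assoc _ (D.inv 1), D.mul_inv', one_mul, add_mul, add_mul]
          norm_num [map_ofNat]
          rw [add_assoc, ← two_mul]
      _ = 0 := by rw [h, mul_zero]
  rw [← one_mul c, ← D.inv_mul' 2, mul_assoc, h1, mul_zero]

/-- By symmetry of the metric, twice this contraction is the contraction of the anticommutator,
whose right-hand side is known from x^i ∂_i. -/
theorem contract_g_g (hη : (η : Matrix (Fin n) (Fin n) ℂ).IsSymm) :
    contract η (fun i j => D.g i * D.g j)
      = (n : ℂ) • (1 : B) + (2 : ℂ) • (D.inv 1 * ((-(n : ℂ) / 2) • (1 : B) - D.h)) := by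
  have h : (2 : ℂ) • contract η (fun i j => D.g i * D.g j) = (2 : ℂ) •
      ((n : ℂ) • (1 : B) + (2 : ℂ) • (D.inv 1 * ((-(n : ℂ) / 2) • (1 : B) - D.h))) := by
    rw [two_smul]
    nth_rewrite 2 [← contract_swap hη]
    rw [← contract_add]
    simp only [g_g, mul_smul]
    rw [contract_add, contract_smul, contract_eta hη, contract_smul, contract_mul_left,
      contract_add, contract_swap hη (fun i j => D.x i * D.p j), D.contract_x_p, smul_add, two_smul,
      mul_add, two_smul ℂ (_ + _)]
    module
  exact smul_right_injective B (two_ne_zero (α := ℂ)) h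

theorem contract_p_x (hη : (η : Matrix (Fin n) (Fin n) ℂ).IsSymm) :
    contract η (fun i j => D.p i * D.x j) = ((n : ℂ) / 2 - 1) • (1 : B) - D.h := by
  simp only [p_x]
  rw [contract_add, contract_add, contract_add, contract_swap hη (fun i j => D.x i * D.p j),
    contract_eta hη, contract_smul, contract_mul_left, contract_mul_left, D.contract_x_p,
    D.contract_g_g hη]
  simp only [mul_add, mul_sub, mul_smul_comm, mul_one, D.inv_h, D.inv01]
  push_cast
  module

/-- That x^i x_i = 0 is hidden in the relations. The doubly contracted products γγxx vanish in
either order of the γ's, because γ_k x^k = 0 and the x's commute. So the contracted anticommutator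
times xx vanishes, and expanding it gives a linear equation for x^i x_i with invertible coefficient.
-/
theorem contract_x_x (hη : (η : Matrix (Fin n) (Fin n) ℂ).IsSymm) :
    contract η (fun i j => D.x i * D.x j) = 0 := by
  have h1 : contract η (fun i j => contract η fun k l => D.g i * D.g k * D.x l * D.x j) = 0 := by
    have e : ∀ i j, contract η (fun k l => D.g i * D.g k * D.x l * D.x j) = 0 := fun i j => by
      simp only [mul_assoc (D.g i)]
      rw [contract_mul_left, contract_mul_right, D.contract_g_x, zero_mul, mul_zero]
    simp only [e]
    simp [contract]
  have h2 : contract η (fun i j => contract η fun k l => D.g k * D.g i * D.x l * D.x j) = 0 := by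
    rw [contract_comm, ← h1]
    refine congrArg (contract η) (funext₂ fun i j => congrArg (contract η) (funext₂ fun k l => ?_))
    rw [mul_assoc, D.x_x, ← mul_assoc]
  have h3 : contract η (fun i j => contract η fun k l => D.x i * D.p k * D.x l * D.x j)
      = ((n : ℂ) / 2 - 2) • contract η (fun i j => D.x i * D.x j)
        - D.h * contract η (fun i j => D.x i * D.x j) := by
    have hx : ∀ i, D.x i * D.h = D.h * D.x i + D.x i := fun i => by
      rw [D.h_x, mul_sub, mul_one, sub_add_cancel]
    have e : ∀ i j, contract η (fun k l => D.x i * D.p k * D.x l * D.x j)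
        = ((n : ℂ) / 2 - 2) • (D.x i * D.x j) - D.h * (D.x i * D.x j) := fun i j => by
      simp only [mul_assoc (D.x i)]
      rw [contract_mul_left, contract_mul_right, D.contract_p_x hη, ← mul_assoc, mul_sub, hx,
        mul_smul_comm, mul_one, sub_mul, add_mul, smul_mul_assoc, mul_assoc]
      module
    simp only [e]
    rw [contract_sub, contract_smul, contract_mul_left]
  have h4 : contract η (fun i j => contract η fun k l => D.x k * D.p i * D.x l * D.x j)
      = contract η (fun i j => contract η fun k l => D.x i * D.p k * D.x l * D.x j) := by
    rw [contract_comm]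
    refine congrArg (contract η) (funext₂ fun i j => congrArg (contract η) (funext₂ fun k l => ?_))
    rw [mul_assoc, D.x_x, ← mul_assoc]
  have h5 : contract η (fun i j => contract η fun k l =>
      (D.g i * D.g k + D.g k * D.g i) * (D.x l * D.x j)) = 0 := by
    simp only [add_mul, ← mul_assoc, contract_add, h1, h2, add_zero]
  simp only [g_g, add_mul, mul_smul, smul_mul_assoc, one_mul, contract_add, contract_smul, mul_add,
    ← mul_assoc] at h5
  rw [contract_contract_eta hη (fun l j => D.x l * D.x j)] at h5
  simp only [mul_assoc (D.inv 1), contract_mul_left, h3, h4] at h5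
  set Q := contract η fun i j => D.x i * D.x j
  -- Multiplying `h5` by -(h+1)/2 gives -(h+1) - (n-4) + 2h = h + 3 - n as the coefficient of Q.
  have h6 : (D.h + algebraMap ℂ B (3 - n : ℤ)) * Q = 0 := by
    have := congrArg (fun q => (-(1 / 2) : ℂ) • ((D.h + algebraMap ℂ B (1 : ℤ)) * q)) h5
    simp only [mul_add, mul_smul_comm, ← mul_assoc _ (D.inv 1), D.mul_inv', one_mul, add_mul,
      mul_zero, smul_zero, ← Algebra.smul_def] at this
    rw [add_mul, ← Algebra.smul_def, ← this]
    push_cast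
    module
  rw [← one_mul Q, ← D.inv_mul' (3 - n), mul_assoc, h6, mul_zero]

/-! ### The representation of the Weyl-Clifford algebra and of its localization. -/

noncomputable def genRep : Gen n → Module.End ℂ (ℕ → B)
  | .x i => D.actX i
  | .d i => ∑ j, ((η⁻¹ : GL (Fin n) ℂ) : Matrix (Fin n) (Fin n) ℂ) i j • D.actP j
  | .g i => D.actG i

noncomputable def freeRep : FreeAlgebra ℂ (Gen n) →ₐ[ℂ] Module.End ℂ (ℕ → B) :=
  FreeAlgebra.lift ℂ D.genRep

theorem rep_rel (hη : (η : Matrix (Fin n) (Fin n) ℂ).IsSymm) {a b : FreeAlgebra ℂ (Gen n)}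
    (h : WCRel η a b) : D.freeRep a = D.freeRep b := by
  cases h with
  | x_x i j => simp only [freeRep, map_mul, FreeAlgebra.lift_ι_apply, genRep, D.act_x_x hη i j]
  | d_d i j =>
    simp only [freeRep, map_mul, FreeAlgebra.lift_ι_apply, genRep, Finset.sum_mul, Finset.mul_sum,
      smul_mul_assoc, mul_smul_comm]
    simp only [Finset.smul_sum]
    rw [Finset.sum_comm]
    refine Finset.sum_congr rfl fun k _ => Finset.sum_congr rfl fun l _ => ?_
    rw [D.act_p_p hη, smul_comm]
  | d_x i j =>
    simp only [freeRep, map_add, map_mul, FreeAlgebra.lift_ι_apply, genRep, Finset.sum_mul,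
      Finset.mul_sum, smul_mul_assoc, mul_smul_comm, D.act_p_x hη, smul_add, smul_smul,
      Finset.sum_add_distrib, AlgHom.commutes]
    rw [← Finset.sum_smul, inv_mul_eta, Algebra.algebraMap_eq_smul_one]
  | g_x i j => simp only [freeRep, map_mul, FreeAlgebra.lift_ι_apply, genRep, D.act_g_x hη i j]
  | g_d i j =>
    simp only [freeRep, map_mul, FreeAlgebra.lift_ι_apply, genRep, Finset.sum_mul, Finset.mul_sum,
      smul_mul_assoc, mul_smul_comm, D.act_g_p hη]
  | g_g i j =>
    rw [AlgHom.commutes, Algebra.algebraMap_eq_smul_one, ← D.act_g_g hη i j]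
    simp only [freeRep, map_add, map_mul, FreeAlgebra.lift_ι_apply, genRep]

/-- The action of the Weyl-Clifford algebra on sequences. -/
noncomputable def rep (hη : (η : Matrix (Fin n) (Fin n) ℂ).IsSymm) :
    WC η →ₐ[ℂ] Module.End ℂ (ℕ → B) :=
  RingQuot.liftAlgHom ℂ ⟨D.freeRep, fun _ _ h => D.rep_rel hη h⟩

theorem rep_mk (hη : (η : Matrix (Fin n) (Fin n) ℂ).IsSymm) (a : FreeAlgebra ℂ (Gen n)) :
    D.rep hη (WC.mk η a) = D.freeRep a :=
  RingQuot.liftAlgHom_mkAlgHom_apply ℂ _ _ a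

section Rep
variable (hη : (η : Matrix (Fin n) (Fin n) ℂ).IsSymm)

theorem rep_x (i : Fin n) : D.rep hη (xU η i) = D.actX i := by
  rw [xU, rep_mk, freeRep, FreeAlgebra.lift_ι_apply]; rfl

theorem rep_g (i : Fin n) : D.rep hη (gU η i) = D.actG i := by
  rw [gU, rep_mk, freeRep, FreeAlgebra.lift_ι_apply]; rfl

theorem rep_d (i : Fin n) : D.rep hη (dL η i)
    = ∑ j, ((η⁻¹ : GL (Fin n) ℂ) : Matrix (Fin n) (Fin n) ℂ) i j • D.actP j := by
  rw [dL, rep_mk, freeRep, FreeAlgebra.lift_ι_apply]; rfl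

theorem rep_dU (i : Fin n) : D.rep hη (dU η i) = D.actP i := by
  simp only [dU, map_sum, map_smul, rep_d]
  exact sum_eta_inv_smul η _ i

/-- The contracted relations make every entry of b except b 1 drop out. The remaining coefficient is
-n/(2h) + (n/2 + h)/(h(h+1)) + (n/2 + h)/(h+1) = 1. -/
theorem rep_dirac_zero (b : ℕ → B) : D.rep hη (∑ i, gU η i * dL η i) b 0 = b 1 := by
  have e : D.rep hη (∑ i, gU η i * dL η i) b 0
      = contract η fun i j => D.actG i (D.actP j b) 0 := by
    simp only [map_sum, map_mul, rep_g, rep_d, Finset.mul_sum, mul_smul_comm, LinearMap.sum_apply,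
      LinearMap.smul_apply, Finset.sum_apply, Pi.smul_apply]
    rfl
  have hxg := D.contract_x_g hη
  have hxx := D.contract_x_x hη
  rw [e]
  simp only [G_zero, P_apply, mul_sub, mul_smul_comm, g_inv_assoc, x_inv0_assoc, x_inv1_assoc,
    ← mul_assoc (D.g _) (D.p _), ← mul_assoc (D.g _) (D.g _), ← mul_assoc (D.g _) (D.x _),
    ← mul_assoc (D.x _) (D.p _), ← mul_assoc (D.x _) (D.g _), ← mul_assoc (D.x _) (D.x _),
    contract_sub, contract_smul, contract_mul_left, contract_mul_right, D.contract_g_p,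
    D.contract_g_x, D.contract_x_p, D.contract_g_g hη, hxg, hxx, zero_mul, mul_zero]
  simp only [add_mul, sub_mul, smul_mul_assoc, one_mul, mul_assoc, mul_add, mul_sub, inv01_assoc,
    mul_smul_comm]
  have h0 : D.inv 0 * (D.h * b 1) = b 1 := by
    rw [← mul_assoc, inv_h, Int.cast_zero, zero_smul, sub_zero, one_mul]
  have h1 : D.inv 1 * (D.h * b 1) = b 1 - D.inv 1 * b 1 := by
    rw [← mul_assoc, inv_h, Int.cast_one, one_smul, sub_mul, one_mul]
  simp only [zero_add, h0, h1]
  module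

/-- Moving X across T gives XT = -TX + 2c ∂^i ∂_i; as X = cT, the nonzero factor 2c cancels. -/
theorem dirac_sq : (∑ i, gU η i * dL η i) * (∑ i, gU η i * dL η i) = ∑ i, dU η i * dL η i := by
  have hc : Complex.I / (Real.sqrt 2 : ℂ) ≠ 0 := fun h => by simpa [h] using c_sq
  have h : Xop η * (∑ i, gU η i * dL η i) = -((∑ i, gU η i * dL η i) * Xop η)
      + (2 * (Complex.I / (Real.sqrt 2 : ℂ))) • ∑ i, dU η i * dL η i := by
    simp only [Finset.mul_sum, Finset.sum_mul, Finset.smul_sum, ← Finset.sum_neg_distrib,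
      ← Finset.sum_add_distrib]
    refine Finset.sum_congr rfl fun i _ => ?_
    rw [← mul_assoc, X_g, add_mul, neg_mul, mul_assoc, X_d, mul_assoc, smul_mul_assoc]
  rw [Xop, smul_mul_assoc, mul_smul_comm, eq_neg_add_iff_add_eq, ← add_smul, ← two_mul] at h
  exact smul_right_injective _ (mul_ne_zero two_ne_zero hc) h

/-- By T² = ∂^i ∂_i and the rule for shifting γ, the operator T satisfies shift · T = 2T² - T ·
shift. If T acts as the shift at index k for all sequences, this equation gives the same at k + 1;
index 0 is `rep_dirac_zero`. -/
theorem rep_dirac : D.rep hη (∑ i, gU η i * dL η i) = shift B := by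
  set T := ∑ i, gU η i * dL η i
  have h : shift B * D.rep hη T = (2 : ℂ) • (D.rep hη T * D.rep hη T) - D.rep hη T * shift B := by
    rw [← map_mul, dirac_sq, map_sum, map_sum, Finset.mul_sum, Finset.sum_mul, Finset.smul_sum,
      ← Finset.sum_sub_distrib]
    refine Finset.sum_congr rfl fun i _ => ?_
    have hd : shift B * D.rep hη (dL η i) = D.rep hη (dL η i) * shift B := by
      simp only [rep_d, Finset.mul_sum, Finset.sum_mul, mul_smul_comm, smul_mul_assoc, shift_P]
    rw [map_mul, map_mul, rep_g, rep_dU, ← mul_assoc, shift_G, sub_mul, smul_mul_assoc, mul_assoc,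
      mul_assoc, hd]
  have key : ∀ k b, D.rep hη T b k = b (k + 1) := by
    intro k
    induction k with
    | zero => exact D.rep_dirac_zero hη
    | succ k ih =>
      intro b
      have e := congrFun (LinearMap.congr_fun h b) k
      change D.rep hη T b (k + 1) = (2 : ℂ) • D.rep hη T (D.rep hη T b) k
        - D.rep hη T (shift B b) k at e
      rw [ih, ih, shift_apply, two_smul, eq_sub_iff_add_eq, add_right_inj] at e
      exact e.symm
  ext b k
  exact key k b

theorem rep_X : D.rep hη (Xop η) = (Complex.I / (Real.sqrt 2 : ℂ)) • shift B := by
  rw [Xop, map_smul, rep_dirac]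

theorem rep_sum_x_d_zero (b : ℕ → B) :
    D.rep hη (∑ i, xU η i * dL η i) b 0 = (-(n : ℂ) / 2) • b 0 - D.h * b 0 := by
  have e : D.rep hη (∑ i, xU η i * dL η i) b 0
      = contract η fun i j => D.actX i (D.actP j b) 0 := by
    simp only [map_sum, map_mul, rep_x, rep_d, Finset.mul_sum, mul_smul_comm, LinearMap.sum_apply,
      LinearMap.smul_apply, Finset.sum_apply, Pi.smul_apply]
    rfl
  have hxg := D.contract_x_g hη
  have hxx := D.contract_x_x hη
  rw [e]
  simp only [X_zero, P_apply, mul_sub, mul_smul_comm, x_inv0_assoc, x_inv1_assoc,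
    ← mul_assoc (D.x _) (D.p _), ← mul_assoc (D.x _) (D.g _), ← mul_assoc (D.x _) (D.x _),
    contract_sub, contract_smul, contract_mul_left, contract_mul_right,
    D.contract_x_p, hxg, hxx, zero_mul, mul_zero]
  rw [sub_mul, smul_mul_assoc, one_mul]
  module

theorem Hop_eq : Hop η = (-(n : ℂ) / 2) • 1 - ∑ i, xU η i * dL η i := by
  rw [Hop, Finset.sum_add_distrib, sum_d_x, Algebra.algebraMap_eq_smul_one]
  module

/-- Index 0 comes from the contraction of x and ∂; since [H, X] = X and X is a multiple of the
shift, each further index lowers the value by 1. -/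
theorem rep_H (b : ℕ → B) (k : ℕ) : D.rep hη (Hop η) b k = D.h * b k - (k : ℂ) • b k := by
  induction k generalizing b with
  | zero =>
    rw [Hop_eq, map_sub, map_smul, map_one, LinearMap.sub_apply, Pi.sub_apply, rep_sum_x_d_zero]
    simp
  | succ k ih =>
    have hc : Complex.I / (Real.sqrt 2 : ℂ) ≠ 0 := fun h => by simpa [h] using c_sq
    have h := congrArg (D.rep hη) (H_X η)
    rw [map_add, map_mul, map_mul, rep_X, mul_smul_comm, smul_mul_assoc, ← smul_add] at h
    have e := congrFun (LinearMap.congr_fun (smul_right_injective _ hc h) b) k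
    change D.rep hη (Hop η) (shift B b) k = D.rep hη (Hop η) b (k + 1) + b (k + 1) at e
    rw [ih, shift_apply, ← sub_eq_iff_eq_add] at e
    rw [← e]
    push_cast
    module

/-- Every term at index 0 contains one of the contractions of γx, xγ, xx, and all three are zero. -/
theorem rep_Y_zero (b : ℕ → B) : D.rep hη (Yop η) b 0 = 0 := by
  have e : D.rep hη (∑ i, gU η i * xL η i) b 0
      = contract η fun i j => D.actG i (D.actX j b) 0 := by
    simp only [map_sum, map_mul, rep_x, rep_g, xL, Finset.mul_sum, mul_smul_comm, map_smul,
      LinearMap.sum_apply, LinearMap.smul_apply, Finset.sum_apply, Pi.smul_apply]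
    rfl
  have hxg := D.contract_x_g hη
  have hxx := D.contract_x_x hη
  rw [Yop, map_smul, LinearMap.smul_apply, Pi.smul_apply, e]
  simp only [X_zero, X_one, G_zero, mul_sub, mul_add, x_inv1_assoc,
    ← mul_assoc (D.g _) (D.x _), ← mul_assoc (D.x _) (D.g _), ← mul_assoc (D.x _) (D.x _),
    contract_sub, contract_add, contract_mul_left, contract_mul_right,
    D.contract_g_x, hxg, hxx, zero_mul, mul_zero, sub_zero, add_zero, smul_zero]

theorem rep_isUnit {s : WC η} (hs : s ∈ denoms η) : IsUnit (D.rep hη s) := by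
  induction hs using Submonoid.closure_induction with
  | mem s hs =>
    obtain ⟨k, rfl⟩ := hs
    -- H + k acts at index j as h + k - j, so its inverse is `inv (k - j)` in each entry.
    let T : Module.End ℂ (ℕ → B) :=
      { toFun := fun b j => D.inv (k - j) * b j
        map_add' := fun b b' => by ext j; simp [mul_add]
        map_smul' := fun c b => by ext j; simp }
    have e : ∀ b j, D.rep hη (Hop η + algebraMap ℂ (WC η) k) b j
        = (D.h + algebraMap ℂ B (k - j : ℤ)) * b j := by
      intro b j
      rw [map_add, AlgHom.commutes, LinearMap.add_apply, Pi.add_apply, rep_H,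
        Module.algebraMap_end_apply, Pi.smul_apply, add_mul, ← Algebra.smul_def]
      push_cast
      module
    refine isUnit_iff_exists.2 ⟨T, ?_, ?_⟩
    · ext b j
      change D.rep hη _ (T b) j = b j
      rw [e]
      change _ * (D.inv (k - j) * b j) = b j
      rw [← mul_assoc, D.mul_inv', one_mul]
    · ext b j
      change D.inv (k - j) * D.rep hη _ b j = b j
      rw [e, ← mul_assoc, D.inv_mul', one_mul]
  | one => rw [map_one]; exact isUnit_one
  | mul s t _ _ hs ht => rw [map_mul]; exact hs.mul ht

/-- The action of the localization `A'` on sequences. -/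
noncomputable def locRep : Loc η →+* Module.End ℂ (ℕ → B) :=
  OreLocalization.universalHom (D.rep hη : WC η →+* Module.End ℂ (ℕ → B))
    (IsUnit.liftRight ((D.rep hη : WC η →* Module.End ℂ (ℕ → B)).comp (denoms η).subtype)
      fun s => D.rep_isUnit hη s.2)
    fun _ => rfl

theorem locRep_toLoc (a : WC η) : D.locRep hη (toLoc η a) = D.rep hη a :=
  OreLocalization.universalHom_commutes _ _ _

theorem shift_eq_zero {b : ℕ → B} (h : shift B b = 0) : b = Pi.single 0 (b 0) := by
  ext k
  rcases k with _ | k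
  · simp
  · exact (congrFun h k).trans (by simp)

/-- A sequence supported at index 0 is killed by the shift, hence by X and by the left ideal that X
generates. -/
theorem locRep_leftIdeal {a : Loc η} (ha : a ∈ leftIdeal η) (c : B) :
    D.locRep hη a (Pi.single 0 c) = 0 := by
  induction ha using Submodule.span_induction with
  | mem a ha =>
    obtain ⟨a, ha, rfl⟩ := ha
    obtain ⟨b, rfl⟩ := gPlus_eq η ha
    rw [locRep_toLoc, map_mul, rep_X]
    have : shift B (Pi.single 0 c) = 0 := by
      ext k
      simp [shift_apply]
    rw [Module.End.mul_apply, LinearMap.smul_apply, this, smul_zero, map_zero]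
  | zero => rw [map_zero, LinearMap.zero_apply]
  | add a b _ _ ha hb => rw [map_add, LinearMap.add_apply, ha, hb, add_zero]
  | smul r a _ ha => rw [smul_eq_mul, map_mul, Module.End.mul_apply, ha, map_zero]

/-- Modulo the left ideal, an element of II is Y times something, and Y has no entry at index 0. -/
theorem locRep_doubleIdeal {a : Loc η} (ha : a ∈ doubleIdeal η) (c : B) :
    D.locRep hη a (Pi.single 0 c) 0 = 0 := by
  obtain ⟨b, hb⟩ := exists_of_mem_doubleIdeal η ha
  have h := congrFun (D.locRep_leftIdeal hη hb c) 0
  rw [map_sub, map_mul, LinearMap.sub_apply, Module.End.mul_apply, locRep_toLoc, Pi.sub_apply,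
    rep_Y_zero, sub_zero] at h
  exact h

/-- For a in the normalizer, Xa kills a sequence supported at index 0, so the shift kills its image
under a, which is therefore again supported at index 0. -/
theorem locRep_normalizer {a : Loc η} (ha : a ∈ normalizer η) (c : B) :
    D.locRep hη a (Pi.single 0 c) = Pi.single 0 (D.locRep hη a (Pi.single 0 c) 0) := by
  have hc : Complex.I / (Real.sqrt 2 : ℂ) ≠ 0 := fun h => by simpa [h] using c_sq
  refine shift_eq_zero ?_
  have h := D.locRep_leftIdeal hη ((mem_normalizer η).1 ha) c
  rw [map_mul, Module.End.mul_apply, locRep_toLoc, rep_X, LinearMap.smul_apply] at h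
  exact (smul_eq_zero.1 h).resolve_left hc

theorem locRep_hInv (k : ℤ) (b : ℕ → B) : D.locRep hη (hInv η k) b 0 = D.inv k * b 0 := by
  have h : (D.h + algebraMap ℂ B k) * D.locRep hη (hInv η k) b 0 = b 0 := by
    have e := congrFun (LinearMap.congr_fun (congrArg (D.locRep hη) (mul_hInv_cancel η k)) b) 0
    rw [map_mul, Module.End.mul_apply, ← AlgHom.commutes (toLoc η), ← map_add, locRep_toLoc,
      map_add, AlgHom.commutes, LinearMap.add_apply, Pi.add_apply, rep_H,
      Module.algebraMap_end_apply, Pi.smul_apply, map_one] at e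
    rw [add_mul, ← Algebra.smul_def]
    simpa using e
  rw [← h, ← mul_assoc, D.inv_mul', one_mul]

end Rep

end DiracData

/-! ### Injectivity of the map from the presented algebra. -/

section Completeness
variable {n : ℕ} (η : GL (Fin n) ℂ)

theorem Presented.of_rel {a b : PFree n} (h : PresRel η a b) :
    Presented.of η a = Presented.of η b :=
  RingQuot.mkAlgHom_rel ℂ h

theorem sum_smul_pgL (i : Fin n) :
    ∑ k, (η : Matrix (Fin n) (Fin n) ℂ) i k • pgL η k = pg i :=
  sum_eta_inv_smul η pg i

theorem sum_smul_pxL (i : Fin n) :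
    ∑ k, (η : Matrix (Fin n) (Fin n) ℂ) i k • pxL η k = px i :=
  sum_eta_inv_smul η px i

theorem sum_inv_smul_pdU (i : Fin n) :
    ∑ k, ((η⁻¹ : GL (Fin n) ℂ) : Matrix (Fin n) (Fin n) ℂ) i k • pdU η k = pd i :=
  sum_inv_eta_smul η pd i

/-- The generators of the presented algebra. -/
noncomputable def presentedData (hη : (η : Matrix (Fin n) (Fin n) ℂ).IsSymm) :
    DiracData η (Presented η) where
  x i := Presented.of η (px i)
  p i := Presented.of η (pdU η i)
  g i := Presented.of η (pg i)
  h := Presented.of η ph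
  inv k := Presented.of η (pinv k)
  inv_mul' k := by simpa using Presented.of_rel η (.inv_mul k)
  mul_inv' k := by simpa using Presented.of_rel η (.mul_inv k)
  h_x i := by simpa using Presented.of_rel η (.h_x i)
  h_p i := by
    have h := fun i => Presented.of_rel η (.h_d i)
    simp only [map_mul, map_add, map_one] at h
    simp only [pdU, map_sum, map_smul, Finset.mul_sum, Finset.sum_mul, mul_smul_comm,
      smul_mul_assoc, h]
  h_g i := by simpa using Presented.of_rel η (.h_g i)
  x_x i j := by simpa using Presented.of_rel η (.x_x i j)
  p_p i j := by
    have h := fun i j => Presented.of_rel η (.d_d i j)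
    simp only [map_mul] at h
    simp only [pdU, map_sum, map_smul, Finset.mul_sum, Finset.sum_mul, mul_smul_comm,
      smul_mul_assoc, Finset.smul_sum]
    rw [Finset.sum_comm]
    refine Finset.sum_congr rfl fun k _ => Finset.sum_congr rfl fun l _ => ?_
    rw [h, smul_comm]
  p_g i j := by
    have h := fun i j => Presented.of_rel η (.d_g i j)
    simp only [map_mul, map_sub, sub_eq_iff_eq_add'] at h
    rw [← sum_smul_pgL η i]
    nth_rewrite 1 [pdU]
    nth_rewrite 1 [pdU]
    simp only [map_sum, map_smul, Finset.mul_sum, Finset.sum_mul, mul_smul_comm,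
      smul_mul_assoc, h, smul_add, Finset.sum_add_distrib]
  g_g i j := by
    have h := Presented.of_rel η (.g_g i j)
    rw [Algebra.algebraMap_eq_smul_one] at h
    simpa only [map_mul, map_add, map_smul, map_one] using h
  p_x i j := by
    have h := fun i j => Presented.of_rel η (.d_x i j)
    simp only [map_mul, map_sub, map_add, map_smul, sub_eq_iff_eq_add',
      Algebra.algebraMap_eq_smul_one] at h
    have e : Presented.of η (pdU η i) * Presented.of η (px j)
        = ∑ k, (η : Matrix (Fin n) (Fin n) ℂ) i k • (Presented.of η (pd k) * Presented.of η (px j)) := by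
      simp only [pdU, map_sum, map_smul, Finset.sum_mul, smul_mul_assoc]
    simp only [e, h, smul_add, Finset.sum_add_distrib]
    rw [← add_assoc, ← add_assoc]
    congr 1
    · congr 1
      · congr 1
        · simp only [pdU, map_sum, map_smul, Finset.mul_sum, mul_smul_comm]
        · simp
      · rw [← sum_smul_pgL η i]
        simp only [map_sum, map_smul, Finset.mul_sum, Finset.sum_mul, mul_smul_comm,
          smul_mul_assoc, Finset.smul_sum, smul_comm (1 / 2 : ℂ)]
    · rw [← sum_smul_pxL η i]
      simp only [map_sum, map_smul, Finset.mul_sum, Finset.sum_mul, mul_smul_comm, smul_mul_assoc]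
  g_x i j := by
    have h := Presented.of_rel η (.g_x i j)
    rwa [map_sub, sub_eq_iff_eq_add', map_mul, map_mul, map_mul, map_mul] at h
  contract_x_p := by
    have h := Presented.of_rel η .sum_x_d
    rw [map_sub, AlgHom.commutes, Algebra.algebraMap_eq_smul_one, map_sum] at h
    rw [← h]
    refine Finset.sum_congr rfl fun i _ => ?_
    rw [← sum_inv_smul_pdU η i]
    simp only [map_mul, map_sum, map_smul, Finset.mul_sum, mul_smul_comm]
  contract_g_p := by
    have h := Presented.of_rel η .sum_g_d
    rw [map_zero, map_sum] at h
    rw [← h]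
    refine Finset.sum_congr rfl fun i _ => ?_
    rw [← sum_inv_smul_pdU η i]
    simp only [map_mul, map_sum, map_smul, Finset.mul_sum, mul_smul_comm]
  contract_g_x := by
    have h := Presented.of_rel η .sum_g_x
    rw [map_zero, map_sum] at h
    -- The given relation has the lowered index on γ and `contract` expands in the other order of
    -- indices; the symmetry of η reconciles them.
    rw [← contract_swap hη, ← h]
    refine Finset.sum_congr rfl fun i _ => ?_
    simp only [pgL, map_mul, map_sum, map_smul, Finset.sum_mul, smul_mul_assoc]

/-- The property is multiplicative and additive in f, so it is enough to have it on generators.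
Allowing every representative w of the class avoids descending the action to the quotient; `key`
shows that the choice is immaterial. -/
theorem locRep_freeToReduction (hη : (η : Matrix (Fin n) (Fin n) ℂ).IsSymm) (f : PFree n) :
    ∀ w : normalizer η, Ideal.Quotient.mk (normalizerIdeal η) w = freeToReduction η f →
      ∀ c, (presentedData η hη).locRep hη w (Pi.single 0 c)
        = Pi.single 0 (Presented.of η f * c) := by
  set D := presentedData η hη
  have key : ∀ (v w : normalizer η), Ideal.Quotient.mk (normalizerIdeal η) w
      = Ideal.Quotient.mk (normalizerIdeal η) v → ∀ c : Presented η,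
      D.locRep hη w (Pi.single 0 c) = D.locRep hη v (Pi.single 0 c) := by
    intro v w h c
    have h1 := D.locRep_leftIdeal hη (a := (w : Loc η) - v)
      ((Ideal.Quotient.eq (I := normalizerIdeal η)).1 h) c
    rwa [map_sub, LinearMap.sub_apply, sub_eq_zero] at h1
  induction f using FreeAlgebra.induction with
  | grade0 r =>
    intro w hw c
    rw [AlgHom.commutes] at hw
    rw [key (algebraMap ℂ _ r) w hw c, AlgHom.commutes]
    have e : ((algebraMap ℂ (normalizer η) r : normalizer η) : Loc η)
        = toLoc η (algebraMap ℂ (WC η) r) := rfl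
    rw [e, D.locRep_toLoc, AlgHom.commutes, Module.algebraMap_end_apply, ← Pi.single_smul,
      Algebra.smul_def]
  | grade1 v =>
    intro w hw c
    have e := reductionToDouble_freeToReduction_gen η v
    rw [← hw, reductionToDouble_mk] at e
    -- Only the entry at 0 matters for w in the normalizer, and that entry depends on w modulo II
    -- alone. So w may be replaced by the generator of A' itself, whose entry at 0 is known.
    have hb : ∀ u : Loc η, bar η u = genBar η v → D.locRep hη w (Pi.single 0 c) 0
        = D.locRep hη u (Pi.single 0 c) 0 := by
      intro u hu
      have h1 : (w : Loc η) - u ∈ doubleIdeal η :=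
        (Submodule.Quotient.eq _).1 (e.trans hu.symm)
      have h2 := D.locRep_doubleIdeal hη h1 c
      rwa [map_sub, LinearMap.sub_apply, Pi.sub_apply, sub_eq_zero] at h2
    rw [D.locRep_normalizer hη w.2]
    congr 1
    cases v with
    | x i => rw [hb _ rfl, D.locRep_toLoc, D.rep_x, D.X_zero, Pi.single_eq_same]; rfl
    | d i =>
      rw [hb _ rfl, D.locRep_toLoc, D.rep_d]
      simp only [LinearMap.sum_apply, LinearMap.smul_apply, Finset.sum_apply, Pi.smul_apply,
        D.P_apply, Pi.single_eq_same]
      simp only [ne_eq, not_false_eq_true, Pi.single_eq_of_ne, mul_zero,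
        smul_zero, sub_zero, zero_add, OfNat.ofNat_ne_zero, one_ne_zero]
      change _ = Presented.of η (pd i) * c
      rw [← sum_inv_smul_pdU η i]
      simp only [map_sum, map_smul, Finset.sum_mul, smul_mul_assoc]
      rfl
    | g i =>
      rw [hb _ rfl, D.locRep_toLoc, D.rep_g, D.G_zero, Pi.single_eq_same,
        Pi.single_eq_of_ne one_ne_zero, mul_zero, mul_zero, sub_zero]
      rfl
    | h =>
      rw [hb _ rfl, D.locRep_toLoc, D.rep_H, Pi.single_eq_same, Nat.cast_zero, zero_smul, sub_zero]
      rfl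
    | inv k => rw [hb _ rfl, D.locRep_hInv, Pi.single_eq_same]; rfl
  | mul a b ha hb =>
    intro w hw c
    obtain ⟨u, hu⟩ := Ideal.Quotient.mk_surjective (freeToReduction η a)
    obtain ⟨v, hv⟩ := Ideal.Quotient.mk_surjective (freeToReduction η b)
    rw [map_mul, ← hu, ← hv, ← map_mul] at hw
    rw [key _ _ hw, Subalgebra.coe_mul, map_mul, Module.End.mul_apply, hb v hv, ha u hu, map_mul,
      mul_assoc]
  | add a b ha hb =>
    intro w hw c
    obtain ⟨u, hu⟩ := Ideal.Quotient.mk_surjective (freeToReduction η a)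
    obtain ⟨v, hv⟩ := Ideal.Quotient.mk_surjective (freeToReduction η b)
    rw [map_add, ← hu, ← hv, ← map_add] at hw
    rw [key _ _ hw, Subalgebra.coe_add, map_add, LinearMap.add_apply, hb v hv, ha u hu, map_add,
      add_mul, Pi.single_add]

/-- Apart from the metric term, the Clifford relation is symmetric in i and j. So η^{ij} and η^{ji}
have the same image, which in a nonzero algebra forces them to be equal. -/
theorem presented_subsingleton (hη : ¬ (η : Matrix (Fin n) (Fin n) ℂ).IsSymm) :
    Subsingleton (Presented η) := by
  by_contra hs
  rw [not_subsingleton_iff_nontrivial] at hs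
  refine hη (Matrix.IsSymm.ext fun i j => ?_)
  have h := fun i j => Presented.of_rel η (.g_g i j)
  simp only [map_add, map_mul, map_smul, AlgHom.commutes] at h
  have h1 := h i j
  rw [add_comm, h j i, add_comm (Presented.of η (px i) * _), add_left_inj, ← map_mul,
    ← map_mul] at h1
  exact mul_left_cancel₀ two_ne_zero ((algebraMap ℂ (Presented η)).injective h1)

theorem presentedToReduction_injective : Function.Injective (presentedToReduction η) := by
  by_cases hη : (η : Matrix (Fin n) (Fin n) ℂ).IsSymm
  · rw [injective_iff_map_eq_zero]
    intro a ha
    obtain ⟨f, rfl⟩ := RingQuot.mkAlgHom_surjective ℂ (PresRel η) a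
    have h1 : Ideal.Quotient.mk (normalizerIdeal η) 0 = freeToReduction η f := by
      rw [← presentedToReduction_of, map_zero]; exact ha.symm
    -- If f maps to zero, the representative 0 acts as left multiplication by f; evaluate it at 1.
    have h := congrFun (locRep_freeToReduction η hη f 0 h1 1) 0
    rw [ZeroMemClass.coe_zero, map_zero, LinearMap.zero_apply, Pi.zero_apply, Pi.single_eq_same,
      mul_one] at h
    exact h.symm
  · have := presented_subsingleton η hη
    exact Function.injective_of_subsingleton _

/-- The isomorphism of the presented algebra with `Z_n'`. -/
noncomputable def presentedEquiv : Presented η ≃ₐ[ℂ] ReductionAlgebra η :=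
  AlgEquiv.ofBijective (presentedToReduction η)
    ⟨presentedToReduction_injective η, presentedToReduction_surjective η⟩

theorem reductionToDouble_presentedEquiv (g : PGen n) :
    reductionToDouble η (presentedEquiv η (Presented.of η (FreeAlgebra.ι ℂ g))) = genBar η g := by
  change reductionToDouble η (presentedToReduction η _) = _
  rw [presentedToReduction_of, reductionToDouble_freeToReduction_gen]

end Completeness
end DiracReduction

theorem mainTheorem1 (n : ℕ) (η : GL (Fin n) ℂ) :
    -- the double coset space with `◇` realizes the localized reduction algebra
    (Function.Bijective (reductionToDouble η)
      ∧ (∀ z w, reductionToDouble η (z * w) = reductionToDouble η z ◇ reductionToDouble η w)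
      ∧ (∀ z : normalizer η, cosetProjector η (bar η z) = Submodule.Quotient.mk (z : Loc η)))
    -- rational functions of `H`
    ∧ (∀ (p : Polynomial ℂ) (l : List ℤ),
      (∀ a : Loc η, bar η (ratH η p l) ◇ bar η a = bar η (ratH η p l * a)
        ∧ bar η a ◇ bar η (ratH η p l) = bar η (a * ratH η p l))
      ∧ (∀ i, bar η (ratH η p l) ◇ xBar η i
        = xBar η i ◇ bar η (ratH η (p.comp (Polynomial.X - 1)) (l.map (· - 1))))
      ∧ (∀ i, bar η (ratH η p l) ◇ dBar η i
        = dBar η i ◇ bar η (ratH η (p.comp (Polynomial.X + 1)) (l.map (· + 1))))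
      ∧ (∀ i, bar η (ratH η p l) ◇ gBar η i = gBar η i ◇ bar η (ratH η p l)))
    -- relations between the generators
    ∧ (∀ i j,
      xBar η i ◇ xBar η j = xBar η j ◇ xBar η i
      ∧ dBar η i ◇ dBar η j = dBar η j ◇ dBar η i
      ∧ dBar η i ◇ gBar η j - gBar η j ◇ dBar η i
        = bar η (hInv η 0) ◇ (gLBar η i ◇ dUBar η j)
      ∧ gBar η i ◇ gBar η j + gBar η j ◇ gBar η i
        = (2 * (η : Matrix (Fin n) (Fin n) ℂ) i j) • bar η 1
          + (2 : ℂ) • (bar η (hInv η 1) ◇ (xBar η j ◇ dUBar η i + xBar η i ◇ dUBar η j))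
      ∧ dBar η i ◇ xBar η j - xBar η j ◇ dBar η i
        = (if i = j then (1 : ℂ) else 0) • bar η 1
          + (1 / 2 : ℂ) • (bar η (hInv η 0) ◇ (gLBar η i ◇ gBar η j))
          + bar η (hInv η 1) ◇ (xLBar η i ◇ dUBar η j)
      ∧ gBar η i ◇ xBar η j - xBar η j ◇ gBar η i
        = bar η (hInv η 1) ◇ (xBar η i ◇ gBar η j))
    ∧ ∑ i, xBar η i ◇ dBar η i = bar η (algebraMap ℂ _ (-(n : ℂ) / 2) - toLoc η (Hop η))
    ∧ ∑ i, gBar η i ◇ dBar η i = 0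
    ∧ ∑ i, gLBar η i ◇ xBar η i = 0
    -- completeness
    ∧ ∃ Φ : Presented η ≃ₐ[ℂ] ReductionAlgebra η,
      (∀ i, reductionToDouble η (Φ (Presented.of η (px i))) = xBar η i)
      ∧ (∀ i, reductionToDouble η (Φ (Presented.of η (pd i))) = dBar η i)
      ∧ (∀ i, reductionToDouble η (Φ (Presented.of η (pg i))) = gBar η i)
      ∧ reductionToDouble η (Φ (Presented.of η ph)) = bar η (toLoc η (Hop η))
      ∧ (∀ k, reductionToDouble η (Φ (Presented.of η (pinv k))) = bar η (hInv η k)) := by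
  refine ⟨⟨reductionToDouble_bijective η, reductionToDouble_mul η, cosetProjector_bar η⟩,
    fun p l => ⟨fun a => ⟨diamond_of_left η (ratH_mem_leftNormalizer η p l) a,
      diamond_of_right η a (ratH_mem_normalizer η p l)⟩, ratH_xBar η p l, ratH_dBar η p l,
      ratH_gBar η p l⟩,
    fun i j => ⟨x_x_diamond η i j, d_d_diamond η i j, d_g_diamond η i j, g_g_diamond η i j,
      d_x_diamond η i j, g_x_diamond η i j⟩,
    sum_x_d_diamond η, sum_g_d_diamond η, sum_g_x_diamond η,
    presentedEquiv η, fun i => reductionToDouble_presentedEquiv η (.x i),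
    fun i => reductionToDouble_presentedEquiv η (.d i),
    fun i => reductionToDouble_presentedEquiv η (.g i), reductionToDouble_presentedEquiv η .h,
    fun k => reductionToDouble_presentedEquiv η (.inv k)⟩
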